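/- **Setting.** Let $D\subset\mathbb R^d$ be a bounded, open, connected set, $U=\mathbb R^N$, $1\le p<\infty$, $0<T<\infty$, $f=(f^1,\dots,f^d)$ with $f^m:U\to U$, and $q\in\mathbb N$. $L^p(D;U)$ carries its Borel $\sigma$-algebra, and $B_r(x)$ denotes the ball in $D$, i.e. $\{y\in D:|x-y|<r\}$. *Correlation measures.* A correlation measure on $D$ is a family $\boldsymbol\nu=(\nu^1,\nu^2,\dots)$ of weak*-measurable maps $\nu^k$ from $D^k$ to measures on $U^k$, with $\nu^k_x$ a probability measure for a.e. $x$, which is symmetric (for every permutation $\sigma$, for a.e. $x$, $\nu^k_{\sigma(x)}$ is the image of $\nu^k_x$ under $\xi\mapsto\sigma(\xi)$), consistent (for a.e. $x$, the image of $\nu^{k+1}_x$ under dropping the last variable is $\nu^k_{x_1,\dots,x_k}$), has $\int_D\langle\nu^1_x,|\xi|^p\rangle dx<\infty$, and satisfies $\omega^p_r(\nu^2):=\int_D\frac1{|B_r(x)|}\int_{B_r(x)}\langle\nu^2_{x,y},|\xi_1-\xi_2|^p\rangle\,dy\,dx\to0$ as $r\to0$. A time-dependent correlation measure on $[0,T)$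 is a family of maps $\nu^k=\nu^k_{t,x}$, weak*-measurable in $(t,x)\in[0,T)\times D^k$, such that $(\nu^1_t,\nu^2_t,\dots)$ is a correlation measure for a.e. $t$, $\operatorname{ess\,sup}_t\int_D\langle\nu^1_{t,x},|\xi|^p\rangle dx<\infty$, and $\int_0^{T'}\omega_r^p(\nu^2_t)\,dt\to0$ as $r\to0$ for every $T'\in(0,T)$. $\mathcal P_T(L^p(D;U))$ is the set of maps $\mu:[0,T)\to\mathcal P(L^p(D;U))$ that are dual to some time-dependent correlation measure $\boldsymbol\nu$: for a.e. $t$, all $k\ge1$ and all $g\in L^1(D^k;C_0(U^k))$, $\int_{D^k}\langle\nu^k_{t,x},g(x)\rangle dx=\int_{L^p}\int_{D^k}g(x,u(x_1),\dots,u(x_k))\,dx\,d\mu_t(u)$. *Observables.* $\mathcal H^{k,p}$ is the set of Carathéodory functions $g:[0,T)\times D^k\times U^k\to\mathbb R$ with $|g(t,x,\xi)|\le\sum_{\alpha\in\{0,1\}^k}\phi_{k-|\alpha|}\big(t,(x_i)_{\alpha_i=0}\big)\prod_{\alpha_i=1}|\xi_i|^p$ for a.e. $(t,x)$ and all $\xi$,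 with nonnegative $\phi_j\in L^\infty([0,T);L^1(D^j))$. $\mathcal H^{k,p}_1$ is the set of $g\in\mathcal H^{k,p}$ for which there are $0\le\psi\in L^\infty([0,T))$ and $0\le h\in\mathcal H^{k-1,p}$ with $$|g(t,x,\zeta)-g(t,x,\xi)|\le\psi(t)\sum_{i=1}^k|\zeta_i-\xi_i|\max(|\xi_i|,|\zeta_i|)^{p-1}h(t,\hat x^i,\hat\xi^i)$$ for a.e. $(t,x)$ and all $\xi,\zeta\in U^k$, where $\hat{\ }^i$ removes the $i$-th entry. A sequence $\mu^j\in\mathcal P_T(L^p(D;U))$ *converges strongly* to $\mu\in\mathcal P_T(L^p(D;U))$ if, for the dual $\boldsymbol\nu_j,\boldsymbol\nu$, every $k\ge1$ and every $g\in\mathcal H^{k,p}_1$, the function $g$ is absolutely integrable on $[0,T)\times D^k\times U^k$ against $\nu^k_{j;t,x}\,dx\,dt$ and $\nu^k_{t,x}\,dx\,dt$, and $\int_{D^k}\big|\int_0^T\langle\nu^k_{j;t,x}-\nu^k_{t,x},g(t,x)\rangle\,dt\big|\,dx\to0$. *Scheme.* Let $\Delta_n>0$, $\Delta_n\to0$.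 For each $\Delta=\Delta_n$ take a Cartesian mesh of $\mathbb R^d$ of cells $\mathcal C_i$, $i\in\mathbb Z^d$, of side $\Delta$, and let $I$ be the set of $i$ with $\mathcal C_i\subset D$ (open cells). For each direction $m=1,\dots,d$ let $F^{m,\Delta}:U^{2q}\to U$ be Lipschitz on bounded sets and consistent, $F^{m,\Delta}(v,\dots,v)=f^m(v)$. The values in the cells $i\notin I$ are prescribed by an arbitrary boundary treatment, i.e. as functions of $(u_j)_{j\in I}$ that are Lipschitz on bounded sets (for instance $0$). Let $\bar u_i$ be the average of $\bar u\in L^p(D;U)$ over $\mathcal C_i$ if $i\in I$ and $\bar u_i=0$ otherwise. Assume that for every $\bar u\in L^p(D;U)$ the semi-discrete scheme $$\frac{d}{dt}u_i^\Delta+\sum_{m=1}^d\frac1\Delta\Big(F^{m,\Delta}(u^\Delta_{i-(q-1)e_m},\dots,u^\Delta_{i+qe_m})-F^{m,\Delta}(u^\Delta_{i-qe_m},\dots,u^\Delta_{i+(q-1)e_m})\Big)=0,\qquad u_i^\Delta(0)=\bar u_i\qquad(i\in I)$$ has a solution on $[0,T)$. Let $\mathcal S_t^\Delta\bar u\in L^p(D;U)$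 be the function equal to $u_i^\Delta(t)$ on $D\cap\mathcal C_i$. For a map $\mu:[0,T)\to\mathcal P(L^p(D;U))$ let $$S_r^p(\mu)=\Big(\int_0^T\int_{L^p}\int_D\frac1{|B_r(x)|}\int_{B_r(x)}|u(x)-u(y)|^p\,dy\,dx\,d\mu_t(u)\,dt\Big)^{1/p}.$$ **Theorem 4.1.** Let $\bar\mu\in\mathcal P(L^p(D;U))$ have support in a ball of radius $R>0$ around $0$, and let $\mu_t^{\Delta}=\mathcal S_t^{\Delta}\#\bar\mu$. Assume, with constants independent of $n$ and writing $\Delta=\Delta_n$: (i) there is $C$ with $\Delta^d\sum_{i\in\mathbb Z^d}|u_i^\Delta(t)|^p\le C\Delta^d\sum_{i\in\mathbb Z^d}|\bar u_i|^p$ for all $t\in[0,T)$ and all $\bar u\in L^p(D;U)$; (ii) there is $s\ge p$ such that for every $K$ there is $C$ with $\Delta^d\int_0^T\sum_{m=1}^d\sum_{i\in\mathbb Z^d}|u^\Delta_{i+e_m}(t)-u_i^\Delta(t)|^s\,dt\le C\Delta$ for all $\bar u$ with $\|\bar u\|_{L^p}\le K$; (iii) there is $C$, possibly depending on $\bar\mu$,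 with $S^p_{\ell\Delta}(\mu^\Delta)\le C\ell^{1/s}S^p_\Delta(\mu^\Delta)$ for all $\ell>1$. Then there are a subsequence $\Delta'\to0$ of $(\Delta_n)$ and $\mu\in\mathcal P_T(L^p(D;U))$ such that $\mu^{\Delta'}$ converges strongly to $\mu$. -/

import Mathlib

open MeasureTheory Filter Topology Set
open scoped ENNReal NNReal ZeroAtInfty BoundedContinuousFunction

noncomputable section

namespace StatSol

/-! ## Basic spaces -/

/-- The physical space `ℝ^d`. -/
abbrev Space (d : ℕ) := EuclideanSpace ℝ (Fin d)

/-- The phase space `U = ℝ^N`. -/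
abbrev State (N : ℕ) := EuclideanSpace ℝ (Fin N)

/-- The space `L^p(D; U)`. -/
abbrev LpState {d : ℕ} (N : ℕ) (p : ℝ≥0∞) (D : Set (Space d)) :=
  Lp (State N) p ((volume : Measure (Space d)).restrict D)

/-- `L^p(D; U)` carries its Borel sigma-algebra. -/
instance {d N : ℕ} {p : ℝ≥0∞} {D : Set (Space d)} [Fact (1 ≤ p)] :
    MeasurableSpace (LpState N p D) := borel _

instance {d N : ℕ} {p : ℝ≥0∞} {D : Set (Space d)} [Fact (1 ≤ p)] :
    BorelSpace (LpState N p D) := ⟨rfl⟩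

/-- Lebesgue measure on the product domain `D^k`. -/
def volPow {d : ℕ} (D : Set (Space d)) (k : ℕ) : Measure (Fin k → Space d) :=
  Measure.pi fun _ => (volume : Measure (Space d)).restrict D

/-- Lebesgue measure on the time interval `[0,T)`. -/
def timeVol (T : ℝ) : Measure ℝ := (volume : Measure ℝ).restrict (Ico 0 T)

/-! ## Correlation measures -/

/-- A family `(ν^1, ν^2, …)` of measure-valued maps `ν^k : D^k → M(U^k)`.
The entry with index `0` plays no role. -/
abbrev CorrFamily (d N : ℕ) := (k : ℕ) → (Fin k → Space d) → Measure (Fin k → State N)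

/-- A time-dependent family of measure-valued maps `ν^k : [0,T) × D^k → M(U^k)`. -/
abbrev TimeCorrFamily (d N : ℕ) :=
  (k : ℕ) → ℝ → (Fin k → Space d) → Measure (Fin k → State N)

/-- The average `⨍_{B_r(x)} F(y) dy` over the ball `B_r(x) = {y ∈ D | |x - y| < r}` in `D`. -/
def ballAverage {d : ℕ} (D : Set (Space d)) (x : Space d) (r : ℝ) (F : Space d → ℝ≥0∞) : ℝ≥0∞ :=
  (∫⁻ y in Metric.ball x r ∩ D, F y) / volume (Metric.ball x r ∩ D)

/-- The modulus of continuity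
`ω_r^p(ν²) = ∫_D ⨍_{B_r(x)} ⟨ν²_{x,y}, |ξ₁ - ξ₂|^p⟩ dy dx`, with `B_r(x)` the ball in `D`. -/
def corrModulus {d N : ℕ} (p : ℝ≥0∞) (D : Set (Space d))
    (ν2 : (Fin 2 → Space d) → Measure (Fin 2 → State N)) (r : ℝ) : ℝ≥0∞ :=
  ∫⁻ x in D, ballAverage D x r fun y => ∫⁻ ξ, ‖ξ 0 - ξ 1‖ₑ ^ p.toReal ∂(ν2 ![x, y])

/-- The `p`-th moment `∫_D ⟨ν¹_x, |ξ|^p⟩ dx`. -/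
def corrMoment {d N : ℕ} (p : ℝ≥0∞) (D : Set (Space d))
    (ν1 : (Fin 1 → Space d) → Measure (Fin 1 → State N)) : ℝ≥0∞ :=
  ∫⁻ x, ∫⁻ ξ, ‖ξ 0‖ₑ ^ p.toReal ∂(ν1 x) ∂(volPow D 1)

/-- Correlation measures from `D` to `U = ℝ^N`. -/
structure IsCorrelationMeasure {d N : ℕ} (p : ℝ≥0∞) (D : Set (Space d))
    (ν : CorrFamily d N) : Prop where
  prob : ∀ k, 1 ≤ k → ∀ᵐ x ∂(volPow D k), IsProbabilityMeasure (ν k x)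
  meas : ∀ k, 1 ≤ k → ∀ f : (Fin k → State N) →ᵇ ℝ,
    AEMeasurable (fun x => ∫ ξ, f ξ ∂(ν k x)) (volPow D k)
  /-- Symmetry: the law at the permuted points is the permuted law. -/
  symm : ∀ k, 1 ≤ k → ∀ (σ : Equiv.Perm (Fin k)) (f : C₀((Fin k → State N), ℝ)),
    ∀ᵐ x ∂(volPow D k), ∫ ξ, f ξ ∂(ν k (x ∘ σ)) = ∫ ξ, f (ξ ∘ σ) ∂(ν k x)
  consistent : ∀ k, 1 ≤ k → ∀ g : C₀((Fin k → State N), ℝ),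
    ∀ᵐ x ∂(volPow D (k + 1)),
      ∫ ξ, g (fun i => ξ i.castSucc) ∂(ν (k + 1) x)
        = ∫ ξ, g ξ ∂(ν k (fun i => x i.castSucc))
  moment : corrMoment p D (ν 1) < ∞
  diag : Tendsto (fun r => corrModulus p D (ν 2) r) (𝓝[>] 0) (𝓝 0)

/-- Time-dependent correlation measures, the set `𝓛^p([0,T), D; U)`. The maps are
weak*-measurable in `(t, x)`; as they take probability values almost everywhere they are
elements of `L^∞_w([0,T) × D^k; M(U^k))`. -/
structure IsTimeCorrelationMeasure {d N : ℕ} (p : ℝ≥0∞) (D : Set (Space d)) (T : ℝ)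
    (ν : TimeCorrFamily d N) : Prop where
  meas : ∀ k, 1 ≤ k → ∀ f : C₀((Fin k → State N), ℝ),
    AEMeasurable (fun q : ℝ × (Fin k → Space d) => ∫ ξ, f ξ ∂(ν k q.1 q.2))
      ((timeVol T).prod (volPow D k))
  slice : ∀ᵐ t ∂(timeVol T), IsCorrelationMeasure p D (fun k => ν k t)
  moment : ∃ c : ℝ≥0, ∀ᵐ t ∂(timeVol T), corrMoment p D (ν 1 t) ≤ c
  diag : ∀ T' ∈ Ioo 0 T,
    Tendsto (fun r => ∫⁻ t, corrModulus p D (ν 2 t) r ∂(timeVol T')) (𝓝[>] 0) (𝓝 0)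

/-! ## Time-parameterized probability measures on `L^p(D; U)` -/

/-- `μ : [0,T) → P(L^p(D;U))` is dual to the time-dependent family `ν`: for a.e. `t`, every
`k ≥ 1` and every `g ∈ L¹(D^k; C₀(U^k))`,
`∫_{D^k} ⟨ν^k_{t,x}, g(x)⟩ dx = ∫_{L^p} ∫_{D^k} g(x, u(x)) dx dμ_t(u)`. -/
def IsDual {d N : ℕ} {p : ℝ≥0∞} [Fact (1 ≤ p)] {D : Set (Space d)} (T : ℝ)
    (μ : ℝ → Measure (LpState N p D)) (ν : TimeCorrFamily d N) : Prop :=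
  ∀ᵐ t ∂(timeVol T), ∀ k, 1 ≤ k →
    ∀ g : (Fin k → Space d) → C₀((Fin k → State N), ℝ), Integrable g (volPow D k) →
      ∫ x, (∫ ξ, g x ξ ∂(ν k t x)) ∂(volPow D k)
        = ∫ u : LpState N p D, (∫ x, g x (fun i => u (x i)) ∂(volPow D k)) ∂(μ t)

/-- `μ` is a map from `[0,T)` to probability measures on `L^p(D;U)` and `ν` is a
time-dependent correlation measure dual to it. -/
structure HasCorrelationMeasure {d N : ℕ} {p : ℝ≥0∞} [Fact (1 ≤ p)] {D : Set (Space d)}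
    (T : ℝ) (μ : ℝ → Measure (LpState N p D)) (ν : TimeCorrFamily d N) : Prop where
  prob : ∀ t ∈ Ico 0 T, IsProbabilityMeasure (μ t)
  corr : IsTimeCorrelationMeasure p D T ν
  dual : IsDual T μ ν

/-- The set `P_T(L^p(D;U))`. -/
def MemPT {d N : ℕ} {p : ℝ≥0∞} [Fact (1 ≤ p)] {D : Set (Space d)} (T : ℝ)
    (μ : ℝ → Measure (LpState N p D)) : Prop :=
  ∃ ν : TimeCorrFamily d N, HasCorrelationMeasure T μ ν

/-! ## Observables -/

/-- The class `H^{k,p}([0,T), D; U)`: Carathéodory functions with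
`|g(t,x,ξ)| ≤ ∑_{α ∈ {0,1}^k} φ_{k-|α|}(t, x_{1-α}) |ξ^α|^p` for nonnegative
`φ_j ∈ L^∞([0,T); L¹(D^j))`. A multi-index `α` is encoded by the set `A = {i | α_i = 1}`. -/
structure IsObservable {d N : ℕ} (p : ℝ≥0∞) (D : Set (Space d)) (T : ℝ) (k : ℕ)
    (g : ℝ → (Fin k → Space d) → (Fin k → State N) → ℝ) : Prop where
  meas : ∀ ξ, AEMeasurable (fun q : ℝ × (Fin k → Space d) => g q.1 q.2 ξ)
    ((timeVol T).prod (volPow D k))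
  cont : ∀ᵐ q ∂((timeVol T).prod (volPow D k)), Continuous (g q.1 q.2)
  bound : ∃ φ : (j : ℕ) → ℝ → (Fin j → Space d) → ℝ≥0,
    (∀ j, AEMeasurable (fun q : ℝ × (Fin j → Space d) => φ j q.1 q.2)
      ((timeVol T).prod (volPow D j))) ∧
    (∀ j, ∃ C : ℝ≥0, ∀ᵐ t ∂(timeVol T), ∫⁻ x, (φ j t x : ℝ≥0∞) ∂(volPow D j) ≤ C) ∧
    ∀ᵐ q ∂((timeVol T).prod (volPow D k)), ∀ ξ,
      |g q.1 q.2 ξ| ≤ ∑ A : Finset (Fin k),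
        (φ (Aᶜ).card q.1 (fun j => q.2 ((Aᶜ).orderEmbOfFin rfl j)) : ℝ)
          * ∏ i ∈ A, ‖ξ i‖ ^ p.toReal

/-- The class `H_1^{k+1,p}([0,T), D; U)` of observables in `k + 1` points that are locally
Lipschitz continuous in the phase variable, with
`|g(t,x,ζ) - g(t,x,ξ)| ≤ ψ(t) ∑_i |ζ_i - ξ_i| max(|ξ_i|,|ζ_i|)^{p-1} h(t, x̂^i, ξ̂^i)`
for a nonnegative `ψ ∈ L^∞([0,T))` and a nonnegative `h ∈ H^{k,p}([0,T), D; U)`, where the hat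
removes the `i`-th entry. -/
def IsLipObservable {d N : ℕ} (p : ℝ≥0∞) (D : Set (Space d)) (T : ℝ) (k : ℕ)
    (g : ℝ → (Fin (k + 1) → Space d) → (Fin (k + 1) → State N) → ℝ) : Prop :=
  IsObservable p D T (k + 1) g ∧
  ∃ (ψ : ℝ → ℝ≥0) (h : ℝ → (Fin k → Space d) → (Fin k → State N) → ℝ),
    AEMeasurable ψ (timeVol T) ∧ (∃ C : ℝ≥0, ∀ᵐ t ∂(timeVol T), ψ t ≤ C) ∧
    IsObservable p D T k h ∧ (∀ t x ξ, 0 ≤ h t x ξ) ∧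
    ∀ᵐ q ∂((timeVol T).prod (volPow D (k + 1))), ∀ ζ ξ,
      |g q.1 q.2 ζ - g q.1 q.2 ξ| ≤ (ψ q.1 : ℝ) * ∑ i, ‖ζ i - ξ i‖
        * max ‖ξ i‖ ‖ζ i‖ ^ (p.toReal - 1)
        * h q.1 (fun j => q.2 (i.succAbove j)) (fun j => ξ (i.succAbove j))

/-- The observable `g` is absolutely integrable against `ν^k` over `[0,T) × D^k × U^k`. -/
def ObsIntegrable {d N : ℕ} (D : Set (Space d)) (T : ℝ) (k : ℕ)
    (g : ℝ → (Fin k → Space d) → (Fin k → State N) → ℝ) (ν : TimeCorrFamily d N) : Prop :=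
  ∫⁻ t, ∫⁻ x, ∫⁻ ξ, ‖g t x ξ‖ₑ ∂(ν k t x) ∂(volPow D k) ∂(timeVol T) < ∞

/-- Strong convergence of `μ_j` to `μ` in `P_T(L^p(D;U))`: for the dual correlation measures
`ν_j` and `ν`, every `k ≥ 1` and every `g` in `H_1^{k,p}([0,T), D; U)`,
`∫_{D^k} |∫_0^T ⟨ν^k_{j;t,x} - ν^k_{t,x}, g(t,x)⟩ dt| dx → 0`, all pairings being absolutely
convergent. -/
def ConvergesStrongly {d N : ℕ} {p : ℝ≥0∞} [Fact (1 ≤ p)] {D : Set (Space d)} (T : ℝ)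
    (μs : ℕ → ℝ → Measure (LpState N p D)) (μ : ℝ → Measure (LpState N p D)) : Prop :=
  ∃ (νs : ℕ → TimeCorrFamily d N) (ν : TimeCorrFamily d N),
    (∀ j, HasCorrelationMeasure T (μs j) (νs j)) ∧ HasCorrelationMeasure T μ ν ∧
    ∀ (k : ℕ) (g : ℝ → (Fin (k + 1) → Space d) → (Fin (k + 1) → State N) → ℝ),
      IsLipObservable p D T k g →
        (∀ j, ObsIntegrable D T (k + 1) g (νs j)) ∧ ObsIntegrable D T (k + 1) g ν ∧
        Tendsto (fun j => ∫⁻ x,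
            ‖∫ t, ((∫ ξ, g t x ξ ∂(νs j (k + 1) t x)) - ∫ ξ, g t x ξ ∂(ν (k + 1) t x))
              ∂(timeVol T)‖ₑ ∂(volPow D (k + 1)))
          atTop (𝓝 0)

/-! ## Meshes -/

/-- An equidistant Cartesian mesh of `ℝ^d` with cells of side length `size`. -/
structure Mesh (d : ℕ) where
  origin : Space d
  size : ℝ
  size_pos : 0 < size

namespace Mesh

variable {d : ℕ}

/-- The open cell with index `i ∈ ℤ^d`. -/
def cell (M : Mesh d) (i : Fin d → ℤ) : Set (Space d) :=
  {x | ∀ m, M.origin m + M.size * i m < x m ∧ x m < M.origin m + M.size * (i m + 1)}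

/-- The indices of the cells of the discretization of `D`: those contained in `D`. -/
def interior (M : Mesh d) (D : Set (Space d)) : Set (Fin d → ℤ) := {i | M.cell i ⊆ D}

/-- The index of the (half-open) cell containing `x`. -/
def index (M : Mesh d) (x : Space d) : Fin d → ℤ := fun m => ⌊(x m - M.origin m) / M.size⌋

/-- The piecewise constant function with the given cell values. -/
def piecewiseConst {N : ℕ} (M : Mesh d) (v : (Fin d → ℤ) → State N) (x : Space d) : State N :=
  v (M.index x)

open Classical in
/-- Cell averages of `u ∈ L^p(D;U)` over the cells contained in `D`, and `0` for the
remaining indices. -/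
def cellAverage {N : ℕ} {p : ℝ≥0∞} {D : Set (Space d)} (M : Mesh d)
    (u : LpState N p D) (i : Fin d → ℤ) : State N :=
  if i ∈ M.interior D then ⨍ x in M.cell i, u x else 0

lemma measurable_index (M : Mesh d) : Measurable M.index := by
  refine measurable_pi_lambda _ fun m => ?_
  have h : Measurable fun x : Space d => (x m - M.origin m) / M.size := by fun_prop
  exact h.floor

lemma memLp_piecewiseConst {N : ℕ} {p : ℝ≥0∞} {D : Set (Space d)} (M : Mesh d)
    (hD : Bornology.IsBounded D) (v : (Fin d → ℤ) → State N) :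
    MemLp (M.piecewiseConst v) p ((volume : Measure (Space d)).restrict D) := by
  obtain ⟨R, hR⟩ := hD.subset_closedBall (0 : Space d)
  refine MemLp.mono_measure (Measure.restrict_mono hR le_rfl) ?_
  have hfin : (M.index '' Metric.closedBall (0 : Space d) R).Finite := by
    refine (Set.finite_Icc (fun m => ⌊(-R - M.origin m) / M.size⌋)
      (fun m => ⌊(R - M.origin m) / M.size⌋)).subset ?_
    rintro _ ⟨x, hx, rfl⟩
    have hxm : ∀ m, |x m| ≤ R := fun m =>
      (EuclideanSpace.norm_eq x ▸ by
        have := PiLp.norm_apply_le x m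
        simpa [EuclideanSpace.norm_eq] using this : |x m| ≤ ‖x‖).trans (by simpa using hx)
    refine ⟨fun m => ?_, fun m => ?_⟩
    · refine Int.floor_le_floor ?_
      have := (abs_le.1 (hxm m)).1
      exact div_le_div_of_nonneg_right (by linarith) M.size_pos.le
    · refine Int.floor_le_floor ?_
      have := (abs_le.1 (hxm m)).2
      exact div_le_div_of_nonneg_right (by linarith) M.size_pos.le
  obtain ⟨C, hC⟩ := (hfin.image fun i => ‖v i‖).bddAbove
  have : IsFiniteMeasure ((volume : Measure (Space d)).restrict (Metric.closedBall 0 R)) :=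
    ⟨by simpa using measure_closedBall_lt_top⟩
  refine MemLp.of_bound (C := C) ?_ ?_
  · exact ((measurable_of_countable v).comp M.measurable_index).aestronglyMeasurable
  · refine ae_restrict_of_forall_mem Metric.isClosed_closedBall.measurableSet fun x hx => ?_
    exact hC ⟨_, ⟨x, hx, rfl⟩, rfl⟩

/-- The piecewise constant function with the given cell values, as an element of `L^p(D;U)`. -/
def toLpState {N : ℕ} (p : ℝ≥0∞) {D : Set (Space d)} (M : Mesh d)
    (hD : Bornology.IsBounded D) (v : (Fin d → ℤ) → State N) : LpState N p D :=
  (M.memLp_piecewiseConst hD v).toLp _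

end Mesh

/-! ## Semi-discrete finite volume schemes -/

/-- A semi-discrete `(2q+1)`-point finite volume scheme on `D` for `∂_t u + ∇ · f(u) = 0`:
a mesh, numerical fluxes `F^m` in every direction (locally Lipschitz and consistent with `f`),
and a treatment of the boundary, which prescribes the values in the cells outside the
discretization of `D` as a locally Lipschitz function of the values inside. -/
structure FVScheme {d N : ℕ} (D : Set (Space d)) (f : Fin d → State N → State N) (q : ℕ) where
  mesh : Mesh d
  flux : Fin d → (Fin (2 * q) → State N) → State N
  flux_lipschitz : ∀ m, ∀ K : Set (Fin (2 * q) → State N), Bornology.IsBounded K →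
    ∃ L : ℝ≥0, LipschitzOnWith L (flux m) K
  flux_consistent : ∀ m v, flux m (fun _ => v) = f m v
  /-- Replaces the values in the exterior cells by the ones given by the boundary treatment. -/
  ghost : ((Fin d → ℤ) → State N) → (Fin d → ℤ) → State N
  ghost_interior : ∀ v, ∀ i ∈ mesh.interior D, ghost v i = v i
  ghost_lipschitz : ∀ (K : ℝ) (i : Fin d → ℤ), ∃ L : ℝ≥0, ∀ v w : (Fin d → ℤ) → State N,
    (∀ j ∈ mesh.interior D, ‖v j‖ ≤ K) → (∀ j ∈ mesh.interior D, ‖w j‖ ≤ K) →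
    ∀ δ : ℝ, 0 ≤ δ → (∀ j ∈ mesh.interior D, ‖v j - w j‖ ≤ δ) →
      ‖ghost v i - ghost w i‖ ≤ L * δ

namespace FVScheme

variable {d N q : ℕ} {D : Set (Space d)} {f : Fin d → State N → State N}

/-- The numerical flux through the face between the cells `i` and `i + e_m`,
`F^m(v_{i-(q-1)e_m}, …, v_{i+q e_m})`. -/
def faceFlux (S : FVScheme D f q) (v : (Fin d → ℤ) → State N) (m : Fin d) (i : Fin d → ℤ) :
    State N :=
  S.flux m fun j => v (i + Pi.single m ((j : ℤ) - ((q : ℤ) - 1)))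

/-- `u` solves the semi-discrete scheme on `[0,T)` with initial data `ubar`. -/
structure IsSolution {p : ℝ≥0∞} (S : FVScheme D f q) (T : ℝ) (ubar : LpState N p D)
    (u : ℝ → (Fin d → ℤ) → State N) : Prop where
  init : ∀ i ∈ S.mesh.interior D, u 0 i = S.mesh.cellAverage ubar i
  boundary : ∀ t ∈ Ico 0 T, S.ghost (u t) = u t
  ode : ∀ t ∈ Ico 0 T, ∀ i ∈ S.mesh.interior D,
    HasDerivWithinAt (fun τ => u τ i)
      (-∑ m, (1 / S.mesh.size) •
        (S.faceFlux (u t) m i - S.faceFlux (u t) m (i - Pi.single m 1))) (Ico 0 T) t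

end FVScheme

/-! ## Approximate statistical solutions and the hypotheses on the scheme -/

section Hypotheses

variable {d N q : ℕ} {p : ℝ≥0∞} [Fact (1 ≤ p)] {D : Set (Space d)}
  {f : Fin d → State N → State N}

/-- The approximate statistical solution `μ_t^Δ = S_t^Δ # μbar`, where `sol ubar t` are the cell
values of the numerical solution with initial data `ubar`. -/
def approxStatSol (M : Mesh d) (hD : Bornology.IsBounded D)
    (sol : LpState N p D → ℝ → (Fin d → ℤ) → State N) (μbar : Measure (LpState N p D)) (t : ℝ) :
    Measure (LpState N p D) :=
  μbar.map fun ubar => M.toLpState p hD (sol ubar t)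

/-- The modulus of continuity `∫_D ⨍_{B_r(x)} |u(x) - u(y)|^p dy dx` of `u ∈ L^p(D;U)`. -/
def modulus (r : ℝ) (u : LpState N p D) : ℝ≥0∞ :=
  ∫⁻ x in D, ballAverage D x r fun y => ‖u x - u y‖ₑ ^ p.toReal

/-- The structure function
`S_r^p(μ) = (∫_0^T ∫_{L^p} ∫_D ⨍_{B_r(x)} |u(x) - u(y)|^p dy dx dμ_t(u) dt)^{1/p}`. -/
def structureFunction (T : ℝ) (μ : ℝ → Measure (LpState N p D)) (r : ℝ) : ℝ≥0∞ :=
  (∫⁻ t, (∫⁻ u, modulus r u ∂(μ t)) ∂(timeVol T)) ^ (1 / p.toReal)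

/-- `L^p` bounds, uniform in the mesh, the time and the initial data. -/
def UniformLpBound (T : ℝ) (M : ℕ → Mesh d)
    (sol : ℕ → LpState N p D → ℝ → (Fin d → ℤ) → State N) : Prop :=
  ∃ C : ℝ≥0, ∀ n, ∀ t ∈ Ico 0 T, ∀ ubar : LpState N p D,
    ENNReal.ofReal ((M n).size ^ d) * ∑' i, ‖sol n ubar t i‖ₑ ^ p.toReal
      ≤ C * (ENNReal.ofReal ((M n).size ^ d)
          * ∑' i, ‖(M n).cellAverage ubar i‖ₑ ^ p.toReal)

/-- Weak BV bounds with exponent `s`, uniform in the mesh and on bounded sets of initial data. -/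
def WeakBVBound (T s : ℝ) (M : ℕ → Mesh d)
    (sol : ℕ → LpState N p D → ℝ → (Fin d → ℤ) → State N) : Prop :=
  ∀ K : ℝ, ∃ C : ℝ≥0, ∀ n, ∀ ubar : LpState N p D, ‖ubar‖ ≤ K →
    ENNReal.ofReal ((M n).size ^ d)
        * ∫⁻ t, ∑ m, ∑' i, ‖sol n ubar t (i + Pi.single m 1) - sol n ubar t i‖ₑ ^ s ∂(timeVol T)
      ≤ C * ENNReal.ofReal (M n).size

/-- Approximate scaling of the structure functions, uniform in the mesh. -/
def ApproximateScaling (T s : ℝ) (M : ℕ → Mesh d)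
    (μs : ℕ → ℝ → Measure (LpState N p D)) : Prop :=
  ∃ C : ℝ≥0, ∀ n, ∀ l : ℝ, 1 < l →
    structureFunction T (μs n) (l * (M n).size)
      ≤ C * ENNReal.ofReal (l ^ (1 / s)) * structureFunction T (μs n) (M n).size

end Hypotheses

end StatSol

end

/-! Regard the approximate solutions as Markov kernels `κ n` from time to `L^p(D;U)`, and seek
compactness of the joint measures `timeVol T ⊗ₘ κ n` on `ℝ × L^p`. The structure functions control
only time averages, so compactness is not claimed at individual times, and no estimate on time
increments is needed.

Tightness. The weak BV bound is an `ℓ^s` bound on differences of neighbouring cells. By Jensen it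
bounds the time-averaged modulus of continuity at the mesh size Δ by `(K Δ)^(p/s)`
(`Mesh.exists_modulus_toLpState_le`, `exists_lintegral_modulus_solOp_le`). Approximate scaling with
`ℓ = r/Δ` carries this to every radius `r > Δ`, and the powers of Δ cancel: the mean modulus at `r`
is at most `(C (K r)^(1/s))^p`, independently of the mesh. A Kolmogorov type criterion in
probability then applies (`isTightMeasureSet_range_of_modulus`): outside an event of small mass, `u`
is close to its projection onto a fixed auxiliary grid, and the projections of a ball of `L^p` lie
in a compact set. For an arbitrary bounded open `D` the cells cut by the boundary need care. They
are handled by a bound on the mass of the averaging kernel in its first variable that uses no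
regularity of `D` (`exists_lintegral_ballKernel_fst_le`).

Limit. Prokhorov's theorem gives a weakly convergent subsequence. All time marginals coincide, so
the limit has the same one and disintegrates into a kernel `κ'`. Its correlation measures are the
joint laws of point values `rep u x` of a random function, where `rep` is a representative
measurable in `(u, x)` obtained by Lebesgue differentiation. Symmetry and consistency are then
immediate, and continuity on the diagonal is dominated convergence.

Strong convergence. Along a function `u`, an observable becomes a map from a ball of `L^p` into
`L¹(D^(k+1))`, bounded and, by Hölder's inequality, Lipschitz. On a compact set carrying almost all
mass, a partition of unity replaces this map by a finite sum of products `χ_c(u) G(t, x, c)`. For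
such products, weak convergence and the fixed time marginal give convergence in `L¹(D^(k+1))`
(`tendsto_lintegral_enorm_integral_sub`).

The kernels exist because the solution operator is jointly measurable: Gronwall's inequality makes
it continuous in the data, and it is continuous in time. -/

noncomputable section

namespace StatSol

/-! ### Representatives of `L^p` classes measurable in the function and the point -/

section Representative

variable {d N : ℕ} {p : ℝ≥0∞} {D : Set (Space d)}

lemma isFiniteMeasure_restrict_of_isBounded (hD : Bornology.IsBounded D) :
    IsFiniteMeasure ((volume : Measure (Space d)).restrict D) :=
  ⟨by simpa using hD.measure_lt_top⟩

lemma measurableSet_mem_closedBall (r : ℝ) :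
    MeasurableSet {q : Space d × Space d | q.2 ∈ Metric.closedBall q.1 r} :=
  measurableSet_le (f := fun q : Space d × Space d => dist q.2 q.1) (by fun_prop) (by fun_prop)

variable [Fact (1 ≤ p)] [IsFiniteMeasure ((volume : Measure (Space d)).restrict D)]

lemma integrable_lpState (u : LpState N p D) :
    Integrable u ((volume : Measure (Space d)).restrict D) :=
  (Lp.memLp u).integrable Fact.out

/-- Integration over a set is continuous on `L^p(D;U)`. -/
lemma continuous_setIntegral_lpState (s : Set (Space d)) :
    Continuous fun u : LpState N p D =>
      ∫ x in s, u x ∂((volume : Measure (Space d)).restrict D) := by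
  set μ := (volume : Measure (Space d)).restrict D
  have hne : μ univ ^ (1 / (1 : ℝ≥0∞).toReal - 1 / p.toReal) ≠ ∞ := by
    refine ENNReal.rpow_ne_top_of_nonneg ?_ (measure_ne_top _ _)
    have hp : (1 : ℝ≥0∞) ≤ p := Fact.out
    rcases eq_or_ne p ∞ with rfl | h
    · simp
    · have : 1 ≤ p.toReal := by simpa using ENNReal.toReal_mono h hp
      have : 1 / p.toReal ≤ 1 := by rw [div_le_one (by linarith)]; exact this
      simpa using this
  -- The Lipschitz constant is that of the embedding of `L^p` into `L¹` over a finite measure.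
  refine LipschitzWith.continuous (K := (μ univ ^ (1 / (1 : ℝ≥0∞).toReal - 1 / p.toReal)).toNNReal)
    fun u v => ?_
  rw [edist_eq_enorm_sub, ← integral_sub (integrable_lpState u).integrableOn
    (integrable_lpState v).integrableOn]
  calc ‖∫ x in s, (u x - v x) ∂μ‖ₑ ≤ ∫⁻ x in s, ‖u x - v x‖ₑ ∂μ := enorm_integral_le_lintegral_enorm _
    _ ≤ ∫⁻ x, ‖u x - v x‖ₑ ∂μ := setLIntegral_le_lintegral _ _
    _ = ∫⁻ x, ‖(u - v : LpState N p D) x‖ₑ ∂μ := by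
        refine lintegral_congr_ae ?_
        filter_upwards [Lp.coeFn_sub u v] with x hx
        rw [hx]; rfl
    _ = eLpNorm (u - v : LpState N p D) 1 μ := by rw [eLpNorm_one_eq_lintegral_enorm]
    _ ≤ eLpNorm (u - v : LpState N p D) p μ * μ univ ^ (1 / (1 : ℝ≥0∞).toReal - 1 / p.toReal) :=
        eLpNorm_le_eLpNorm_mul_rpow_measure_univ Fact.out (Lp.memLp _).1
    _ = _ := by
        rw [ENNReal.coe_toNNReal hne, edist_eq_enorm_sub, Lp.enorm_def, mul_comm]

/-- The average of `u`, extended by zero outside `D`, over a closed ball. -/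
def ballMean (n : ℕ) (x : Space d) (u : LpState N p D) : State N :=
  (volume.real (Metric.closedBall x (1 / ((n : ℝ) + 1))))⁻¹ •
    ∫ y in Metric.closedBall x (1 / ((n : ℝ) + 1)), u y ∂((volume : Measure (Space d)).restrict D)

/-- A representative of `u ∈ L^p(D;U)` that depends measurably on `(u, x)`. -/
def rep (u : LpState N p D) (x : Space d) : State N :=
  limUnder atTop fun n : ℕ => ballMean n x u

/-- Each ball mean is a Carathéodory function, continuous in `u` and measurable in `x`. For `p < ∞`
the space `L^p` is second countable, which makes such functions jointly measurable; limits along a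
sequence preserve this. -/
lemma measurable_rep [Fact (p ≠ ∞)] :
    Measurable fun q : LpState N p D × Space d => rep q.1 q.2 := by
  refine StronglyMeasurable.measurable (StronglyMeasurable.limUnder fun n => ?_)
  refine Measurable.stronglyMeasurable ?_
  refine measurable_uncurry_of_continuous_of_measurable
    (u := fun (u : LpState N p D) (x : Space d) => ballMean n x u) (fun x => ?_) fun u => ?_
  · exact (continuous_setIntegral_lpState (D := D) (p := p) (N := N) _).const_smul
      (volume.real (Metric.closedBall x (1 / ((n : ℝ) + 1))))⁻¹
  · set μ := (volume : Measure (Space d)).restrict D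
    unfold ballMean
    refine Measurable.fun_smul ?_ ?_
    · refine Measurable.inv ?_
      exact (measurable_measure_prodMk_left (ν := volume)
        (measurableSet_mem_closedBall (1 / ((n : ℝ) + 1)))).ennreal_toReal
    · have h : ∀ x : Space d, ∫ y in Metric.closedBall x (1 / ((n : ℝ) + 1)), u y ∂μ
          = ∫ y, {q : Space d × Space d | q.2 ∈ Metric.closedBall q.1 (1 / ((n : ℝ) + 1))}.indicator
              (fun q => u q.2) (x, y) ∂μ := fun x => by
        rw [← integral_indicator Metric.isClosed_closedBall.measurableSet]
        rfl
      rw [funext h]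
      refine (StronglyMeasurable.integral_prod_right' ?_).measurable
      exact ((Lp.stronglyMeasurable u).comp_measurable measurable_snd).indicator
        (measurableSet_mem_closedBall _)

lemma measurable_rep_comp [Fact (p ≠ ∞)] {α : Type*} [MeasurableSpace α] {f : α → LpState N p D}
    {g : α → Space d} (hf : Measurable f) (hg : Measurable g) :
    Measurable fun a => rep (f a) (g a) := by
  have h := (measurable_rep (N := N) (p := p) (D := D)).comp (hf.prodMk hg)
  exact h

/-- Lebesgue's differentiation theorem for the extension of `u` by zero. -/
lemma rep_ae_eq (hD : MeasurableSet D) (u : LpState N p D) :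
    rep u =ᵐ[(volume : Measure (Space d)).restrict D] u := by
  have hint : Integrable (D.indicator u) (volume : Measure (Space d)) :=
    (integrable_indicator_iff hD).2 (integrable_lpState u)
  have h := IsUnifLocDoublingMeasure.ae_tendsto_average (μ := (volume : Measure (Space d)))
    hint.locallyIntegrable 1
  filter_upwards [ae_restrict_of_ae h, ae_restrict_mem hD] with x hx hxD
  have hlim := hx (fun _ : ℕ => x) (fun n : ℕ => 1 / ((n : ℝ) + 1)) (l := atTop)
    (tendsto_nhdsWithin_iff.2 ⟨tendsto_one_div_add_atTop_nhds_zero_nat,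
      Eventually.of_forall fun n => by simp only [mem_Ioi]; positivity⟩)
    (Eventually.of_forall fun n => Metric.mem_closedBall_self (by positivity))
  rw [indicator_of_mem hxD] at hlim
  refine Tendsto.limUnder_eq (hlim.congr fun n => ?_)
  rw [setAverage_eq, ballMean, setIntegral_indicator hD,
    Measure.restrict_restrict Metric.isClosed_closedBall.measurableSet]

attribute [irreducible] rep

end Representative

/-! ### The averaging kernel over balls in `D` -/

section BallKernel

variable {d : ℕ}

/-- The kernel `1_{|x-y|<r} / |B_r(x)|` of the averaging operator over balls in `D`. -/
def ballKernel (D : Set (Space d)) (r : ℝ) (q : Space d × Space d) : ℝ≥0∞ :=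
  {q : Space d × Space d | q.2 ∈ Metric.ball q.1 r}.indicator
    (fun q => (volume (Metric.ball q.1 r ∩ D))⁻¹) q

lemma measurableSet_mem_ball (r : ℝ) :
    MeasurableSet {q : Space d × Space d | q.2 ∈ Metric.ball q.1 r} :=
  measurableSet_lt (f := fun q : Space d × Space d => dist q.2 q.1) (by fun_prop) (by fun_prop)

lemma measurable_volume_ball_inter {D : Set (Space d)} (hD : MeasurableSet D) (r : ℝ) :
    Measurable fun x : Space d => volume (Metric.ball x r ∩ D) :=
  measurable_measure_prodMk_left (ν := volume)
    ((measurableSet_mem_ball r).inter (measurable_snd hD))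

lemma measurable_ballKernel {D : Set (Space d)} (hD : MeasurableSet D) (r : ℝ) :
    Measurable (ballKernel D r) :=
  Measurable.indicator ((measurable_volume_ball_inter hD r).inv.comp measurable_fst)
    (measurableSet_mem_ball r)

/-- The kernel form makes Tonelli available in both space variables. If the ball meets `D` in a null
set, both sides vanish, although the kernel is infinite there. -/
lemma ballAverage_eq_lintegral_ballKernel {D : Set (Space d)} (x : Space d)
    (r : ℝ) (F : Space d → ℝ≥0∞) :
    ballAverage D x r F = ∫⁻ y in D, ballKernel D r (x, y) * F y := by
  have h : ∫⁻ y in D, ballKernel D r (x, y) * F y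
      = ∫⁻ y in Metric.ball x r ∩ D, (volume (Metric.ball x r ∩ D))⁻¹ * F y := by
    rw [← Measure.restrict_restrict Metric.isOpen_ball.measurableSet,
      ← lintegral_indicator Metric.isOpen_ball.measurableSet]
    refine lintegral_congr fun y => ?_
    by_cases hy : y ∈ Metric.ball x r
    · simp [ballKernel, hy, Metric.mem_ball.1 hy]
    · simp only [ballKernel, indicator_of_notMem hy]
      rw [indicator_of_notMem (by exact hy), zero_mul]
  rw [h, ballAverage]
  rcases eq_or_ne (volume (Metric.ball x r ∩ D)) 0 with h0 | h0
  · simp [Measure.restrict_zero_set h0]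
  · rw [lintegral_const_mul' _ _ (by simpa using h0), ENNReal.div_eq_inv_mul]

lemma lintegral_ballKernel_snd_le (D : Set (Space d)) (r : ℝ)
    (x : Space d) : ∫⁻ y in D, ballKernel D r (x, y) ≤ 1 := by
  have := ballAverage_eq_lintegral_ballKernel (D := D) x r fun _ => 1
  simp only [mul_one] at this
  rw [← this, ballAverage]
  simp [ENNReal.div_self_le_one]

/-- The averaging kernels are uniformly integrable in the first variable. -/
lemma exists_lintegral_ballKernel_fst_le (d : ℕ) :
    ∃ C : ℝ≥0, ∀ D : Set (Space d), MeasurableSet D → ∀ r : ℝ, 0 < r → ∀ y : Space d,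
      ∫⁻ x in D, ballKernel D r (x, y) ≤ C := by
  -- Cover the unit ball by balls of radius 1/2 with centres `c`. If `|x - y| < r`, then `x` lies in
  -- some `B_{r/2}(y + r c)`, and this half ball is contained in `B_r(x)`. So `1/|B_r(x) ∩ D|` is at
  -- most the same quantity for the half ball, which no longer depends on `x`; each half ball
  -- contributes at most 1. The number of half balls is the constant.
  obtain ⟨t, -, ht⟩ := (isCompact_closedBall (0 : Space d) 1).elim_nhds_subcover
    (fun c => Metric.ball c (1 / 2)) fun c _ => Metric.ball_mem_nhds c (by norm_num)
  refine ⟨t.card, fun D hD r hr y => ?_⟩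
  have hle : ∀ x, ballKernel D r (x, y) ≤ ∑ c ∈ t, (Metric.ball (y + r • c) (r / 2)).indicator
      (fun _ => (volume (Metric.ball (y + r • c) (r / 2) ∩ D))⁻¹) x := fun x => by
    by_cases hx : y ∈ Metric.ball x r
    · have hz : r⁻¹ • (x - y) ∈ Metric.closedBall (0 : Space d) 1 := by
        rw [mem_closedBall_zero_iff, norm_smul, Real.norm_eq_abs, abs_inv, abs_of_pos hr,
          inv_mul_le_iff₀ hr, mul_one, ← dist_eq_norm, dist_comm]
        exact (Metric.mem_ball.1 hx).le
      obtain ⟨c, hc, hzc⟩ := mem_iUnion₂.1 (ht hz)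
      have hxc : x ∈ Metric.ball (y + r • c) (r / 2) := by
        rw [Metric.mem_ball, dist_eq_norm] at hzc ⊢
        have : x - (y + r • c) = r • (r⁻¹ • (x - y) - c) := by
          rw [smul_sub, smul_smul, mul_inv_cancel₀ hr.ne', one_smul]; abel
        rw [this, norm_smul, Real.norm_eq_abs, abs_of_pos hr]
        nlinarith
      refine le_trans ?_ (Finset.single_le_sum (f := fun c =>
        (Metric.ball (y + r • c) (r / 2)).indicator
          (fun _ => (volume (Metric.ball (y + r • c) (r / 2) ∩ D))⁻¹) x) (fun _ _ => zero_le) hc)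
      rw [indicator_of_mem hxc]
      refine (indicator_le_self _ _ _).trans (ENNReal.inv_le_inv.2 (measure_mono ?_))
      refine inter_subset_inter_left _ fun z hz => ?_
      rw [Metric.mem_ball] at hz hxc ⊢
      have := dist_triangle_right z x (y + r • c)
      linarith
    · rw [ballKernel, indicator_of_notMem (by exact hx)]
      exact zero_le
  calc ∫⁻ x in D, ballKernel D r (x, y)
      ≤ ∫⁻ x in D, ∑ c ∈ t, (Metric.ball (y + r • c) (r / 2)).indicator
        (fun _ => (volume (Metric.ball (y + r • c) (r / 2) ∩ D))⁻¹) x := lintegral_mono hle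
    _ = ∑ c ∈ t, ∫⁻ x in D, (Metric.ball (y + r • c) (r / 2)).indicator
        (fun _ => (volume (Metric.ball (y + r • c) (r / 2) ∩ D))⁻¹) x :=
      lintegral_finsetSum _ fun c _ => measurable_const.indicator Metric.isOpen_ball.measurableSet
    _ ≤ ∑ c ∈ t, 1 := by
      refine Finset.sum_le_sum fun c _ => ?_
      rw [lintegral_indicator Metric.isOpen_ball.measurableSet, lintegral_const,
        Measure.restrict_restrict Metric.isOpen_ball.measurableSet, Measure.restrict_apply_univ]
      exact ENNReal.inv_mul_le_one _
    _ = _ := by simp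

/-- Finitely many balls of radius `r` cover `D`. For `x` within `r` of a centre `c` the integrand is
the kernel at `(x, c)`, whose integral in `x` is bounded even if `c` is not in `D`. This is the
dominating function for the boundary cells. -/
lemma lintegral_inv_volume_ball_lt_top {D : Set (Space d)} (hD : MeasurableSet D)
    (hb : Bornology.IsBounded D) {r : ℝ} (hr : 0 < r) :
    ∫⁻ x in D, (volume (Metric.ball x r ∩ D))⁻¹ < ∞ := by
  obtain ⟨C, hC⟩ := exists_lintegral_ballKernel_fst_le d
  obtain ⟨R, hR⟩ := hb.subset_closedBall (0 : Space d)
  obtain ⟨t, -, ht⟩ := (isCompact_closedBall (0 : Space d) R).elim_nhds_subcover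
    (fun c => Metric.ball c r) fun c _ => Metric.ball_mem_nhds c hr
  have hle : ∀ x ∈ D, (volume (Metric.ball x r ∩ D))⁻¹ ≤ ∑ c ∈ t, ballKernel D r (x, c) :=
    fun x hx => by
      obtain ⟨c, hc, hxc⟩ := mem_iUnion₂.1 (ht (hR hx))
      refine le_trans ?_ (Finset.single_le_sum (f := fun c => ballKernel D r (x, c))
        (fun _ _ => zero_le) hc)
      rw [ballKernel, indicator_of_mem (by rw [mem_ofPred_eq, Metric.mem_ball_comm]; exact hxc)]
  calc ∫⁻ x in D, (volume (Metric.ball x r ∩ D))⁻¹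
      ≤ ∫⁻ x in D, ∑ c ∈ t, ballKernel D r (x, c) := setLIntegral_mono' hD hle
    _ = ∑ c ∈ t, ∫⁻ x in D, ballKernel D r (x, c) :=
      lintegral_finsetSum _ fun c _ =>
        (measurable_ballKernel hD r).comp (measurable_id.prodMk measurable_const)
    _ ≤ ∑ c ∈ t, (C : ℝ≥0∞) := Finset.sum_le_sum fun c _ => hC D hD r hr c
    _ < ∞ := by simp [ENNReal.mul_lt_top]

lemma volume_ball_inter_ne_zero {D : Set (Space d)} (hD : IsOpen D) {x : Space d} (hx : x ∈ D)
    {r : ℝ} (hr : 0 < r) : volume (Metric.ball x r ∩ D) ≠ 0 :=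
  ((Metric.isOpen_ball.inter hD).measure_pos _ ⟨x, Metric.mem_ball_self hr, hx⟩).ne'

end BallKernel

/-! ### Moduli of continuity of `L^p` functions -/

section Modulus

variable {d N : ℕ}

/-- The modulus of continuity of a function on `D`. -/
def fnModulus (p : ℝ) (D : Set (Space d)) (r : ℝ) (f : Space d → State N) : ℝ≥0∞ :=
  ∫⁻ x in D, ∫⁻ y in D, ballKernel D r (x, y) * ‖f x - f y‖ₑ ^ p

lemma fnModulus_congr {p : ℝ} {D : Set (Space d)} {r : ℝ} {f g : Space d → State N}
    (h : f =ᵐ[volume.restrict D] g) : fnModulus p D r f = fnModulus p D r g := by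
  refine lintegral_congr_ae ?_
  filter_upwards [h] with x hx
  refine lintegral_congr_ae ?_
  filter_upwards [h] with y hy
  rw [hx, hy]

lemma modulus_eq_fnModulus {p : ℝ≥0∞} {D : Set (Space d)} (r : ℝ)
    (u : LpState N p D) : modulus r u = fnModulus p.toReal D r u :=
  lintegral_congr fun x => ballAverage_eq_lintegral_ballKernel x r _

lemma fnModulus_le_of_forall {p : ℝ} (hp : 0 ≤ p) {D : Set (Space d)} (hD : MeasurableSet D)
    {r : ℝ} {f : Space d → State N} {ε : ℝ≥0∞}
    (h : ∀ x ∈ D, ∀ y ∈ D, dist y x < r → ‖f x - f y‖ₑ ≤ ε) :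
    fnModulus p D r f ≤ ε ^ p * volume D := by
  calc fnModulus p D r f ≤ ∫⁻ x in D, ε ^ p := by
        refine setLIntegral_mono' hD fun x hx => ?_
        calc ∫⁻ y in D, ballKernel D r (x, y) * ‖f x - f y‖ₑ ^ p
            ≤ ∫⁻ y in D, ballKernel D r (x, y) * ε ^ p := by
              refine setLIntegral_mono' hD fun y hy => ?_
              by_cases hxy : y ∈ Metric.ball x r
              · gcongr
                exact h x hx y hy hxy
              · rw [ballKernel, indicator_of_notMem (by exact hxy)]; simp
          _ = (∫⁻ y in D, ballKernel D r (x, y)) * ε ^ p :=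
            lintegral_mul_const _ ((measurable_ballKernel hD r).comp
              (measurable_const.prodMk measurable_id))
          _ ≤ 1 * ε ^ p := by gcongr; exact lintegral_ballKernel_snd_le D r x
          _ = ε ^ p := one_mul _
    _ = _ := by simp

lemma fnModulus_add_le {p : ℝ} (hp : 1 ≤ p) {D : Set (Space d)} (hD : MeasurableSet D) {r : ℝ}
    {f g : Space d → State N} (hf : StronglyMeasurable f) :
    fnModulus p D r (f + g) ≤ 2 ^ (p - 1) * (fnModulus p D r f + fnModulus p D r g) := by
  have hm : ∀ k : Space d → State N, StronglyMeasurable k → Measurable fun q : Space d × Space d =>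
      ballKernel D r q * ‖k q.1 - k q.2‖ₑ ^ p := fun k hk =>
    (measurable_ballKernel hD r).mul ((((hk.comp_measurable measurable_fst).sub
      (hk.comp_measurable measurable_snd)).enorm).pow_const p)
  have hm' := fun k hk => (hm k hk).lintegral_prod_right' (ν := volume.restrict D)
  unfold fnModulus
  rw [← lintegral_add_left (hm' f hf), ← lintegral_const_mul' _ _ (by simp)]
  refine lintegral_mono fun x => ?_
  simp only
  have hx : Measurable fun y => ballKernel D r (x, y) * ‖f x - f y‖ₑ ^ p :=
    (hm f hf).comp measurable_prodMk_left
  rw [← lintegral_add_left hx,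
    ← lintegral_const_mul' _ _ (by simp)]
  refine lintegral_mono fun y => ?_
  calc ballKernel D r (x, y) * ‖(f + g) x - (f + g) y‖ₑ ^ p
      ≤ ballKernel D r (x, y) * (‖f x - f y‖ₑ + ‖g x - g y‖ₑ) ^ p := by
        gcongr
        rw [Pi.add_apply, Pi.add_apply, add_sub_add_comm]
        exact enorm_add_le _ _
    _ ≤ ballKernel D r (x, y) * (2 ^ (p - 1) * (‖f x - f y‖ₑ ^ p + ‖g x - g y‖ₑ ^ p)) := by
        gcongr
        exact ENNReal.rpow_add_le_mul_rpow_add_rpow _ _ hp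
    _ = _ := by ring

/-- The modulus of continuity is controlled by the `L^p` norm, uniformly in the radius. -/
lemma exists_fnModulus_le (d N : ℕ) {p : ℝ} (hp : 1 ≤ p) :
    ∃ C : ℝ≥0, ∀ D : Set (Space d), MeasurableSet D → ∀ r : ℝ, 0 < r →
      ∀ f : Space d → State N, StronglyMeasurable f →
        fnModulus p D r f ≤ C * ∫⁻ x in D, ‖f x‖ₑ ^ p := by
  obtain ⟨C, hC⟩ := exists_lintegral_ballKernel_fst_le d
  have h2 : (2 : ℝ≥0∞) ^ (p - 1) ≠ ∞ := by simp
  refine ⟨((2 : ℝ≥0∞) ^ (p - 1)).toNNReal * (1 + C), fun D hD r hr f hf => ?_⟩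
  have hfm : Measurable fun x => ‖f x‖ₑ ^ p := hf.enorm.pow_const p
  have hk := measurable_ballKernel hD r
  have h1 : Measurable fun q : Space d × Space d => ballKernel D r q * ‖f q.1‖ₑ ^ p :=
    hk.mul (hfm.comp measurable_fst)
  have h2' : Measurable fun q : Space d × Space d => ballKernel D r q * ‖f q.2‖ₑ ^ p :=
    hk.mul (hfm.comp measurable_snd)
  calc fnModulus p D r f
      ≤ ∫⁻ x in D, ∫⁻ y in D, 2 ^ (p - 1) * (ballKernel D r (x, y) * ‖f x‖ₑ ^ p
          + ballKernel D r (x, y) * ‖f y‖ₑ ^ p) := by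
        refine lintegral_mono fun x => lintegral_mono fun y => ?_
        calc ballKernel D r (x, y) * ‖f x - f y‖ₑ ^ p
            ≤ ballKernel D r (x, y) * (‖f x‖ₑ + ‖f y‖ₑ) ^ p := by
              gcongr
              exact enorm_sub_le
          _ ≤ ballKernel D r (x, y) * (2 ^ (p - 1) * (‖f x‖ₑ ^ p + ‖f y‖ₑ ^ p)) := by
              gcongr
              exact ENNReal.rpow_add_le_mul_rpow_add_rpow _ _ hp
          _ = _ := by ring
    _ = 2 ^ (p - 1) * ((∫⁻ x in D, ∫⁻ y in D, ballKernel D r (x, y) * ‖f x‖ₑ ^ p)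
          + ∫⁻ x in D, ∫⁻ y in D, ballKernel D r (x, y) * ‖f y‖ₑ ^ p) := by
        rw [← lintegral_add_left (h1.lintegral_prod_right' (ν := volume.restrict D)),
          ← lintegral_const_mul' _ _ h2]
        refine lintegral_congr fun x => ?_
        simp only
        have hx : Measurable fun y => ballKernel D r (x, y) * ‖f x‖ₑ ^ p :=
          h1.comp measurable_prodMk_left
        rw [← lintegral_add_left hx,
          ← lintegral_const_mul' _ _ h2]
    -- Schur's test: the kernel mass in `y` is at most 1, which handles `|f x|^p`; after Tonelli,
    -- the mass in `x` is at most `C`, which handles `|f y|^p`.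
    _ ≤ 2 ^ (p - 1) * ((∫⁻ x in D, ‖f x‖ₑ ^ p) + C * ∫⁻ x in D, ‖f x‖ₑ ^ p) := by
        gcongr with x
        · have hx : Measurable fun y => ballKernel D r (x, y) := hk.comp measurable_prodMk_left
          rw [lintegral_mul_const _ hx]
          calc _ ≤ 1 * ‖f x‖ₑ ^ p := by gcongr; exact lintegral_ballKernel_snd_le D r x
            _ = _ := one_mul _
        · rw [lintegral_lintegral_swap h2'.aemeasurable, ← lintegral_const_mul _ hfm]
          refine lintegral_mono fun y => ?_
          have hy : Measurable fun x => ballKernel D r (x, y) := hk.comp measurable_prodMk_right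
          rw [lintegral_mul_const _ hy]
          gcongr
          exact hC D hD r hr y
    _ = _ := by
        rw [ENNReal.coe_mul, ENNReal.coe_toNNReal h2]
        push_cast
        ring

lemma enorm_lpState_rpow {p : ℝ≥0∞} [Fact (1 ≤ p)] [Fact (p ≠ ∞)] {D : Set (Space d)}
    (u : LpState N p D) : ‖u‖ₑ ^ p.toReal = ∫⁻ x in D, ‖u x‖ₑ ^ p.toReal := by
  have h0 : p ≠ 0 := (zero_lt_one.trans_le (Fact.out : 1 ≤ p)).ne'
  have ht : p ≠ ∞ := Fact.out
  rw [Lp.enorm_def, eLpNorm_eq_lintegral_rpow_enorm_toReal h0 ht, ← ENNReal.rpow_mul,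
    one_div_mul_cancel (ENNReal.toReal_pos h0 ht).ne', ENNReal.rpow_one]

lemma one_le_toReal (p : ℝ≥0∞) [Fact (1 ≤ p)] [Fact (p ≠ ∞)] : 1 ≤ p.toReal := by
  simpa using ENNReal.toReal_mono (Fact.out : p ≠ ∞) (Fact.out : 1 ≤ p)

lemma exists_modulus_le (d N : ℕ) (p : ℝ≥0∞) [Fact (1 ≤ p)] [Fact (p ≠ ∞)] :
    ∃ C : ℝ≥0, ∀ D : Set (Space d), MeasurableSet D → ∀ r : ℝ, 0 < r →
      ∀ u : LpState N p D, modulus r u ≤ C * ‖u‖ₑ ^ p.toReal := by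
  obtain ⟨C, hC⟩ := exists_fnModulus_le d N (one_le_toReal p)
  refine ⟨C, fun D hD r hr u => ?_⟩
  rw [modulus_eq_fnModulus, enorm_lpState_rpow]
  exact hC D hD r hr u (Lp.stronglyMeasurable u)

/-- Approximate `u` in `L^p` by a compactly supported continuous `g`. The modulus of `g` is small
for small `r` by uniform continuity, and that of `u - g` is controlled by its norm with a constant
independent of `r`. -/
lemma tendsto_modulus_zero {p : ℝ≥0∞} [Fact (1 ≤ p)] [Fact (p ≠ ∞)] {D : Set (Space d)}
    (hD : MeasurableSet D) (hb : Bornology.IsBounded D) (u : LpState N p D) :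
    Tendsto (fun r => modulus r u) (𝓝[>] 0) (𝓝 0) := by
  have := isFiniteMeasure_restrict_of_isBounded hb
  have hp1 := one_le_toReal p
  obtain ⟨C, hC⟩ := exists_fnModulus_le d N hp1
  simp_rw [modulus_eq_fnModulus]
  have key : ∀ ε : ℝ≥0∞, ε ≠ 0 → ∀ᶠ r in 𝓝[>] (0 : ℝ), fnModulus p.toReal D r u
      ≤ 2 ^ (p.toReal - 1) * (ε ^ p.toReal * volume D + C * ε ^ p.toReal) := fun ε hε => by
    obtain ⟨g, hgs, hgL, hgc, -⟩ := (Lp.memLp u).exists_hasCompactSupport_eLpNorm_sub_le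
      (Fact.out : p ≠ ∞) hε
    have hgu := hgs.uniformContinuous_of_continuous hgc
    rcases eq_or_ne ε ∞ with rfl | hεt
    · refine Eventually.of_forall fun r => ?_
      rcases eq_or_ne (volume D) 0 with h0 | h0
      · simp [fnModulus, Measure.restrict_zero_set h0]
      · rw [ENNReal.top_rpow_of_pos (by linarith), ENNReal.top_mul h0, top_add, ENNReal.mul_top]
        · exact le_top
        · simp
    have hpos : 0 < ε.toReal := ENNReal.toReal_pos hε hεt
    obtain ⟨δ, hδ, hd⟩ := Metric.uniformContinuous_iff.1 hgu ε.toReal hpos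
    filter_upwards [Ioo_mem_nhdsGT hδ] with r hr
    have hsm := (Lp.stronglyMeasurable u).sub hgc.stronglyMeasurable
    have heq : (u : Space d → State N) = g + (⇑u - g) := by simp
    rw [heq]
    refine (fnModulus_add_le hp1 hD hgc.stronglyMeasurable).trans ?_
    gcongr
    · refine fnModulus_le_of_forall (by linarith) hD fun x _ y _ hxy => ?_
      have := (hd (hxy.trans hr.2)).le
      rw [dist_comm, dist_eq_norm] at this
      rw [← ofReal_norm]
      exact ENNReal.ofReal_le_of_le_toReal this
    · refine (hC D hD r hr.1 _ hsm).trans ?_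
      gcongr
      have h0 : p ≠ 0 := (zero_lt_one.trans_le (Fact.out : 1 ≤ p)).ne'
      rw [eLpNorm_eq_lintegral_rpow_enorm_toReal h0 (Fact.out : p ≠ ∞)] at hgL
      have := ENNReal.rpow_le_rpow hgL (z := p.toReal) (by linarith)
      rwa [← ENNReal.rpow_mul, one_div_mul_cancel (by linarith), ENNReal.rpow_one] at this
  have hlim : Tendsto (fun ε : ℝ≥0∞ =>
      2 ^ (p.toReal - 1) * (ε ^ p.toReal * volume D + C * ε ^ p.toReal)) (𝓝[≠] 0) (𝓝 0) := by
    have h0 : Tendsto (fun ε : ℝ≥0∞ => ε ^ p.toReal) (𝓝[≠] 0) (𝓝 0) := by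
      have := (ENNReal.continuous_rpow_const (y := p.toReal)).tendsto 0
      rw [ENNReal.zero_rpow_of_pos (by linarith)] at this
      exact this.mono_left nhdsWithin_le_nhds
    have h1 := ENNReal.Tendsto.mul_const h0 (b := volume D) (Or.inr hb.measure_lt_top.ne)
    have h2 := ENNReal.Tendsto.const_mul h0 (a := (C : ℝ≥0∞)) (Or.inr ENNReal.coe_ne_top)
    have h3 := ENNReal.Tendsto.const_mul (h1.add h2) (a := (2 : ℝ≥0∞) ^ (p.toReal - 1))
      (Or.inr (by simp))
    simpa using h3
  rw [ENNReal.tendsto_nhds_zero]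
  intro η hη
  have hev : ∀ᶠ ε in 𝓝[≠] (0 : ℝ≥0∞), ε ≠ 0 := eventually_mem_nhdsWithin
  obtain ⟨ε, h1, h2⟩ := ((ENNReal.tendsto_nhds_zero.1 hlim η hη).and hev).exists
  exact (key ε h2).mono fun r hr => hr.trans h1

/-- Passing to the jointly measurable representative turns the modulus into an iterated integral
with a parameter. -/
lemma measurable_modulus {p : ℝ≥0∞} [Fact (1 ≤ p)] [Fact (p ≠ ∞)] {D : Set (Space d)}
    (hD : MeasurableSet D) [IsFiniteMeasure ((volume : Measure (Space d)).restrict D)] (r : ℝ) :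
    Measurable fun u : LpState N p D => modulus r u := by
  have h : ∀ u : LpState N p D, modulus r u = ∫⁻ x in D, ∫⁻ y in D,
      ballKernel D r (x, y) * ‖rep u x - rep u y‖ₑ ^ p.toReal := fun u => by
    rw [modulus_eq_fnModulus, ← fnModulus_congr (rep_ae_eq hD u)]; rfl
  rw [funext h]
  have hm : Measurable fun z : (LpState N p D × Space d) × Space d =>
      ballKernel D r (z.1.2, z.2) * ‖rep z.1.1 z.1.2 - rep z.1.1 z.2‖ₑ ^ p.toReal := by
    refine ((measurable_ballKernel hD r).comp (by fun_prop)).mul (Measurable.pow_const ?_ _)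
    exact ((measurable_rep_comp (by fun_prop) (by fun_prop)).sub
      (measurable_rep_comp (by fun_prop) (by fun_prop))).enorm
  exact (hm.lintegral_prod_right' (ν := volume.restrict D)).lintegral_prod_right'
    (ν := volume.restrict D)

attribute [irreducible] ballKernel

end Modulus

/-! ### Correlation measures as laws of point values -/

section PointCorrelations

variable {d N : ℕ} {p : ℝ≥0∞} {D : Set (Space d)}

/-- The values of `u` at finitely many points. -/
def repTuple {k : ℕ} (u : LpState N p D) (x : Fin k → Space d) : Fin k → State N :=
  fun i => rep u (x i)

/-- The joint laws of the values at finitely many points of a random element of `L^p(D;U)`. -/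
def pointLaw [Fact (1 ≤ p)] (m : Measure (LpState N p D)) : CorrFamily d N :=
  fun _ x => m.map fun u => repTuple u x

variable [Fact (1 ≤ p)]

lemma lintegral_modulus_le {C : ℝ≥0} {r R : ℝ}
    (hC : ∀ u : LpState N p D, modulus r u ≤ C * ‖u‖ₑ ^ p.toReal)
    {m : Measure (LpState N p D)} [IsProbabilityMeasure m] (hm : ∀ᵐ u ∂m, ‖u‖ ≤ R) :
    ∫⁻ u, modulus r u ∂m ≤ C * ENNReal.ofReal R ^ p.toReal := by
  calc ∫⁻ u, modulus r u ∂m ≤ ∫⁻ _, C * ENNReal.ofReal R ^ p.toReal ∂m := by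
        refine lintegral_mono_ae ?_
        filter_upwards [hm] with u hu
        refine (hC u).trans ?_
        gcongr
        rw [← ofReal_norm]
        exact ENNReal.ofReal_le_ofReal hu
    _ = _ := by simp

variable [IsFiniteMeasure ((volume : Measure (Space d)).restrict D)]

instance (k : ℕ) : IsFiniteMeasure (volPow D k) := by unfold volPow; infer_instance

lemma repTuple_ae_eq (hD : MeasurableSet D) (k : ℕ) (u : LpState N p D) :
    ∀ᵐ x ∂(volPow D k), repTuple u x = fun i => u (x i) := by
  have h : ∀ i : Fin k, ∀ᵐ x ∂(volPow D k), rep u (x i) = u (x i) := fun i =>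
    (Measure.quasiMeasurePreserving_eval
      (fun _ : Fin k => (volume : Measure (Space d)).restrict D) i).ae (rep_ae_eq hD u)
  filter_upwards [ae_all_iff.2 h] with x hx
  exact funext hx

variable [Fact (p ≠ ∞)]

lemma measurable_repTuple (k : ℕ) :
    Measurable fun q : LpState N p D × (Fin k → Space d) => repTuple q.1 q.2 := by
  refine measurable_pi_lambda _ fun i => ?_
  exact measurable_rep_comp measurable_fst ((measurable_pi_apply i).comp measurable_snd)

lemma measurable_repTuple_left {k : ℕ} (x : Fin k → Space d) :
    Measurable fun u : LpState N p D => repTuple u x :=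
  measurable_pi_lambda _ fun _ => measurable_rep_comp measurable_id measurable_const

lemma integral_pointLaw (m : Measure (LpState N p D)) {k : ℕ} (x : Fin k → Space d)
    {f : (Fin k → State N) → ℝ} (hf : Measurable f) :
    ∫ ξ, f ξ ∂(pointLaw m k x) = ∫ u, f (repTuple u x) ∂m :=
  integral_map (measurable_repTuple_left x).aemeasurable hf.aestronglyMeasurable

lemma lintegral_pointLaw (m : Measure (LpState N p D)) {k : ℕ} (x : Fin k → Space d)
    {f : (Fin k → State N) → ℝ≥0∞} (hf : Measurable f) :
    ∫⁻ ξ, f ξ ∂(pointLaw m k x) = ∫⁻ u, f (repTuple u x) ∂m :=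
  lintegral_map hf (measurable_repTuple_left x)

lemma isProbabilityMeasure_pointLaw (m : Measure (LpState N p D)) [IsProbabilityMeasure m] {k : ℕ}
    (x : Fin k → Space d) : IsProbabilityMeasure (pointLaw m k x) :=
  Measure.isProbabilityMeasure_map (measurable_repTuple_left x).aemeasurable

/-- Tonelli, moving the expectation past both space integrals. Diagonal continuity of the
correlation measure thus becomes smallness of the mean modulus of a random function. -/
lemma corrModulus_pointLaw (hD : MeasurableSet D) (m : Measure (LpState N p D)) [SFinite m]
    (r : ℝ) : corrModulus p D (pointLaw m 2) r = ∫⁻ u, modulus r u ∂m := by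
  have hk := measurable_ballKernel hD r
  have hr : Measurable fun z : (LpState N p D × Space d) × Space d =>
      ‖rep z.1.1 z.1.2 - rep z.1.1 z.2‖ₑ ^ p.toReal := by
    refine Measurable.pow_const ?_ _
    exact ((measurable_rep_comp (by fun_prop) (by fun_prop)).sub
      (measurable_rep_comp (by fun_prop) (by fun_prop))).enorm
  have hm : Measurable fun z : (LpState N p D × Space d) × Space d =>
      ballKernel D r (z.1.2, z.2) * ‖rep z.1.1 z.1.2 - rep z.1.1 z.2‖ₑ ^ p.toReal :=
    (hk.comp (by fun_prop : Measurable fun z : (LpState N p D × Space d) × Space d =>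
      (z.1.2, z.2))).mul hr
  have h1 : ∀ u : LpState N p D, modulus r u = ∫⁻ x in D, ∫⁻ y in D,
      ballKernel D r (x, y) * ‖rep u x - rep u y‖ₑ ^ p.toReal := fun u => by
    rw [modulus_eq_fnModulus, ← fnModulus_congr (rep_ae_eq hD u)]; rfl
  have h2 : ∀ x y : Space d, ∫⁻ ξ, ‖ξ 0 - ξ 1‖ₑ ^ p.toReal ∂(pointLaw m 2 ![x, y])
      = ∫⁻ u, ‖rep u x - rep u y‖ₑ ^ p.toReal ∂m := fun x y => by
    rw [lintegral_pointLaw m _ (by fun_prop)]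
    rfl
  unfold corrModulus
  simp_rw [h2, ballAverage_eq_lintegral_ballKernel, h1]
  symm
  rw [lintegral_lintegral_swap
    (hm.lintegral_prod_right' (ν := volume.restrict D)).aemeasurable]
  refine lintegral_congr fun x => ?_
  have hx : Measurable fun q : LpState N p D × Space d =>
      ballKernel D r (x, q.2) * ‖rep q.1 x - rep q.1 q.2‖ₑ ^ p.toReal :=
    hm.comp (by fun_prop : Measurable fun q : LpState N p D × Space d => ((q.1, x), q.2))
  rw [lintegral_lintegral_swap hx.aemeasurable]
  refine lintegral_congr fun y => ?_
  have hu : Measurable fun u : LpState N p D => ‖rep u x - rep u y‖ₑ ^ p.toReal :=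
    ((measurable_rep_comp measurable_id measurable_const).sub
      (measurable_rep_comp measurable_id measurable_const)).enorm.pow_const _
  rw [lintegral_const_mul _ hu]

lemma corrMoment_pointLaw (hD : MeasurableSet D) (m : Measure (LpState N p D)) [SFinite m] :
    corrMoment p D (pointLaw m 1) = ∫⁻ u, ‖u‖ₑ ^ p.toReal ∂m := by
  have h : ∀ x : Fin 1 → Space d, ∫⁻ ξ, ‖ξ 0‖ₑ ^ p.toReal ∂(pointLaw m 1 x)
      = ∫⁻ u, ‖rep u (x 0)‖ₑ ^ p.toReal ∂m := fun x => by
    rw [lintegral_pointLaw m _ (by fun_prop)]; rfl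
  have hm : Measurable fun q : LpState N p D × Space d => ‖rep q.1 q.2‖ₑ ^ p.toReal :=
    measurable_rep.enorm.pow_const _
  unfold corrMoment
  simp_rw [h, enorm_lpState_rpow]
  rw [lintegral_lintegral_swap]
  · refine lintegral_congr fun u => ?_
    have h1 := (measurePreserving_funUnique ((volume : Measure (Space d)).restrict D)
      (Fin 1)).lintegral_comp (hm.comp (measurable_prodMk_left (x := u)))
    refine Eq.trans h1 (lintegral_congr_ae ?_)
    filter_upwards [rep_ae_eq hD u] with x hx
    simp [hx]
  · exact (hm.comp (by fun_prop : Measurable fun q : (Fin 1 → Space d) × LpState N p D =>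
      (q.2, q.1 0))).aemeasurable

lemma tendsto_lintegral_modulus (hD : MeasurableSet D) (hb : Bornology.IsBounded D) {R : ℝ}
    {m : Measure (LpState N p D)} [IsProbabilityMeasure m] (hm : ∀ᵐ u ∂m, ‖u‖ ≤ R) :
    Tendsto (fun r => ∫⁻ u, modulus r u ∂m) (𝓝[>] 0) (𝓝 0) := by
  obtain ⟨C, hC⟩ := exists_modulus_le d N p
  have := tendsto_lintegral_filter_of_dominated_convergence (μ := m) (l := 𝓝[>] (0 : ℝ))
    (F := fun r u => modulus r u) (f := fun _ => 0) (fun _ => C * ENNReal.ofReal R ^ p.toReal)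
    (Eventually.of_forall fun r => measurable_modulus hD r) ?_ (by simp [ENNReal.mul_eq_top])
    (Eventually.of_forall fun u => tendsto_modulus_zero hD hb u)
  · simpa using this
  · filter_upwards [self_mem_nhdsWithin] with r hr
    filter_upwards [hm] with u hu
    refine (hC D hD r hr u).trans ?_
    gcongr
    rw [← ofReal_norm]
    exact ENNReal.ofReal_le_ofReal hu

/-- All the laws are images of the single measure `m` under evaluation of the same representative,
so symmetry and consistency hold at every point. The bound on the norms serves the moment and,
through dominated convergence, the diagonal. -/
lemma isCorrelationMeasure_pointLaw (hD : MeasurableSet D) (hb : Bornology.IsBounded D) {R : ℝ}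
    {m : Measure (LpState N p D)} [IsProbabilityMeasure m] (hm : ∀ᵐ u ∂m, ‖u‖ ≤ R) :
    IsCorrelationMeasure p D (pointLaw m) where
  prob k _ := Eventually.of_forall fun x => isProbabilityMeasure_pointLaw m x
  meas k _ f := by
    simp_rw [integral_pointLaw m _ f.continuous.measurable]
    have h : StronglyMeasurable fun q : LpState N p D × (Fin k → Space d) => f (repTuple q.1 q.2) :=
      (f.continuous.measurable.comp (measurable_repTuple k)).stronglyMeasurable
    exact h.integral_prod_left'.measurable.aemeasurable
  symm k _ σ f := by
    refine Eventually.of_forall fun x => ?_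
    have hf : Measurable (fun ξ => f ξ) := f.continuous.measurable
    rw [integral_pointLaw m _ hf, integral_pointLaw m _
      (f := fun ξ => f (ξ ∘ σ))
      (hf.comp (measurable_pi_lambda _ fun i => measurable_pi_apply (σ i)))]
    rfl
  consistent k _ g := by
    refine Eventually.of_forall fun x => ?_
    have hf : Measurable (fun ξ => g ξ) := g.continuous.measurable
    rw [integral_pointLaw m _ hf, integral_pointLaw m _
      (f := fun ξ : Fin (k + 1) → State N => g fun i => ξ i.castSucc)
      (hf.comp (measurable_pi_lambda _ fun i => measurable_pi_apply _))]
    rfl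
  moment := by
    rw [corrMoment_pointLaw hD]
    calc ∫⁻ u, ‖u‖ₑ ^ p.toReal ∂m ≤ ∫⁻ _, ENNReal.ofReal R ^ p.toReal ∂m := by
          refine lintegral_mono_ae ?_
          filter_upwards [hm] with u hu
          gcongr
          rw [← ofReal_norm]
          exact ENNReal.ofReal_le_ofReal hu
      _ < ∞ := by
          rw [lintegral_const, measure_univ, mul_one]
          exact ENNReal.rpow_lt_top_of_nonneg (zero_le_one.trans (one_le_toReal p))
            ENNReal.ofReal_ne_top
  diag := by
    simp_rw [corrModulus_pointLaw hD]
    exact tendsto_lintegral_modulus hD hb hm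

/-- Fubini with dominating function `‖g x‖`. The map `g` is only almost everywhere strongly
measurable, so a strongly measurable version is used; joint measurability comes from continuity of
evaluation on `C₀ × U^k`. -/
lemma integral_pointLaw_eq_of_integrable (hD : MeasurableSet D) {m : Measure (LpState N p D)}
    [IsProbabilityMeasure m] {k : ℕ} {g : (Fin k → Space d) → C₀((Fin k → State N), ℝ)}
    (hg : Integrable g (volPow D k)) :
    ∫ x, (∫ ξ, g x ξ ∂(pointLaw m k x)) ∂(volPow D k)
      = ∫ u : LpState N p D, (∫ x, g x (fun i => u (x i)) ∂(volPow D k)) ∂m := by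
  set g' := hg.1.mk g with hg'
  have hgg : g =ᵐ[volPow D k] g' := hg.1.ae_eq_mk
  have hg's : StronglyMeasurable g' := hg.1.stronglyMeasurable_mk
  have heval : Continuous fun q : C₀((Fin k → State N), ℝ) × (Fin k → State N) => q.1 q.2 :=
    (continuous_eval (F := (Fin k → State N) →ᵇ ℝ)).comp
      ((ZeroAtInftyContinuousMap.isometry_toBCF.continuous.comp continuous_fst).prodMk
        continuous_snd)
  have hs : StronglyMeasurable fun q : (Fin k → Space d) × LpState N p D =>
      g' q.1 (repTuple q.2 q.1) :=
    heval.comp_stronglyMeasurable ((hg's.comp_measurable measurable_fst).prodMk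
      ((measurable_repTuple k).comp measurable_swap).stronglyMeasurable)
  have hint : Integrable (fun q : (Fin k → Space d) × LpState N p D => g' q.1 (repTuple q.2 q.1))
      ((volPow D k).prod m) := by
    have h1 : Integrable (fun q : (Fin k → Space d) × LpState N p D => g' q.1)
        ((volPow D k).prod m) := (hg.congr hgg).comp_fst m
    refine h1.norm.mono hs.aestronglyMeasurable (Eventually.of_forall fun q => ?_)
    rw [norm_norm, ← ZeroAtInftyContinuousMap.norm_toBCF_eq_norm]
    exact BoundedContinuousFunction.norm_coe_le_norm (g' q.1).toBCF _
  calc ∫ x, (∫ ξ, g x ξ ∂(pointLaw m k x)) ∂(volPow D k)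
      = ∫ x, (∫ u, g' x (repTuple u x) ∂m) ∂(volPow D k) := by
        refine integral_congr_ae ?_
        filter_upwards [hgg] with x hx
        have hf : Measurable (fun ξ => g' x ξ) := (g' x).continuous.measurable
        rw [hx, integral_pointLaw m _ hf]
    _ = ∫ u, (∫ x, g' x (repTuple u x) ∂(volPow D k)) ∂m := integral_integral_swap hint
    _ = _ := by
        refine integral_congr_ae (Eventually.of_forall fun u => integral_congr_ae ?_)
        filter_upwards [hgg, repTuple_ae_eq hD k u] with x hx hu
        rw [hx, hu]

/-- The correlation measures of a kernel from time to `L^p(D;U)`. -/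
lemma hasCorrelationMeasure_pointLaw (hD : MeasurableSet D) (hb : Bornology.IsBounded D) {T R : ℝ}
    (κ : ProbabilityTheory.Kernel ℝ (LpState N p D)) [ProbabilityTheory.IsMarkovKernel κ]
    (hκ : ∀ᵐ t ∂(timeVol T), ∀ᵐ u ∂(κ t), ‖u‖ ≤ R) :
    HasCorrelationMeasure T (fun t => κ t) (fun k t => pointLaw (κ t) k) where
  prob t _ := inferInstance
  dual := Eventually.of_forall fun t k _ g hg => integral_pointLaw_eq_of_integrable hD hg
  corr :=
    { meas := fun k _ f => by
        have hf : Measurable (fun ξ => f ξ) := f.continuous.measurable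
        simp_rw [integral_pointLaw _ _ hf]
        have h : StronglyMeasurable fun q : (ℝ × (Fin k → Space d)) × LpState N p D =>
            f (repTuple q.2 q.1.2) :=
          (f.continuous.measurable.comp ((measurable_repTuple k).comp
            (by fun_prop : Measurable fun q : (ℝ × (Fin k → Space d)) × LpState N p D =>
              (q.2, q.1.2)))).stronglyMeasurable
        exact (StronglyMeasurable.integral_kernel_prod_right'
          (κ := κ.comap Prod.fst measurable_fst) h).measurable.aemeasurable
      slice := hκ.mono fun t ht => isCorrelationMeasure_pointLaw hD hb ht
      moment := by
        refine ⟨R.toNNReal ^ p.toReal, hκ.mono fun t ht => ?_⟩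
        rw [corrMoment_pointLaw hD]
        calc ∫⁻ u, ‖u‖ₑ ^ p.toReal ∂(κ t) ≤ ∫⁻ _, ENNReal.ofReal R ^ p.toReal ∂(κ t) := by
              refine lintegral_mono_ae ?_
              filter_upwards [ht] with u hu
              gcongr
              rw [← ofReal_norm]
              exact ENNReal.ofReal_le_ofReal hu
          _ = _ := by
              simp [ENNReal.coe_rpow_of_nonneg _ (zero_le_one.trans (one_le_toReal p)),
                ENNReal.ofReal]
      diag := fun T' hT' => by
        have hκ' : ∀ᵐ t ∂(timeVol T'), ∀ᵐ u ∂(κ t), ‖u‖ ≤ R :=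
          ae_mono (Measure.restrict_mono (Ico_subset_Ico_right hT'.2.le) le_rfl) hκ
        simp_rw [corrModulus_pointLaw hD]
        obtain ⟨C, hC⟩ := exists_modulus_le d N p
        have hfin : IsFiniteMeasure (timeVol T') := by unfold timeVol; infer_instance
        -- Dominated convergence in time: each slice tends to zero, and the mean moduli are bounded
        -- uniformly in `t` and `r` since `κ t` lives on a fixed ball.
        have := tendsto_lintegral_filter_of_dominated_convergence (μ := timeVol T')
          (l := 𝓝[>] (0 : ℝ)) (F := fun r t => ∫⁻ u, modulus r u ∂(κ t)) (f := fun _ => 0)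
          (fun _ => C * ENNReal.ofReal R ^ p.toReal)
          (Eventually.of_forall fun r => (measurable_modulus hD r).lintegral_kernel) ?_
          (by simp [ENNReal.mul_eq_top])
          (hκ'.mono fun t ht => tendsto_lintegral_modulus hD hb ht)
        · simpa using this
        · filter_upwards [self_mem_nhdsWithin] with r hr
          filter_upwards [hκ'] with t ht
          exact lintegral_modulus_le (hC D hD r hr) ht }

end PointCorrelations

/-! ### Power means -/

section PowerMean

variable {α : Type*} [MeasurableSpace α]

/-- The power mean inequality. -/
lemma rpow_lintegral_le {μ : Measure α} {f : α → ℝ≥0∞} {p : ℝ}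
    (hp : 1 ≤ p) (hf : AEMeasurable f μ) :
    (∫⁻ x, f x ∂μ) ^ p ≤ μ univ ^ (p - 1) * ∫⁻ x, f x ^ p ∂μ := by
  have h := eLpNorm'_le_eLpNorm'_mul_rpow_measure_univ (μ := μ) (f := f) zero_lt_one hp
    hf.aestronglyMeasurable
  simp only [eLpNorm', enorm_eq_self, ENNReal.rpow_one, div_one] at h
  have h2 := ENNReal.rpow_le_rpow h (zero_le_one.trans hp)
  rw [ENNReal.mul_rpow_of_nonneg _ _ (zero_le_one.trans hp), ← ENNReal.rpow_mul,
    ← ENNReal.rpow_mul, one_div_mul_cancel (by linarith), ENNReal.rpow_one, sub_mul,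
    one_div_mul_cancel (by linarith), one_mul, mul_comm] at h2
  exact h2

/-- Jensen's inequality: the difference of `c` and the average of `u` is the average of `c - u`. -/
lemma enorm_sub_setAverage_rpow_le {E : Type*} [NormedAddCommGroup E] [NormedSpace ℝ E]
    [CompleteSpace E] {μ : Measure α} {s : Set α} (h0 : μ s ≠ 0) (ht : μ s ≠ ∞) {u : α → E}
    (hu : IntegrableOn u s μ) (c : E) {p : ℝ} (hp : 1 ≤ p) :
    ‖c - ⨍ x in s, u x ∂μ‖ₑ ^ p ≤ (μ s)⁻¹ * ∫⁻ x in s, ‖c - u x‖ₑ ^ p ∂μ := by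
  have hc : IntegrableOn (fun _ => c) s μ := integrableOn_const ht
  have heq : c - ⨍ x in s, u x ∂μ = (μ.real s)⁻¹ • ∫ x in s, (c - u x) ∂μ := by
    rw [integral_sub hc hu, smul_sub, ← setAverage_eq, ← setAverage_eq, setAverage_const h0 ht]
  have hen : ‖(μ.real s)⁻¹‖ₑ = (μ s)⁻¹ := by
    rw [enorm_inv (by simp [measureReal_def, ENNReal.toReal_eq_zero_iff, h0, ht]), measureReal_def,
      Real.enorm_of_nonneg ENNReal.toReal_nonneg, ENNReal.ofReal_toReal ht]
  calc ‖c - ⨍ x in s, u x ∂μ‖ₑ ^ p ≤ ((μ s)⁻¹ * ∫⁻ x in s, ‖c - u x‖ₑ ∂μ) ^ p := by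
        rw [heq, enorm_smul, hen]
        gcongr
        exact enorm_integral_le_lintegral_enorm _
    _ = (μ s)⁻¹ ^ p * (∫⁻ x in s, ‖c - u x‖ₑ ∂μ) ^ p :=
        ENNReal.mul_rpow_of_nonneg _ _ (by linarith)
    _ ≤ (μ s)⁻¹ ^ p * (μ s ^ (p - 1) * ∫⁻ x in s, ‖c - u x‖ₑ ^ p ∂μ) := by
        gcongr
        have := rpow_lintegral_le hp (hc.sub hu).1.enorm
        rwa [Measure.restrict_apply_univ] at this
    _ = _ := by
        rw [← mul_assoc]
        congr 1
        rw [ENNReal.inv_rpow, ← ENNReal.rpow_neg, ← ENNReal.rpow_add _ _ h0 ht,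
          ← ENNReal.rpow_neg_one]
        congr 1
        ring

end PowerMean

/-! ### Meshes and projection onto cell averages -/

namespace Mesh

variable {d : ℕ}

lemma index_eq_of_mem_cell {M : Mesh d} {i : Fin d → ℤ} {x : Space d} (hx : x ∈ M.cell i) :
    M.index x = i := by
  funext m
  have h := hx m
  have hs := M.size_pos
  rw [index, Int.floor_eq_iff, le_div_iff₀ hs, div_lt_iff₀ hs]
  constructor <;> linarith

lemma index_bounds (M : Mesh d) (x : Space d) (m : Fin d) :
    M.origin m + M.size * M.index x m ≤ x m ∧ x m < M.origin m + M.size * (M.index x m + 1) := by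
  have hs := M.size_pos
  have h := (Int.floor_eq_iff (a := (x m - M.origin m) / M.size) (z := M.index x m)).1 rfl
  rw [le_div_iff₀ hs, div_lt_iff₀ hs] at h
  constructor <;> linarith

lemma isOpen_cell (M : Mesh d) (i : Fin d → ℤ) : IsOpen (M.cell i) := by
  have : M.cell i = ⋂ m, {x : Space d | M.origin m + M.size * i m < x m ∧
      x m < M.origin m + M.size * (i m + 1)} := by
    ext x; simp [cell]
  rw [this]
  refine isOpen_iInter_of_finite fun m => IsOpen.and ?_ ?_
  · exact isOpen_lt continuous_const (by fun_prop)
  · exact isOpen_lt (by fun_prop) continuous_const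

lemma norm_le_sum_abs (x : Space d) : ‖x‖ ≤ ∑ m, |x m| := by
  rw [EuclideanSpace.norm_eq]
  refine Real.sqrt_le_iff.2 ⟨Finset.sum_nonneg fun _ _ => abs_nonneg _, ?_⟩
  simp only [Real.norm_eq_abs]
  exact Finset.sum_sq_le_sq_sum_of_nonneg fun _ _ => abs_nonneg _

lemma abs_apply_le_norm (x : Space d) (m : Fin d) : |x m| ≤ ‖x‖ := PiLp.norm_apply_le x m

/-- Each coordinate differs by at most the mesh size, so the `ℓ¹` distance is at most `d` mesh
sizes. The additional one makes the inequality strict and the radius positive when `d = 0`. -/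
lemma dist_lt_of_mem_cell_index {M : Mesh d} {x z : Space d} (hz : z ∈ M.cell (M.index x)) :
    dist z x < (d + 1) * M.size := by
  have hs := M.size_pos
  rw [dist_eq_norm]
  calc ‖z - x‖ ≤ ∑ m, |(z - x) m| := norm_le_sum_abs _
    _ ≤ ∑ _m : Fin d, M.size := by
        refine Finset.sum_le_sum fun m _ => ?_
        have h1 := hz m
        have h2 := M.index_bounds x m
        rw [PiLp.sub_apply, abs_le]
        constructor <;> linarith
    _ = d * M.size := by simp
    _ < _ := by linarith

lemma volume_cell (M : Mesh d) (i : Fin d → ℤ) :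
    volume (M.cell i) = ENNReal.ofReal (M.size ^ d) := by
  have h : M.cell i = (WithLp.ofLp : Space d → Fin d → ℝ) ⁻¹'
      (univ.pi fun m => Ioo (M.origin m + M.size * i m) (M.origin m + M.size * (i m + 1))) := by
    ext x; simp [cell]
  rw [h, (PiLp.volume_preserving_ofLp (Fin d)).measure_preimage
    (MeasurableSet.univ_pi fun _ => measurableSet_Ioo).nullMeasurableSet, Real.volume_pi_Ioo]
  have : ∀ m : Fin d, M.origin m + M.size * (i m + 1) - (M.origin m + M.size * i m) = M.size :=
    fun m => by ring
  simp [this, ENNReal.ofReal_pow M.size_pos.le]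

lemma finite_index_image (M : Mesh d) {D : Set (Space d)} (hD : Bornology.IsBounded D) :
    (M.index '' D).Finite := by
  obtain ⟨R, hR⟩ := hD.subset_closedBall (0 : Space d)
  refine (Set.finite_Icc (fun m => ⌊(-R - M.origin m) / M.size⌋)
    (fun m => ⌊(R - M.origin m) / M.size⌋)).subset ?_
  rintro _ ⟨x, hx, rfl⟩
  have hxm : ∀ m, |x m| ≤ R := fun m =>
    (abs_apply_le_norm x m).trans (mem_closedBall_zero_iff.1 (hR hx))
  refine ⟨fun m => Int.floor_le_floor ?_, fun m => Int.floor_le_floor ?_⟩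
  · have := (abs_le.1 (hxm m)).1
    exact div_le_div_of_nonneg_right (by linarith) M.size_pos.le
  · have := (abs_le.1 (hxm m)).2
    exact div_le_div_of_nonneg_right (by linarith) M.size_pos.le

lemma cell_nonempty (M : Mesh d) (i : Fin d → ℤ) : (M.cell i).Nonempty := by
  refine ⟨WithLp.toLp 2 fun m => M.origin m + M.size * (i m + 1 / 2), fun m => ?_⟩
  have hs := M.size_pos
  simp only
  constructor <;> nlinarith

lemma interior_subset_index_image (M : Mesh d) (D : Set (Space d)) :
    M.interior D ⊆ M.index '' D := fun i hi => by
  obtain ⟨x, hx⟩ := M.cell_nonempty i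
  exact ⟨x, hi hx, index_eq_of_mem_cell hx⟩

lemma finite_interior (M : Mesh d) {D : Set (Space d)} (hD : Bornology.IsBounded D) :
    (M.interior D).Finite :=
  (M.finite_index_image hD).subset (M.interior_subset_index_image D)

section Projection

variable {N : ℕ} {p : ℝ≥0∞} {D : Set (Space d)}

lemma coeFn_toLpState (M : Mesh d) (hD : Bornology.IsBounded D) (v : (Fin d → ℤ) → State N) :
    M.toLpState p hD v =ᵐ[volume.restrict D] M.piecewiseConst v :=
  MemLp.coeFn_toLp _

lemma cellAverage_of_mem (M : Mesh d) (u : LpState N p D) {i : Fin d → ℤ}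
    (hi : i ∈ M.interior D) : M.cellAverage u i = ⨍ x in M.cell i, u x := if_pos hi

lemma cellAverage_of_notMem (M : Mesh d) (u : LpState N p D) {i : Fin d → ℤ}
    (hi : i ∉ M.interior D) : M.cellAverage u i = 0 := if_neg hi

variable [IsFiniteMeasure ((volume : Measure (Space d)).restrict D)]

lemma norm_toLpState_sub_le (M : Mesh d) (hD : Bornology.IsBounded D) (hDm : MeasurableSet D)
    {v w : (Fin d → ℤ) → State N} {δ : ℝ} (hδ : 0 ≤ δ) (h : ∀ i ∈ M.index '' D, ‖v i - w i‖ ≤ δ) :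
    ‖M.toLpState p hD v - M.toLpState p hD w‖
      ≤ measureUnivNNReal ((volume : Measure (Space d)).restrict D) ^ p.toReal⁻¹ * δ := by
  refine Lp.norm_le_of_ae_bound hδ ?_
  filter_upwards [Lp.coeFn_sub (M.toLpState p hD v) (M.toLpState p hD w),
    M.coeFn_toLpState (p := p) hD v, M.coeFn_toLpState (p := p) hD w, ae_restrict_mem hDm]
    with x hx hv hw hxD
  rw [hx, Pi.sub_apply, hv, hw]
  exact h _ ⟨x, hxD, rfl⟩

variable [Fact (1 ≤ p)]

lemma integrableOn_cell (M : Mesh d) (u : LpState N p D) {i : Fin d → ℤ}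
    (hi : i ∈ M.interior D) : IntegrableOn u (M.cell i) :=
  IntegrableOn.mono_set (t := D) (integrable_lpState u) hi

variable [Fact (p ≠ ∞)]

lemma enorm_sub_cellAverage_rpow_le (M : Mesh d) (u : LpState N p D) {i : Fin d → ℤ}
    (hi : i ∈ M.interior D) (c : State N) :
    ‖c - M.cellAverage u i‖ₑ ^ p.toReal
      ≤ (ENNReal.ofReal (M.size ^ d))⁻¹ * ∫⁻ x in M.cell i, ‖c - u x‖ₑ ^ p.toReal := by
  have hpos : 0 < M.size ^ d := pow_pos M.size_pos d
  rw [cellAverage_of_mem M u hi, ← M.volume_cell i]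
  refine enorm_sub_setAverage_rpow_le ?_ ?_ (M.integrableOn_cell u hi) c (one_le_toReal p)
  · rw [M.volume_cell]; simpa using hpos
  · rw [M.volume_cell]; simp

/-- Cell averaging does not increase the `L^p` norm. -/
lemma tsum_cellAverage_rpow_le (M : Mesh d) (u : LpState N p D) :
    ENNReal.ofReal (M.size ^ d) * ∑' i, ‖M.cellAverage u i‖ₑ ^ p.toReal ≤ ‖u‖ₑ ^ p.toReal := by
  have hp := one_le_toReal p
  have hpos : 0 < M.size ^ d := pow_pos M.size_pos d
  rw [← ENNReal.tsum_mul_left, enorm_lpState_rpow]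
  have hle : ∀ i, ENNReal.ofReal (M.size ^ d) * ‖M.cellAverage u i‖ₑ ^ p.toReal
      ≤ ∫⁻ x in M.cell i, ‖u x‖ₑ ^ p.toReal ∂(volume.restrict D) := fun i => by
    by_cases hi : i ∈ M.interior D
    · have h := M.enorm_sub_cellAverage_rpow_le u hi 0
      simp only [zero_sub, enorm_neg] at h
      rw [Measure.restrict_restrict (M.isOpen_cell i).measurableSet, inter_eq_left.2 hi]
      calc _ ≤ ENNReal.ofReal (M.size ^ d) * ((ENNReal.ofReal (M.size ^ d))⁻¹ *
              ∫⁻ x in M.cell i, ‖u x‖ₑ ^ p.toReal) := by gcongr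
        _ = _ := by
            rw [← mul_assoc, ENNReal.mul_inv_cancel (by simpa using hpos) ENNReal.ofReal_ne_top,
              one_mul]
    · rw [M.cellAverage_of_notMem u hi, enorm_zero, ENNReal.zero_rpow_of_pos (by linarith),
        mul_zero]
      exact zero_le
  refine (ENNReal.tsum_le_tsum hle).trans ?_
  rw [← lintegral_iUnion (fun i => (M.isOpen_cell i).measurableSet)]
  · exact setLIntegral_le_lintegral _ _
  · intro i j hij
    refine Set.disjoint_left.2 fun x hi hj => hij ?_
    rw [← index_eq_of_mem_cell hi, ← index_eq_of_mem_cell hj]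

/-- The part of the averaging kernel mass that belongs to the cells not contained in `D`. -/
def boundaryMass (M : Mesh d) (D : Set (Space d)) (r : ℝ) : ℝ≥0∞ :=
  ∫⁻ x in D, (M.index ⁻¹' (M.interior D)ᶜ).indicator
    (fun x => (volume (Metric.ball x r ∩ D))⁻¹) x

/-- Projection onto the piecewise constant functions, measured by moduli of continuity. -/
lemma exists_enorm_sub_projection_rpow_le (d N : ℕ) (p : ℝ≥0∞) [Fact (1 ≤ p)] [Fact (p ≠ ∞)] :
    ∃ K : ℝ≥0, ∀ (D : Set (Space d)) (_ : IsOpen D) (hb : Bornology.IsBounded D) (M : Mesh d)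
      (r : ℝ), 0 < r → ∀ u : LpState N p D,
      ‖u - M.toLpState p hb (M.cellAverage u)‖ₑ ^ p.toReal
        ≤ K * (modulus ((d + 1) * M.size) u + modulus r u
          + M.boundaryMass D r * ‖u‖ₑ ^ p.toReal) := by
  have hp := one_le_toReal p
  have hKt : ENNReal.ofReal ((d + 1) ^ d) * volume (Metric.ball (0 : Space d) 1) ≠ ∞ :=
    ENNReal.mul_ne_top ENNReal.ofReal_ne_top measure_ball_lt_top.ne
  have h2t : (2 : ℝ≥0∞) ^ (p.toReal - 1) ≠ ∞ := by simp
  -- The first summand is the volume of a ball of radius `(d + 1)Δ` relative to a cell; the second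
  -- is the convexity constant of the `p`-th power.
  refine ⟨(ENNReal.ofReal ((d + 1) ^ d) * volume (Metric.ball (0 : Space d) 1)).toNNReal
    + ((2 : ℝ≥0∞) ^ (p.toReal - 1)).toNNReal, fun D hD hb M r hr u => ?_⟩
  have := isFiniteMeasure_restrict_of_isBounded hb
  push_cast
  rw [ENNReal.coe_toNNReal hKt, ENNReal.coe_toNNReal h2t]
  set K₁ := ENNReal.ofReal ((d + 1) ^ d) * volume (Metric.ball (0 : Space d) 1)
  set K₂ := (2 : ℝ≥0∞) ^ (p.toReal - 1)
  have hs := M.size_pos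
  have hpos : 0 < M.size ^ d := pow_pos hs d
  set W : ℝ → Space d → ℝ≥0∞ := fun ρ x => ballAverage D x ρ fun y => ‖u x - u y‖ₑ ^ p.toReal
  set e : Space d → ℝ≥0∞ := fun x => (M.index ⁻¹' (M.interior D)ᶜ).indicator
    (fun x => (volume (Metric.ball x r ∩ D))⁻¹) x
  have hu : StronglyMeasurable u := Lp.stronglyMeasurable u
  have hW : ∀ ρ, Measurable (W ρ) := fun ρ => by
    have h : Measurable fun q : Space d × Space d =>
        ballKernel D ρ q * ‖u q.1 - u q.2‖ₑ ^ p.toReal :=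
      (measurable_ballKernel hD.measurableSet ρ).mul ((((hu.comp_measurable measurable_fst).sub
        (hu.comp_measurable measurable_snd)).enorm).pow_const _)
    have h2 : W ρ = fun x => ∫⁻ y in D, ballKernel D ρ (x, y) * ‖u x - u y‖ₑ ^ p.toReal :=
      funext fun x => ballAverage_eq_lintegral_ballKernel x ρ _
    rw [h2]
    exact h.lintegral_prod_right' (ν := volume.restrict D)
  have he : Measurable e :=
    (measurable_volume_ball_inter hD.measurableSet r).inv.indicator
      (M.measurable_index (Set.to_countable _).measurableSet)
  have hpt : ∀ x ∈ D, ‖u x - M.piecewiseConst (M.cellAverage u) x‖ₑ ^ p.toReal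
      ≤ K₁ * W ((d + 1) * M.size) x + (K₂ * W r x + K₂ * (e x * ‖u‖ₑ ^ p.toReal)) := by
    intro x hx
    by_cases hi : M.index x ∈ M.interior D
    -- A cell inside `D` is contained in the ball of radius `(d + 1)Δ` about each point it contains,
    -- of comparable volume. The mean over the cell is therefore at most `K₁` times the mean over
    -- that ball in `D`.
    · refine le_trans ?_ le_self_add
      have hball : M.cell (M.index x) ⊆ Metric.ball x ((d + 1) * M.size) ∩ D := fun z hz =>
        ⟨Metric.mem_ball.2 (dist_lt_of_mem_cell_index hz), hi hz⟩
      have hvol : volume (Metric.ball x ((d + 1) * M.size) ∩ D)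
          ≤ K₁ * ENNReal.ofReal (M.size ^ d) := by
        refine (measure_mono inter_subset_left).trans ?_
        rw [Measure.addHaar_ball_of_pos volume x (by positivity), finrank_euclideanSpace, Fintype.card_fin,
          mul_pow, ENNReal.ofReal_mul (by positivity)]
        apply le_of_eq
        ring
      have h0 := volume_ball_inter_ne_zero hD hx (r := (d + 1) * M.size) (by positivity)
      have ht : volume (Metric.ball x ((d + 1) * M.size) ∩ D) ≠ ∞ :=
        ((measure_mono inter_subset_left).trans_lt measure_ball_lt_top).ne
      calc ‖u x - M.cellAverage u (M.index x)‖ₑ ^ p.toReal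
          ≤ (ENNReal.ofReal (M.size ^ d))⁻¹ *
            ∫⁻ y in M.cell (M.index x), ‖u x - u y‖ₑ ^ p.toReal :=
            M.enorm_sub_cellAverage_rpow_le u hi _
        _ ≤ (K₁ * (volume (Metric.ball x ((d + 1) * M.size) ∩ D))⁻¹) *
            ∫⁻ y in Metric.ball x ((d + 1) * M.size) ∩ D, ‖u x - u y‖ₑ ^ p.toReal := by
            refine mul_le_mul' ?_ (lintegral_mono_set hball)
            rw [← div_eq_mul_inv, ENNReal.le_div_iff_mul_le (Or.inl h0) (Or.inl ht), mul_comm,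
              ← div_eq_mul_inv]
            exact ENNReal.div_le_of_le_mul hvol
        _ = _ := by
            simp only [W, ballAverage]
            rw [ENNReal.div_eq_inv_mul, mul_assoc]
    -- In a cell not contained in `D` the projection is zero, so `u x` itself has to be estimated.
    -- It is compared with `u y` on average over `B_r(x)`: the difference gives the modulus at `r`,
    -- and the mean of `|u y|^p` leaves the weight `1/|B_r(x) ∩ D|`, which integrates to the
    -- boundary mass.
    · refine le_trans ?_ le_add_self
      have h0 := volume_ball_inter_ne_zero hD hx hr
      have ht : volume (Metric.ball x r ∩ D) ≠ ∞ :=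
        ((measure_mono inter_subset_left).trans_lt measure_ball_lt_top).ne
      have hex : e x = (volume (Metric.ball x r ∩ D))⁻¹ := indicator_of_mem (by exact hi) _
      have hpw : M.piecewiseConst (M.cellAverage u) x = 0 := M.cellAverage_of_notMem u hi
      have hm : Measurable fun y => ‖u x - u y‖ₑ ^ p.toReal :=
        (stronglyMeasurable_const.sub hu).enorm.pow_const _
      rw [hpw, sub_zero, hex, ← mul_add]
      calc ‖u x‖ₑ ^ p.toReal
          = (volume (Metric.ball x r ∩ D))⁻¹ * ∫⁻ _ in Metric.ball x r ∩ D, ‖u x‖ₑ ^ p.toReal := by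
            rw [lintegral_const, Measure.restrict_apply_univ, mul_comm, mul_assoc,
              ENNReal.mul_inv_cancel h0 ht, mul_one]
        _ ≤ (volume (Metric.ball x r ∩ D))⁻¹ * ∫⁻ y in Metric.ball x r ∩ D,
              K₂ * (‖u x - u y‖ₑ ^ p.toReal + ‖u y‖ₑ ^ p.toReal) := by
            gcongr with y
            calc ‖u x‖ₑ ^ p.toReal ≤ (‖u x - u y‖ₑ + ‖u y‖ₑ) ^ p.toReal := by
                  gcongr
                  simpa using enorm_add_le (u x - u y) (u y)
              _ ≤ _ := ENNReal.rpow_add_le_mul_rpow_add_rpow _ _ hp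
        _ = K₂ * (W r x + (volume (Metric.ball x r ∩ D))⁻¹ *
              ∫⁻ y in Metric.ball x r ∩ D, ‖u y‖ₑ ^ p.toReal) := by
            simp only [W, ballAverage]
            rw [lintegral_const_mul' _ _ h2t, lintegral_add_left hm, ENNReal.div_eq_inv_mul]
            ring
        _ ≤ _ := by
            gcongr
            rw [enorm_lpState_rpow]
            exact lintegral_mono_set inter_subset_right
  calc ‖u - M.toLpState p hb (M.cellAverage u)‖ₑ ^ p.toReal
      = ∫⁻ x in D, ‖u x - M.piecewiseConst (M.cellAverage u) x‖ₑ ^ p.toReal := by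
        rw [enorm_lpState_rpow]
        refine lintegral_congr_ae ?_
        filter_upwards [Lp.coeFn_sub u (M.toLpState p hb (M.cellAverage u)),
          M.coeFn_toLpState (p := p) hb (M.cellAverage u)] with x hx hv
        rw [hx, Pi.sub_apply, hv]
    _ ≤ ∫⁻ x in D, (K₁ * W ((d + 1) * M.size) x + (K₂ * W r x + K₂ * (e x * ‖u‖ₑ ^ p.toReal))) :=
        setLIntegral_mono' hD.measurableSet hpt
    _ = K₁ * modulus ((d + 1) * M.size) u
          + (K₂ * modulus r u + K₂ * (M.boundaryMass D r * ‖u‖ₑ ^ p.toReal)) := by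
        rw [lintegral_add_left ((hW _).const_mul _), lintegral_add_left ((hW _).const_mul _),
          lintegral_const_mul _ (hW _), lintegral_const_mul _ (hW _),
          lintegral_const_mul _ (he.mul_const _), lintegral_mul_const _ he]
        rfl
    _ ≤ (K₁ + K₂) * modulus ((d + 1) * M.size) u + ((K₁ + K₂) * modulus r u
          + (K₁ + K₂) * (M.boundaryMass D r * ‖u‖ₑ ^ p.toReal)) := by
        gcongr
        · exact le_self_add
        · exact le_add_self
        · exact le_add_self
    _ = _ := by ring

/-- Dominated convergence: since `D` is open, the cell of a given `x ∈ D` lies in `D` once the mesh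
is fine, and `1/|B_r(x) ∩ D|` is integrable over `D`. The boundary of `D` may have positive measure.
-/
lemma tendsto_boundaryMass {D : Set (Space d)} (hD : IsOpen D) (hb : Bornology.IsBounded D)
    {r : ℝ} (hr : 0 < r) {M : ℕ → Mesh d} (hM : Tendsto (fun n => (M n).size) atTop (𝓝 0)) :
    Tendsto (fun n => (M n).boundaryMass D r) atTop (𝓝 0) := by
  have hm := (measurable_volume_ball_inter hD.measurableSet r).inv
  have := tendsto_lintegral_of_dominated_convergence' (μ := volume.restrict D)
    (F := fun n x => ((M n).index ⁻¹' ((M n).interior D)ᶜ).indicator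
      (fun x => (volume (Metric.ball x r ∩ D))⁻¹) x) (f := fun _ => 0)
    (fun x => (volume (Metric.ball x r ∩ D))⁻¹)
    (fun n => (hm.indicator ((M n).measurable_index (Set.to_countable _).measurableSet)).aemeasurable)
    (fun n => Eventually.of_forall fun x => indicator_le_self _ _ _)
    (lintegral_inv_volume_ball_lt_top hD.measurableSet hb hr).ne ?_
  · rw [lintegral_zero] at this
    exact this
  · filter_upwards [ae_restrict_mem hD.measurableSet] with x hx
    obtain ⟨δ, hδ, hball⟩ := Metric.isOpen_iff.1 hD x hx
    have hev : ∀ᶠ n in atTop, ((d : ℝ) + 1) * (M n).size < δ := by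
      have : Tendsto (fun n => ((d : ℝ) + 1) * (M n).size) atTop (𝓝 0) := by
        simpa using hM.const_mul ((d : ℝ) + 1)
      exact this.eventually (gt_mem_nhds hδ)
    refine tendsto_const_nhds.congr' ?_
    filter_upwards [hev] with n hn
    rw [indicator_of_notMem]
    simp only [mem_preimage, mem_compl_iff, not_not]
    exact fun z hz => hball (Metric.mem_ball.2 ((dist_lt_of_mem_cell_index hz).trans hn))

/-- The projections of a bounded set of functions are precompact. -/
lemma exists_isCompact_projection_mem (hD : MeasurableSet D) (hb : Bornology.IsBounded D)
    (M : Mesh d) (R : ℝ) :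
    ∃ K : Set (LpState N p D), IsCompact K ∧
      ∀ u : LpState N p D, ‖u‖ ≤ R → M.toLpState p hb (M.cellAverage u) ∈ K := by
  classical
  have hp := one_le_toReal p
  set J := (M.finite_index_image hb).toFinset
  -- Only finitely many cells meet `D`, so the projections of a ball lie in a continuous image of a
  -- closed ball in a finite-dimensional space.
  let ext : (J → State N) → (Fin d → ℤ) → State N := fun w i => if h : i ∈ J then w ⟨i, h⟩ else 0
  have hcont : Continuous fun w : J → State N => M.toLpState p hb (ext w) := by
    refine LipschitzWith.continuous (K := measureUnivNNReal
      ((volume : Measure (Space d)).restrict D) ^ p.toReal⁻¹) (LipschitzWith.of_dist_le_mul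
        fun w w' => ?_)
    rw [dist_eq_norm, dist_eq_norm]
    refine M.norm_toLpState_sub_le hb hD (norm_nonneg _) fun i hi => ?_
    have hiJ : i ∈ J := (M.finite_index_image hb).mem_toFinset.2 hi
    simp only [ext, hiJ, dif_pos]
    exact norm_le_pi_norm (w - w') ⟨i, hiJ⟩
  have hpos : 0 < M.size ^ d := pow_pos M.size_pos d
  set B := ((ENNReal.ofReal (M.size ^ d))⁻¹ * ENNReal.ofReal R ^ p.toReal) ^ (p.toReal)⁻¹
  have hB : B ≠ ∞ := by
    refine ENNReal.rpow_ne_top_of_nonneg (by positivity) (ENNReal.mul_ne_top ?_ ?_)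
    · simpa using hpos
    · exact ENNReal.rpow_ne_top_of_nonneg (by linarith) ENNReal.ofReal_ne_top
  refine ⟨_, (isCompact_closedBall (0 : J → State N) B.toReal).image hcont, fun u hu => ?_⟩
  refine ⟨fun j => M.cellAverage u j, ?_, ?_⟩
  · rw [mem_closedBall_zero_iff, pi_norm_le_iff_of_nonneg ENNReal.toReal_nonneg]
    intro j
    have h1 : ENNReal.ofReal (M.size ^ d) * ‖M.cellAverage u j‖ₑ ^ p.toReal
        ≤ ENNReal.ofReal R ^ p.toReal := by
      refine le_trans ?_ ((M.tsum_cellAverage_rpow_le u).trans ?_)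
      · gcongr
        exact ENNReal.le_tsum (f := fun i => ‖M.cellAverage u i‖ₑ ^ p.toReal) (j : Fin d → ℤ)
      · gcongr
        rw [← ofReal_norm]
        exact ENNReal.ofReal_le_ofReal hu
    have h2 : ‖M.cellAverage u j‖ₑ ≤ B := by
      rw [ENNReal.le_rpow_inv_iff (by linarith), ← ENNReal.div_eq_inv_mul,
        ENNReal.le_div_iff_mul_le (Or.inl (by simpa using hpos)) (Or.inl ENNReal.ofReal_ne_top),
        mul_comm]
      exact h1
    rw [← toReal_enorm]
    exact ENNReal.toReal_mono hB h2
  · simp only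
    rw [← sub_eq_zero, ← norm_le_zero_iff]
    refine (M.norm_toLpState_sub_le hb hD le_rfl fun i hi => ?_).trans (by simp)
    have hiJ : i ∈ J := (M.finite_index_image hb).mem_toFinset.2 hi
    simp [ext, hiJ]

end Projection

end Mesh

open ProbabilityTheory

/-! ### Tightness from moduli of continuity -/

section Compactness

/-- A sequence of finite measures that, up to small mass, eventually lives on finitely many small
balls is tight. -/
lemma isTightMeasureSet_range_of_finite_cover {X : Type*} [MetricSpace X] [CompleteSpace X]
    [SecondCountableTopology X] [MeasurableSpace X] [BorelSpace X] (m : ℕ → Measure X)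
    [∀ n, IsFiniteMeasure (m n)]
    (h : ∀ δ : ℝ, 0 < δ → ∀ ε : ℝ≥0∞, 0 < ε → ∃ F : Set X, F.Finite ∧
      ∀ᶠ n in atTop, m n (⋃ c ∈ F, Metric.closedBall c δ)ᶜ ≤ ε) :
    IsTightMeasureSet (range m) := by
  -- "Eventually" improves to "for all `n`": each of the finitely many exceptional measures is tight
  -- by itself, and the balls needed for it are added to the family.
  have h' : ∀ δ : ℝ, 0 < δ → ∀ ε : ℝ≥0∞, 0 < ε → ∃ F : Set X, F.Finite ∧
      ∀ n, m n (⋃ c ∈ F, Metric.closedBall c δ)ᶜ ≤ ε := fun δ hδ ε hε => by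
    obtain ⟨F, hF, hev⟩ := h δ hδ ε hε
    obtain ⟨n₀, hn₀⟩ := eventually_atTop.1 hev
    have hs : ∀ n, ∃ G : Set X, G.Finite ∧ m n (⋃ c ∈ G, Metric.closedBall c δ)ᶜ ≤ ε := fun n => by
      obtain ⟨K, hK, hm⟩ := isTightMeasureSet_iff_exists_isCompact_measure_compl_le.1
        (isTightMeasureSet_singleton (μ := m n)) ε hε
      obtain ⟨G, -, hG, hKG⟩ := hK.finite_cover_balls hδ
      refine ⟨G, hG, (measure_mono (compl_subset_compl.2 (hKG.trans ?_))).trans (hm _ rfl)⟩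
      exact iUnion₂_mono fun c _ => Metric.ball_subset_closedBall
    choose G hG hGm using hs
    refine ⟨F ∪ ⋃ n ∈ Iio n₀, G n, hF.union ((finite_Iio n₀).biUnion fun n _ => hG n), fun n => ?_⟩
    rcases le_or_gt n₀ n with hn | hn
    · refine (measure_mono (compl_subset_compl.2 ?_)).trans (hn₀ n hn)
      exact biUnion_subset_biUnion_left subset_union_left
    · refine (measure_mono (compl_subset_compl.2 ?_)).trans (hGm n)
      refine biUnion_subset_biUnion_left (Subset.trans ?_ subset_union_right)
      exact subset_biUnion_of_mem (u := G) (mem_Iio.2 hn)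
  rw [isTightMeasureSet_iff_exists_isCompact_measure_compl_le]
  intro ε hε
  obtain ⟨ε', hε'0, hε'⟩ := ENNReal.exists_pos_sum_of_countable' hε.ne' ℕ
  choose F hF hFm using fun j : ℕ => h' (1 / ((j : ℝ) + 1)) (by positivity) (ε' j) (hε'0 j)
  -- An intersection of finite unions of closed balls of radii `1/(j+1)` is closed and totally
  -- bounded, hence compact; the masses lost at the stages are summable.
  refine ⟨⋂ j, ⋃ c ∈ F j, Metric.closedBall c (1 / ((j : ℝ) + 1)), ?_, ?_⟩
  · refine isCompact_iff_totallyBounded_isComplete.2 ⟨?_, IsClosed.isComplete ?_⟩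
    · refine Metric.totallyBounded_iff.2 fun δ hδ => ?_
      obtain ⟨j, hj⟩ := exists_nat_one_div_lt hδ
      refine ⟨F j, hF j, (iInter_subset _ j).trans ?_⟩
      exact iUnion₂_mono fun c _ => Metric.closedBall_subset_ball hj
    · exact isClosed_iInter fun j => (hF j).isClosed_biUnion fun c _ => Metric.isClosed_closedBall
  · rintro _ ⟨n, rfl⟩
    rw [compl_iInter]
    exact (measure_iUnion_le _).trans ((ENNReal.tsum_le_tsum fun j => hFm j n).trans hε'.le)

variable {d N : ℕ} {p : ℝ≥0∞} [Fact (1 ≤ p)] [Fact (p ≠ ∞)] {D : Set (Space d)}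

/-- A bounded sequence of random elements of `L^p(D;U)` whose mean moduli of continuity vanish
uniformly is tight. -/
lemma isTightMeasureSet_range_of_modulus (hD : IsOpen D) (hb : Bornology.IsBounded D) {R : ℝ}
    (m : ℕ → Measure (LpState N p D)) [∀ n, IsProbabilityMeasure (m n)]
    (hm : ∀ n, ∀ᵐ u ∂(m n), ‖u‖ ≤ R)
    (hmod : ∀ ε : ℝ≥0∞, 0 < ε → ∀ᶠ r in 𝓝[>] (0 : ℝ), ∀ᶠ n in atTop,
      ∫⁻ u, modulus r u ∂(m n) ≤ ε) :
    IsTightMeasureSet (range m) := by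
  have := isFiniteMeasure_restrict_of_isBounded hb
  have hp := one_le_toReal p
  refine isTightMeasureSet_range_of_finite_cover m fun δ hδ ε hε => ?_
  obtain ⟨K, hK⟩ := Mesh.exists_enorm_sub_projection_rpow_le d N p
  -- Half of `δ` is spent on the projection error, half on covering the compact set of projections.
  set c := ENNReal.ofReal (δ / 2) ^ p.toReal with hc
  have hc0 : c ≠ 0 := (ENNReal.rpow_pos (by simpa using hδ) ENNReal.ofReal_ne_top).ne'
  have hct : c ≠ ∞ := ENNReal.rpow_ne_top_of_nonneg (by linarith) ENNReal.ofReal_ne_top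
  obtain ⟨η, hη, hηε⟩ : ∃ η : ℝ≥0∞, 0 < η ∧ K * (η + η + η) / c ≤ ε := by
    have hlim : Tendsto (fun η : ℝ≥0∞ => K * (η + η + η) / c) (𝓝[>] 0) (𝓝 0) := by
      have h1 : Tendsto (fun η : ℝ≥0∞ => K * (η + η + η) / c) (𝓝 0) (𝓝 (K * (0 + 0 + 0) / c)) :=
        ENNReal.Tendsto.div_const (ENNReal.Tendsto.const_mul
          ((tendsto_id.add tendsto_id).add tendsto_id) (Or.inr ENNReal.coe_ne_top)) (Or.inr hc0)
      simpa using h1.mono_left nhdsWithin_le_nhds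
    obtain ⟨η, h1, h2⟩ := ((ENNReal.tendsto_nhds_zero.1 hlim ε hε).and
      self_mem_nhdsWithin).exists
    exact ⟨η, h2, h1⟩
  -- The radius `r` used near the boundary is fixed first; the auxiliary grid `M j`, unrelated to
  -- the numerical meshes, is then refined until its boundary mass at that `r` is negligible.
  obtain ⟨r, hr1, hr⟩ := ((hmod η hη).and self_mem_nhdsWithin).exists
  let M : ℕ → Mesh d := fun j => ⟨0, 1 / ((j : ℝ) + 1), by positivity⟩
  have hMsize : Tendsto (fun j => (M j).size) atTop (𝓝 0) := tendsto_one_div_add_atTop_nhds_zero_nat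
  have hb1 : ∀ᶠ j in atTop, (M j).boundaryMass D r * ENNReal.ofReal R ^ p.toReal ≤ η := by
    have h1 : Tendsto (fun j => (M j).boundaryMass D r * ENNReal.ofReal R ^ p.toReal) atTop (𝓝 0) := by
      simpa using ENNReal.Tendsto.mul_const (Mesh.tendsto_boundaryMass hD hb hr hMsize)
        (Or.inr (ENNReal.rpow_ne_top_of_nonneg (by linarith) ENNReal.ofReal_ne_top))
    exact ENNReal.tendsto_nhds_zero.1 h1 η hη
  have hb2 : ∀ᶠ j in atTop, ∀ᶠ n in atTop,
      ∫⁻ u, modulus (((d : ℝ) + 1) * (M j).size) u ∂(m n) ≤ η := by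
    have h1 : Tendsto (fun j => ((d : ℝ) + 1) * (M j).size) atTop (𝓝[>] 0) := by
      refine tendsto_nhdsWithin_iff.2 ⟨by simpa using hMsize.const_mul ((d : ℝ) + 1), ?_⟩
      refine Eventually.of_forall fun j => ?_
      have := (M j).size_pos
      simp only [mem_Ioi]
      positivity
    exact h1.eventually (hmod η hη)
  obtain ⟨j, hj1, hj2⟩ := (hb1.and hb2).exists
  obtain ⟨S, hS, hSmem⟩ := Mesh.exists_isCompact_projection_mem (N := N) (p := p) hD.measurableSet
    hb (M j) R
  obtain ⟨F, -, hF, hSF⟩ := hS.finite_cover_balls (half_pos hδ)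
  refine ⟨F, hF, ?_⟩
  filter_upwards [hr1, hj2] with n hn1 hn2
  let B : LpState N p D → ℝ≥0∞ := fun u => K * (modulus (((d : ℝ) + 1) * (M j).size) u + modulus r u
    + (M j).boundaryMass D r * ENNReal.ofReal R ^ p.toReal)
  have hB : Measurable B := (((measurable_modulus hD.measurableSet _).add
    (measurable_modulus hD.measurableSet _)).add_const _).const_mul _
  have hBint : ∫⁻ u, B u ∂(m n) ≤ K * (η + η + η) := by
    have h1 := measurable_modulus (N := N) (p := p) hD.measurableSet (((d : ℝ) + 1) * (M j).size)
    have h2 := measurable_modulus (N := N) (p := p) hD.measurableSet r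
    simp only [B]
    rw [lintegral_const_mul _ ((h1.fun_add h2).add_const _), lintegral_add_left (h1.fun_add h2),
      lintegral_add_left h1]
    gcongr
    simpa using hj1
  -- If `B u < c`, then `u` is within `δ/2` of its projection, which is within `δ/2` of a point of
  -- `F`. The mass of `c ≤ B u` is estimated by Markov's inequality.
  calc m n (⋃ c ∈ F, Metric.closedBall c δ)ᶜ ≤ m n {u | c ≤ B u} := by
        refine measure_mono_ae ?_
        filter_upwards [hm n] with u hu hmem
        by_contra hlt
        have hlt' : B u < c := not_le.1 hlt
        have h1 : ‖u - (M j).toLpState p hb ((M j).cellAverage u)‖ₑ ^ p.toReal < c := by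
          refine ((hK D hD hb (M j) r hr u).trans ?_).trans_lt hlt'
          simp only [B]
          gcongr
          rw [← ofReal_norm]
          exact ENNReal.ofReal_le_ofReal hu
        have h2 : ‖u - (M j).toLpState p hb ((M j).cellAverage u)‖ < δ / 2 := by
          have := (ENNReal.rpow_lt_rpow_iff (by linarith : 0 < p.toReal)).1 h1
          rw [← ofReal_norm, ENNReal.ofReal_lt_ofReal_iff (half_pos hδ)] at this
          exact this
        obtain ⟨c, hcF, hcb⟩ := mem_iUnion₂.1 (hSF (hSmem u hu))
        refine hmem (mem_iUnion₂.2 ⟨c, hcF, ?_⟩)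
        rw [Metric.mem_closedBall]
        rw [Metric.mem_ball] at hcb
        rw [← dist_eq_norm] at h2
        linarith [dist_triangle u ((M j).toLpState p hb ((M j).cellAverage u)) c]
    _ ≤ (∫⁻ u, B u ∂(m n)) / c := meas_ge_le_lintegral_div hB.aemeasurable hc0 hct
    _ ≤ K * (η + η + η) / c := by gcongr
    _ ≤ ε := hηε

end Compactness

/-! ### Prokhorov's theorem and disintegration in time -/

section Disintegration

variable {X : Type*} [NormedAddCommGroup X] [CompleteSpace X] [SecondCountableTopology X]
  [MeasurableSpace X] [BorelSpace X]

/-- A sequence of kernels with tight mean has a subsequence that converges weakly to a kernel. -/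
lemma exists_subseq_tendsto_integral_compProd {π : Measure ℝ} [IsProbabilityMeasure π]
    (κ : ℕ → Kernel ℝ X) [∀ n, IsMarkovKernel (κ n)]
    (ht : IsTightMeasureSet (range fun n => (π ⊗ₘ κ n).snd)) {R : ℝ}
    (hR : ∀ n, ∀ᵐ t ∂π, ∀ᵐ u ∂(κ n t), ‖u‖ ≤ R) :
    ∃ φ : ℕ → ℕ, StrictMono φ ∧ ∃ κ' : Kernel ℝ X, IsMarkovKernel κ' ∧
      (∀ᵐ t ∂π, ∀ᵐ u ∂(κ' t), ‖u‖ ≤ R) ∧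
      ∀ F : ℝ × X →ᵇ ℝ, Tendsto (fun n => ∫ q, F q ∂(π ⊗ₘ κ (φ n))) atTop
        (𝓝 (∫ q, F q ∂(π ⊗ₘ κ'))) := by
  let Q : ℕ → ProbabilityMeasure (ℝ × X) := fun n => ⟨π ⊗ₘ κ n, inferInstance⟩
  have htight : IsTightMeasureSet {((μ : ProbabilityMeasure (ℝ × X)) : Measure (ℝ × X)) |
      μ ∈ range Q} := by
    refine IsTightMeasureSet.prodMk ?_ ?_
    · refine (isTightMeasureSet_singleton (μ := π)).subset ?_
      rintro _ ⟨_, ⟨_, ⟨n, rfl⟩, rfl⟩, rfl⟩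
      exact Measure.fst_compProd π (κ n)
    · refine ht.subset ?_
      rintro _ ⟨_, ⟨_, ⟨n, rfl⟩, rfl⟩, rfl⟩
      exact ⟨n, rfl⟩
  obtain ⟨P, -, φ, hφ, hlim⟩ := (isCompact_closure_of_isTightMeasureSet htight).tendsto_subseq
    fun n => subset_closure (mem_range_self n)
  -- The time marginal passes to the weak limit, so the limit is `π` composed with its conditional
  -- kernel.
  have hfst : (P : Measure (ℝ × X)).fst = π := by
    have h1 : Tendsto (fun n => (Q (φ n)).map (f := Prod.fst) measurable_fst.aemeasurable) atTop
        (𝓝 (P.map measurable_fst.aemeasurable)) :=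
      ProbabilityMeasure.tendsto_map_of_tendsto_of_continuous _ _ hlim continuous_fst
    have h2 : ∀ n, (Q (φ n)).map (f := Prod.fst) measurable_fst.aemeasurable
        = (⟨π, inferInstance⟩ : ProbabilityMeasure ℝ) := fun n => by
      refine Subtype.ext ?_
      exact Measure.fst_compProd π (κ (φ n))
    have h3 : P.map (f := Prod.fst) measurable_fst.aemeasurable
        = (⟨π, inferInstance⟩ : ProbabilityMeasure ℝ) :=
      tendsto_nhds_unique (h1.congr h2) tendsto_const_nhds
    exact congrArg Subtype.val h3
  have hdis : π ⊗ₘ (P : Measure (ℝ × X)).condKernel = P := by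
    conv_lhs => rw [← hfst]
    exact Measure.disintegrate _ _
  have hconv : ∀ F : ℝ × X →ᵇ ℝ, Tendsto (fun n => ∫ q, F q ∂(π ⊗ₘ κ (φ n))) atTop
      (𝓝 (∫ q, F q ∂(P : Measure (ℝ × X)))) :=
    ProbabilityMeasure.tendsto_iff_forall_integral_tendsto.1 hlim
  refine ⟨φ, hφ, (P : Measure (ℝ × X)).condKernel, inferInstance, ?_, ?_⟩
  -- A bounded continuous function vanishing exactly on the ball of radius `R`. Its integrals are
  -- zero along the sequence, hence in the limit, so the limit kernel charges only that ball.
  · let F : ℝ × X →ᵇ ℝ := BoundedContinuousFunction.ofNormedAddCommGroup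
      (fun q => min 1 (max 0 (‖q.2‖ - R))) (by fun_prop) 1 fun q => by
        rw [Real.norm_of_nonneg (le_min zero_le_one (le_max_left _ _))]
        exact min_le_left _ _
    have hF : ∀ q, F q = min 1 (max 0 (‖q.2‖ - R)) := fun q => rfl
    have hz : ∀ n, ∫ q, F q ∂(π ⊗ₘ κ (φ n)) = 0 := fun n => by
      refine integral_eq_zero_of_ae ?_
      refine Measure.ae_compProd_of_ae_ae ?_ ?_
      · exact F.continuous.measurable (measurableSet_singleton 0)
      · filter_upwards [hR (φ n)] with t ht
        filter_upwards [ht] with u hu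
        simp only [Pi.zero_apply, hF]
        rw [max_eq_left (by linarith), min_eq_right zero_le_one]
    have hP : ∫ q, F q ∂(P : Measure (ℝ × X)) = 0 := by
      have := hconv F
      simp_rw [hz] at this
      exact (tendsto_nhds_unique tendsto_const_nhds this).symm
    rw [← hdis, integral_eq_zero_iff_of_nonneg
      (fun q => by rw [hF]; exact le_min zero_le_one (le_max_left _ _)) (F.integrable _)] at hP
    filter_upwards [Measure.ae_ae_of_ae_compProd hP] with t ht
    filter_upwards [ht] with u hu
    simp only [Pi.zero_apply, hF] at hu
    by_contra hlt
    have : 0 < min 1 (max 0 (‖u‖ - R)) :=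
      lt_min zero_lt_one (lt_max_of_lt_right (by linarith [not_le.1 hlt]))
    exact this.ne' hu
  · rw [hdis]
    exact hconv

end Disintegration

/-! ### Integrals of products over `D^k` -/

section ProductIntegrals

variable {X : Type*} [MeasurableSpace X] (μ : Measure X) [SigmaFinite μ]

lemma lintegral_pi_prod_eq_pow {F : X → ℝ≥0∞} (hF : Measurable F) (n : ℕ) :
    ∫⁻ x, ∏ j, F (x j) ∂(Measure.pi fun _ : Fin n => μ) = (∫⁻ x, F x ∂μ) ^ n := by
  induction n with
  | zero => simp
  | succ n ih =>
    have h := (measurePreserving_piFinSuccAbove (fun _ : Fin (n + 1) => μ) 0).lintegral_comp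
      (f := fun q : X × (Fin n → X) => F q.1 * ∏ j, F (q.2 j)) (by fun_prop)
    simp only [Fin.prod_univ_succ]
    refine Eq.trans ?_ (h.trans ?_)
    · rfl
    · rw [lintegral_prod_mul (f := F) (g := fun x : Fin n → X => ∏ j, F (x j)) hF.aemeasurable
        (by fun_prop : Measurable fun x : Fin n → X => ∏ j, F (x j)).aemeasurable, ih, pow_succ']

lemma measurePreserving_pi_split {m n k : ℕ} (e : Fin m ⊕ Fin n ≃ Fin k) :
    MeasurePreserving (fun x : Fin k → X => ((fun j => x (e (Sum.inl j))), fun j => x (e (Sum.inr j))))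
      (Measure.pi fun _ => μ) ((Measure.pi fun _ => μ).prod (Measure.pi fun _ => μ)) :=
  (measurePreserving_sumPiEquivProdPi (X := fun _ : Fin m ⊕ Fin n => X) fun _ => μ).comp
    (measurePreserving_piCongrLeft (fun _ : Fin k => μ) e).symm

/-- The coordinates split into those in `A` and those in its complement, the latter enumerated
increasingly as in the growth bound for observables. Each term of that bound factorises. -/
lemma lintegral_pi_mul_prod {k : ℕ} (A : Finset (Fin k)) {φ : (Fin (Aᶜ).card → X) → ℝ≥0∞}
    (hφ : AEMeasurable φ (Measure.pi fun _ => μ)) {F : X → ℝ≥0∞} (hF : Measurable F) :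
    ∫⁻ x, φ (fun j => x ((Aᶜ).orderEmbOfFin rfl j)) * ∏ i ∈ A, F (x i) ∂(Measure.pi fun _ => μ)
      = (∫⁻ x, φ x ∂(Measure.pi fun _ => μ)) * (∫⁻ x, F x ∂μ) ^ A.card := by
  have hA : ((Aᶜ)ᶜ).card = A.card := by rw [compl_compl]
  set e := finSumEquivOfFinset (s := Aᶜ) rfl hA
  have hprod : ∀ x : Fin k → X, ∏ i ∈ A, F (x i) = ∏ j, F (x (e (Sum.inr j))) := fun x => by
    have h1 : Finset.map ((Aᶜ)ᶜ.orderEmbOfFin hA).toEmbedding Finset.univ = A := by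
      rw [Finset.map_orderEmbOfFin_univ, compl_compl]
    conv_lhs => rw [← h1]
    rw [Finset.prod_map]
    rfl
  have hP : Measurable fun x : Fin A.card → X => ∏ j, F (x j) := by fun_prop
  have hmp := measurePreserving_pi_split μ e
  have h := lintegral_map' (μ := Measure.pi fun _ : Fin k => μ)
    (f := fun q : (Fin (Aᶜ).card → X) × (Fin A.card → X) => φ q.1 * ∏ j, F (q.2 j))
    (by rw [hmp.map_eq]; exact hφ.comp_fst.mul (hP.comp measurable_snd).aemeasurable)
    hmp.measurable.aemeasurable
  rw [hmp.map_eq] at h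
  simp_rw [hprod]
  refine Eq.trans ?_ (h.symm.trans ?_)
  · rfl
  · rw [lintegral_prod_mul hφ hP.aemeasurable, lintegral_pi_prod_eq_pow μ hF]

lemma aemeasurable_mul_removeNth {k : ℕ} (i : Fin (k + 1)) {F : X → ℝ≥0∞} (hF : Measurable F)
    {H : (Fin k → X) → ℝ≥0∞} (hH : AEMeasurable H (Measure.pi fun _ => μ)) :
    AEMeasurable (fun x => F (x i) * H fun j => x (i.succAbove j)) (Measure.pi fun _ => μ) := by
  have hq : AEMeasurable (fun q : X × (Fin k → X) => F q.1 * H q.2)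
      (μ.prod (Measure.pi fun _ => μ)) :=
    (hF.comp measurable_fst).aemeasurable.mul hH.comp_snd
  exact hq.comp_quasiMeasurePreserving
    (measurePreserving_piFinSuccAbove (fun _ : Fin (k + 1) => μ) i).quasiMeasurePreserving

lemma lintegral_mul_removeNth {k : ℕ} (i : Fin (k + 1)) {F : X → ℝ≥0∞} (hF : Measurable F)
    {H : (Fin k → X) → ℝ≥0∞} (hH : AEMeasurable H (Measure.pi fun _ => μ)) :
    ∫⁻ x, F (x i) * H (fun j => x (i.succAbove j)) ∂(Measure.pi fun _ => μ)
      = (∫⁻ x, F x ∂μ) * ∫⁻ y, H y ∂(Measure.pi fun _ => μ) := by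
  have hmp := measurePreserving_piFinSuccAbove (fun _ : Fin (k + 1) => μ) i
  rw [← lintegral_prod_mul hF.aemeasurable hH]
  have h := lintegral_map' (μ := Measure.pi fun _ : Fin (k + 1) => μ)
    (f := fun q : X × (Fin k → X) => F q.1 * H q.2)
    (by
      rw [hmp.map_eq]
      exact (hF.comp measurable_fst).aemeasurable.mul hH.comp_snd) hmp.measurable.aemeasurable
  rw [hmp.map_eq] at h
  exact h.symm

end ProductIntegrals

/-! ### Observables along functions in a ball of `L^p` -/

section Observables

variable {d N : ℕ} {p : ℝ≥0∞} {D : Set (Space d)} {T : ℝ}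

instance (T : ℝ) : IsFiniteMeasure (timeVol T) := by unfold timeVol; infer_instance

/-- An observable agrees almost everywhere with a jointly measurable function. -/
lemma IsObservable.exists_measurable {k : ℕ} {g : ℝ → (Fin k → Space d) → (Fin k → State N) → ℝ}
    (hg : IsObservable p D T k g) :
    ∃ g' : ℝ × (Fin k → Space d) → (Fin k → State N) → ℝ,
      Measurable (fun q : (ℝ × (Fin k → Space d)) × (Fin k → State N) => g' q.1 q.2) ∧
      ∀ᵐ q ∂((timeVol T).prod (volPow D k)), g q.1 q.2 = g' q := by
  classical
  set μ := (timeVol T).prod (volPow D k)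
  -- Measurability in `(t, x)` holds for each `ξ` only up to a null set that depends on `ξ`. A
  -- countable dense set of `ξ` leaves one measurable null set `Z`; off `Z`, continuity recovers the
  -- remaining values as limits.
  let ξ : ℕ → Fin k → State N := TopologicalSpace.denseSeq _
  have hae : ∀ᵐ q ∂μ, Continuous (g q.1 q.2) ∧ ∀ j, g q.1 q.2 (ξ j) = (hg.meas (ξ j)).mk _ q :=
    hg.cont.and (ae_all_iff.2 fun j => (hg.meas (ξ j)).ae_eq_mk)
  set Z := toMeasurable μ {q | ¬(Continuous (g q.1 q.2) ∧
    ∀ j, g q.1 q.2 (ξ j) = (hg.meas (ξ j)).mk _ q)}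
  have hZ : MeasurableSet Z := measurableSet_toMeasurable _ _
  have hZ0 : μ Z = 0 := by rw [measure_toMeasurable]; exact hae
  have hnot : ∀ q ∉ Z, Continuous (g q.1 q.2) ∧
      ∀ j, g q.1 q.2 (ξ j) = (hg.meas (ξ j)).mk _ q := fun q hq => by
    by_contra h
    exact hq (subset_toMeasurable _ _ h)
  let g' : ℝ × (Fin k → Space d) → (Fin k → State N) → ℝ := fun q η =>
    if q ∈ Z then 0 else g q.1 q.2 η
  have hcont : ∀ q, Continuous (g' q) := fun q => by
    by_cases hq : q ∈ Z
    · simp only [g', hq, if_true]; exact continuous_const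
    · simp only [g', hq, if_false]; exact (hnot q hq).1
  have hmeas_seq : ∀ j, Measurable fun q => g' q (ξ j) := fun j => by
    have : (fun q => g' q (ξ j)) = Zᶜ.indicator ((hg.meas (ξ j)).mk _) := by
      funext q
      by_cases hq : q ∈ Z
      · simp [g', hq]
      · simp only [g', hq, if_false]
        rw [indicator_of_mem (by exact hq)]
        exact (hnot q hq).2 j
    rw [this]
    exact (hg.meas (ξ j)).measurable_mk.indicator hZ.compl
  have hmeas : ∀ η, Measurable fun q => g' q η := fun η => by
    obtain ⟨s, hs, hlim⟩ := mem_closure_iff_seq_limit.1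
      ((TopologicalSpace.denseRange_denseSeq (Fin k → State N)) η)
    choose j hj using hs
    refine measurable_of_tendsto_metrizable (fun n => hmeas_seq (j n)) (tendsto_pi_nhds.2 fun q => ?_)
    have h1 : ∀ n, g' q (ξ (j n)) = g' q (s n) := fun n => by rw [← hj n]
    simp_rw [h1]
    exact ((hcont q).tendsto η).comp hlim
  refine ⟨g', ?_, ?_⟩
  · have h := measurable_uncurry_of_continuous_of_measurable
      (u := fun (η : Fin k → State N) (q : ℝ × (Fin k → Space d)) => g' q η) hcont hmeas
    have h2 := h.comp (measurable_swap (α := ℝ × (Fin k → Space d)) (β := Fin k → State N))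
    exact h2
  · have hZae : ∀ᵐ q ∂μ, q ∉ Z := measure_eq_zero_iff_ae_notMem.1 hZ0
    filter_upwards [hZae] with q hq
    funext η
    simp [g', hq]

/-- Hölder's inequality for the weight in the local Lipschitz condition. -/
lemma lintegral_enorm_sub_mul_max_le {p : ℝ} (hp : 1 ≤ p) {f₁ f₂ : Space d → State N}
    (h₁ : Measurable f₁) (h₂ : Measurable f₂) {R : ℝ≥0}
    (hR₁ : ∫⁻ x in D, ‖f₁ x‖ₑ ^ p ≤ R) (hR₂ : ∫⁻ x in D, ‖f₂ x‖ₑ ^ p ≤ R) :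
    ∫⁻ x in D, ‖f₁ x - f₂ x‖ₑ * max ‖f₂ x‖ₑ ‖f₁ x‖ₑ ^ (p - 1)
      ≤ (∫⁻ x in D, ‖f₁ x - f₂ x‖ₑ ^ p) ^ (1 / p) * ((R : ℝ≥0∞) + R) ^ (1 - 1 / p) := by
  -- For `p = 1` the weight is identically 1 and the conjugate exponent infinite, so Hölder's
  -- inequality is not invoked.
  rcases eq_or_lt_of_le hp with rfl | hp1
  · simp
  · have hpq : p.HolderConjugate (p / (p - 1)) := Real.HolderConjugate.conjExponent hp1
    refine (ENNReal.lintegral_mul_le_Lp_mul_Lq _ hpq (h₁.sub h₂).enorm.aemeasurable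
      ((h₂.enorm.max h₁.enorm).pow_const (p - 1)).aemeasurable).trans ?_
    have hexp : 1 / (p / (p - 1)) = 1 - 1 / p := by
      field_simp
    rw [hexp]
    have hnn : 0 ≤ 1 - 1 / p := by
      rw [sub_nonneg, div_le_one (by linarith)]
      exact hp
    refine mul_le_mul' le_rfl (ENNReal.rpow_le_rpow ?_ hnn)
    calc ∫⁻ x in D, (max ‖f₂ x‖ₑ ‖f₁ x‖ₑ ^ (p - 1)) ^ (p / (p - 1))
        ≤ ∫⁻ x in D, (‖f₂ x‖ₑ ^ p + ‖f₁ x‖ₑ ^ p) := by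
          refine lintegral_mono fun x => ?_
          simp only
          rw [← ENNReal.rpow_mul, mul_div_cancel₀ _ (by linarith : p - 1 ≠ 0)]
          rcases le_total ‖f₂ x‖ₑ ‖f₁ x‖ₑ with h | h
          · rw [max_eq_right h]; exact le_add_self
          · rw [max_eq_left h]; exact le_self_add
      _ = (∫⁻ x in D, ‖f₂ x‖ₑ ^ p) + ∫⁻ x in D, ‖f₁ x‖ₑ ^ p :=
          lintegral_add_left (h₂.enorm.pow_const _) _
      _ ≤ _ := add_le_add hR₂ hR₁

variable [IsFiniteMeasure ((volume : Measure (Space d)).restrict D)]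

lemma ae_aemeasurable_of_prod {k : ℕ} {f : ℝ × (Fin k → Space d) → ℝ≥0∞}
    (hf : AEMeasurable f ((timeVol T).prod (volPow D k))) :
    ∀ᵐ t ∂(timeVol T), AEMeasurable (fun x => f (t, x)) (volPow D k) := by
  filter_upwards [Measure.ae_ae_of_ae_prod hf.ae_eq_mk] with t ht
  exact ⟨fun x => hf.mk f (t, x), hf.measurable_mk.comp measurable_prodMk_left, ht⟩

/-- Observables are integrable along functions in bounded subsets of `L^p`. -/
lemma IsObservable.exists_lintegral_le {k : ℕ}
    {g : ℝ → (Fin k → Space d) → (Fin k → State N) → ℝ} (hg : IsObservable p D T k g)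
    (R : ℝ≥0) :
    ∃ B : ℝ≥0, ∀ᵐ t ∂(timeVol T), ∀ f : Space d → State N, Measurable f →
      ∫⁻ x in D, ‖f x‖ₑ ^ p.toReal ≤ R → ∫⁻ x, ‖g t x fun i => f (x i)‖ₑ ∂(volPow D k) ≤ B := by
  obtain ⟨φ, hφm, hφb, hbound⟩ := hg.bound
  choose C hC using hφb
  refine ⟨∑ A : Finset (Fin k), C (Aᶜ).card * R ^ A.card, ?_⟩
  have hm : ∀ᵐ t ∂(timeVol T), ∀ j, AEMeasurable (fun x => (φ j t x : ℝ≥0∞)) (volPow D j) :=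
    ae_all_iff.2 fun j => ae_aemeasurable_of_prod
      (f := fun q : ℝ × (Fin j → Space d) => (φ j q.1 q.2 : ℝ≥0∞)) (hφm j).coe_nnreal_ennreal
  filter_upwards [hm, ae_all_iff.2 hC, Measure.ae_ae_of_ae_prod hbound] with t htm htC htb f hf hR
  have hFm : Measurable fun x => ‖f x‖ₑ ^ p.toReal := hf.enorm.pow_const _
  calc ∫⁻ x, ‖g t x fun i => f (x i)‖ₑ ∂(volPow D k)
      ≤ ∫⁻ x, ∑ A : Finset (Fin k), (φ (Aᶜ).card t (fun j => x ((Aᶜ).orderEmbOfFin rfl j)) : ℝ≥0∞)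
          * ∏ i ∈ A, ‖f (x i)‖ₑ ^ p.toReal ∂(volPow D k) := by
        refine lintegral_mono_ae ?_
        filter_upwards [htb] with x hx
        have h := hx fun i => f (x i)
        rw [← Real.norm_eq_abs] at h
        rw [← ofReal_norm]
        refine (ENNReal.ofReal_le_ofReal h).trans (le_of_eq ?_)
        rw [ENNReal.ofReal_sum_of_nonneg fun A _ => by positivity]
        refine Finset.sum_congr rfl fun A _ => ?_
        rw [ENNReal.ofReal_mul (by positivity), ENNReal.ofReal_coe_nnreal,
          ENNReal.ofReal_prod_of_nonneg fun i _ => by positivity]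
        congr 1
        refine Finset.prod_congr rfl fun i _ => ?_
        rw [← ofReal_norm, ENNReal.ofReal_rpow_of_nonneg (norm_nonneg _) ENNReal.toReal_nonneg]
    _ = ∑ A : Finset (Fin k), ∫⁻ x, (φ (Aᶜ).card t (fun j => x ((Aᶜ).orderEmbOfFin rfl j)) : ℝ≥0∞)
          * ∏ i ∈ A, ‖f (x i)‖ₑ ^ p.toReal ∂(volPow D k) := by
        refine lintegral_finsetSum' _ fun A _ => ?_
        refine AEMeasurable.mul ?_ ?_
        · have hqmp : Measure.QuasiMeasurePreserving (fun x : Fin k → Space d =>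
              fun j : Fin (Aᶜ).card => x ((Aᶜ).orderEmbOfFin rfl j)) (volPow D k)
              (volPow D (Aᶜ).card) :=
            (Measure.quasiMeasurePreserving_fst (μ := volPow D (Aᶜ).card)
              (ν := volPow D (((Aᶜ)ᶜ).card))).comp
              (measurePreserving_pi_split ((volume : Measure (Space d)).restrict D)
                (finSumEquivOfFinset (s := Aᶜ) rfl rfl)).quasiMeasurePreserving
          exact (htm _).comp_quasiMeasurePreserving hqmp
        · exact (by fun_prop : Measurable fun x : Fin k → Space d =>
            ∏ i ∈ A, ‖f (x i)‖ₑ ^ p.toReal).aemeasurable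
    _ = ∑ A : Finset (Fin k), (∫⁻ x, (φ (Aᶜ).card t x : ℝ≥0∞) ∂(volPow D (Aᶜ).card))
          * (∫⁻ x in D, ‖f x‖ₑ ^ p.toReal) ^ A.card :=
        Finset.sum_congr rfl fun A _ =>
          lintegral_pi_mul_prod ((volume : Measure (Space d)).restrict D) A (htm _) hFm
    _ ≤ ∑ A : Finset (Fin k), (C (Aᶜ).card : ℝ≥0∞) * (R : ℝ≥0∞) ^ A.card := by
        gcongr with A
        exact htC _
    _ = _ := by push_cast; rfl

/-- Observables in the locally Lipschitz class are Lipschitz along bounded subsets of `L^p`. -/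
lemma IsLipObservable.exists_lintegral_sub_le [Fact (1 ≤ p)] [Fact (p ≠ ∞)] {k : ℕ}
    {g : ℝ → (Fin (k + 1) → Space d) → (Fin (k + 1) → State N) → ℝ}
    (hg : IsLipObservable p D T k g) (R : ℝ≥0) :
    ∃ L : ℝ≥0, ∀ᵐ t ∂(timeVol T), ∀ f₁ f₂ : Space d → State N, Measurable f₁ → Measurable f₂ →
      ∫⁻ x in D, ‖f₁ x‖ₑ ^ p.toReal ≤ R → ∫⁻ x in D, ‖f₂ x‖ₑ ^ p.toReal ≤ R →
      ∫⁻ x, ‖g t x (fun i => f₁ (x i)) - g t x fun i => f₂ (x i)‖ₑ ∂(volPow D (k + 1))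
        ≤ L * (∫⁻ x in D, ‖f₁ x - f₂ x‖ₑ ^ p.toReal) ^ (1 / p.toReal) := by
  obtain ⟨-, ψ, h, -, ⟨Cψ, hψ⟩, hobs, hnn, hlip⟩ := hg
  have hp := one_le_toReal p
  obtain ⟨B, hB⟩ := hobs.exists_lintegral_le R
  obtain ⟨h', hh'm, hh'⟩ := hobs.exists_measurable
  have hexp : 0 ≤ 1 - 1 / p.toReal := by
    rw [sub_nonneg, div_le_one (by linarith)]
    exact hp
  have hKt : ((R : ℝ≥0∞) + R) ^ (1 - 1 / p.toReal) ≠ ∞ :=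
    ENNReal.rpow_ne_top_of_nonneg hexp (by simp)
  -- One term for each of the `k + 1` coordinates; in each, Hölder gives the `L^p` distance times a
  -- power of `R + R`, and `h` along `f₂` contributes at most `B` after integrating over the other
  -- points.
  refine ⟨Cψ * ((k + 1) * (((R : ℝ≥0∞) + R) ^ (1 - 1 / p.toReal)).toNNReal * B), ?_⟩
  filter_upwards [hψ, hB, Measure.ae_ae_of_ae_prod hh', Measure.ae_ae_of_ae_prod hlip]
    with t htψ htB hth' htl f₁ f₂ h₁ h₂ hR₁ hR₂
  set F : Space d → ℝ≥0∞ := fun x =>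
    ‖f₁ x - f₂ x‖ₑ * max ‖f₂ x‖ₑ ‖f₁ x‖ₑ ^ (p.toReal - 1)
  set H : (Fin k → Space d) → ℝ≥0∞ := fun y => ‖h t y fun j => f₂ (y j)‖ₑ
  have hF : Measurable F :=
    (h₁.sub h₂).enorm.mul ((h₂.enorm.max h₁.enorm).pow_const _)
  have hH : AEMeasurable H (volPow D k) := by
    refine ⟨fun y => ‖h' (t, y) fun j => f₂ (y j)‖ₑ, ?_, ?_⟩
    · have h3 : Measurable fun y : Fin k → Space d => ((t, y), fun j => f₂ (y j)) := by fun_prop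
      have h4 := (hh'm.comp h3).enorm
      exact h4
    · filter_upwards [hth'] with y hy
      simp only [H]
      rw [hy]
  calc ∫⁻ x, ‖g t x (fun i => f₁ (x i)) - g t x fun i => f₂ (x i)‖ₑ ∂(volPow D (k + 1))
      ≤ ∫⁻ x, Cψ * ∑ i, F (x i) * H (fun j => x (i.succAbove j)) ∂(volPow D (k + 1)) := by
        refine lintegral_mono_ae ?_
        filter_upwards [htl] with x hx
        have h5 := hx (fun i => f₁ (x i)) fun i => f₂ (x i)
        rw [← Real.norm_eq_abs] at h5
        rw [← ofReal_norm]
        refine (ENNReal.ofReal_le_ofReal h5).trans ?_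
        have h6 : ∀ i : Fin (k + 1), 0 ≤ ‖f₁ (x i) - f₂ (x i)‖
            * max ‖f₂ (x i)‖ ‖f₁ (x i)‖ ^ (p.toReal - 1)
            * h t (fun j => x (i.succAbove j)) (fun j => f₂ (x (i.succAbove j))) := fun i =>
          mul_nonneg (by positivity) (hnn _ _ _)
        rw [ENNReal.ofReal_mul (by positivity), ENNReal.ofReal_coe_nnreal,
          ENNReal.ofReal_sum_of_nonneg fun i _ => h6 i]
        gcongr with i
        rw [ENNReal.ofReal_mul (by positivity), ENNReal.ofReal_mul (by positivity),
          ← ENNReal.ofReal_rpow_of_nonneg (by positivity) (by linarith), ENNReal.ofReal_max,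
          ofReal_norm, ofReal_norm, ofReal_norm, ← Real.enorm_of_nonneg (hnn _ _ _)]
    _ = Cψ * ∑ i : Fin (k + 1), ∫⁻ x, F (x i) * H (fun j => x (i.succAbove j))
          ∂(volPow D (k + 1)) := by
        have hae : ∀ i : Fin (k + 1), AEMeasurable (fun x => F (x i) *
            H fun j => x (i.succAbove j)) (volPow D (k + 1)) := fun i =>
          aemeasurable_mul_removeNth ((volume : Measure (Space d)).restrict D) i hF hH
        rw [lintegral_const_mul' _ _ ENNReal.coe_ne_top, lintegral_finsetSum' _ fun i _ => hae i]
    _ = Cψ * ((k + 1) * ((∫⁻ x in D, F x) * ∫⁻ y, H y ∂(volPow D k))) := by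
        have hint : ∀ i : Fin (k + 1), ∫⁻ x, F (x i) * H (fun j => x (i.succAbove j))
            ∂(volPow D (k + 1)) = (∫⁻ x in D, F x) * ∫⁻ y, H y ∂(volPow D k) := fun i =>
          lintegral_mul_removeNth ((volume : Measure (Space d)).restrict D) i hF hH
        simp [hint]
    _ ≤ Cψ * ((k + 1) * (((∫⁻ x in D, ‖f₁ x - f₂ x‖ₑ ^ p.toReal) ^ (1 / p.toReal)
          * ((R : ℝ≥0∞) + R) ^ (1 - 1 / p.toReal)) * B)) := by
        gcongr
        · exact lintegral_enorm_sub_mul_max_le hp h₁ h₂ hR₁ hR₂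
        · exact htB f₂ h₂ hR₂
    _ = _ := by
        push_cast
        rw [ENNReal.coe_toNNReal hKt]
        ring

end Observables

/-! ### From weak convergence to convergence of pairings in `L¹` -/

section WeakToStrong

/-- Continuous functions with values in `[0,1]` and sum at most one, equal to one on the union of
the balls of radius `δ`, subordinate to the balls of radius `2δ`. -/
lemma exists_subordinate_functions {X : Type*} [PseudoMetricSpace X] {δ : ℝ} (hδ : 0 < δ) (C : Finset X) :
    ∃ χ : X → X →ᵇ ℝ, (∀ c u, 0 ≤ χ c u) ∧ (∀ u, ∑ c ∈ C, χ c u ≤ 1) ∧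
      (∀ u, (∃ c ∈ C, dist u c < δ) → ∑ c ∈ C, χ c u = 1) ∧
      ∀ c u, χ c u ≠ 0 → dist u c ≤ 2 * δ := by
  let w : X → X → ℝ := fun c u => max 0 (2 * δ - dist u c)
  let S : X → ℝ := fun u => ∑ c ∈ C, w c u
  -- Dividing by `max δ S` avoids zeros. Near a centre `S ≥ δ` and the weights sum to one; elsewhere
  -- the sum is at most one.
  let den : X → ℝ := fun u => max δ (S u)
  have hw0 : ∀ c u, 0 ≤ w c u := fun c u => le_max_left _ _
  have hwc : ∀ c, Continuous (w c) := fun c => by fun_prop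
  have hSc : Continuous S := continuous_finsetSum _ fun c _ => hwc c
  have hden : ∀ u, 0 < den u := fun u => lt_max_of_lt_left hδ
  have hdc : Continuous den := continuous_const.max hSc
  have hq : ∀ c, Continuous fun u => w c u / den u := fun c =>
    (hwc c).div hdc fun u => (hden u).ne'
  have hwb : ∀ c u, w c u ≤ 2 * δ := fun c u =>
    max_le (by positivity) (by linarith [dist_nonneg (x := u) (y := c)])
  have hbd : ∀ c u, ‖w c u / den u‖ ≤ 2 := fun c u => by
    rw [Real.norm_of_nonneg (div_nonneg (hw0 c u) (hden u).le), div_le_iff₀ (hden u)]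
    have := hwb c u
    have h2 : δ ≤ den u := le_max_left _ _
    linarith
  have hsum : ∀ u, ∑ c ∈ C, w c u / den u = S u / den u := fun u => by rw [Finset.sum_div]
  refine ⟨fun c => BoundedContinuousFunction.ofNormedAddCommGroup _ (hq c) 2 (hbd c),
    fun c u => div_nonneg (hw0 c u) (hden u).le, fun u => ?_, fun u hu => ?_, fun c u hne => ?_⟩
  · refine (hsum u).trans_le ?_
    rw [div_le_one (hden u)]
    exact le_max_right _ _
  · refine (hsum u).trans ?_
    obtain ⟨c, hc, hcu⟩ := hu
    have h1 : δ ≤ S u :=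
      le_trans (le_max_of_le_right (by linarith) : δ ≤ w c u)
        (Finset.single_le_sum (f := fun c => w c u) (fun c _ => hw0 c u) hc)
    have h2 : den u = S u := max_eq_right h1
    rw [h2, div_self (by linarith)]
  · by_contra hlt
    push Not at hlt
    refine hne ?_
    have : w c u = 0 := max_eq_left (by linarith)
    change w c u / den u = 0
    rw [this, zero_div]

variable {Ω Y : Type*} [MeasurableSpace Ω] [MeasurableSpace Y] {V : Measure Y}

lemma ae_lintegral_enorm_lt_top [SFinite V] {m : Measure Ω} [SFinite m] {G : Y → Ω → ℝ}
    (hG : Measurable (Function.uncurry G)) (h : ∫⁻ y, ∫⁻ w, ‖G y w‖ₑ ∂m ∂V ≠ ∞) :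
    ∀ᵐ y ∂V, Integrable (G y) m := by
  have hm : Measurable fun y => ∫⁻ w, ‖G y w‖ₑ ∂m := hG.enorm.lintegral_prod_right
  filter_upwards [ae_lt_top hm h] with y hy
  exact ⟨(hG.comp measurable_prodMk_left).aestronglyMeasurable, hy⟩

/-- An `ε/3` argument: `H` must approximate `G` equally well under all the measures, so that only
the pairings of `H` have to converge. -/
lemma tendsto_lintegral_enorm_integral_sub_of_approx [SFinite V] {m : ℕ → Measure Ω}
    {m' : Measure Ω} [∀ n, SFinite (m n)] [SFinite m'] {G : Y → Ω → ℝ}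
    (hG : Measurable (Function.uncurry G)) (hGn : ∀ n, ∫⁻ y, ∫⁻ w, ‖G y w‖ₑ ∂(m n) ∂V ≠ ∞)
    (hG' : ∫⁻ y, ∫⁻ w, ‖G y w‖ₑ ∂m' ∂V ≠ ∞)
    (happ : ∀ ε : ℝ≥0, 0 < ε → ∃ H : Y → Ω → ℝ, Measurable (Function.uncurry H) ∧
      (∀ n, ∫⁻ y, ∫⁻ w, ‖G y w - H y w‖ₑ ∂(m n) ∂V ≤ ε) ∧
      ∫⁻ y, ∫⁻ w, ‖G y w - H y w‖ₑ ∂m' ∂V ≤ ε ∧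
      Tendsto (fun n => ∫⁻ y, ‖∫ w, H y w ∂(m n) - ∫ w, H y w ∂m'‖ₑ ∂V) atTop (𝓝 0)) :
    Tendsto (fun n => ∫⁻ y, ‖∫ w, G y w ∂(m n) - ∫ w, G y w ∂m'‖ₑ ∂V) atTop (𝓝 0) := by
  rw [ENNReal.tendsto_nhds_zero]
  intro ε hε
  obtain ⟨δ, hδ, hδε⟩ := ENNReal.lt_iff_exists_nnreal_btwn.1 hε
  have hδ0 : 0 < δ := by exact_mod_cast hδ
  obtain ⟨H, hH, hn, h', hlim⟩ := happ (δ / 3) (by positivity)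
  have hGH : Measurable (Function.uncurry fun y w => G y w - H y w) := hG.sub hH
  filter_upwards [ENNReal.tendsto_nhds_zero.1 hlim (δ / 3 : ℝ≥0)
    (by exact_mod_cast (by positivity : 0 < δ / 3))] with n hlimn
  have hsplit : ∀ᵐ y ∂V, ‖∫ w, G y w ∂(m n) - ∫ w, G y w ∂m'‖ₑ
      ≤ (∫⁻ w, ‖G y w - H y w‖ₑ ∂(m n) + ∫⁻ w, ‖G y w - H y w‖ₑ ∂m')
        + ‖∫ w, H y w ∂(m n) - ∫ w, H y w ∂m'‖ₑ := by
    filter_upwards [ae_lintegral_enorm_lt_top hG (hGn n), ae_lintegral_enorm_lt_top hG hG',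
      ae_lintegral_enorm_lt_top hGH ((hn n).trans_lt ENNReal.coe_lt_top).ne,
      ae_lintegral_enorm_lt_top hGH (h'.trans_lt ENNReal.coe_lt_top).ne] with y h1 h2 h3 h4
    have h5 : Integrable (H y) (m n) := by
      have := h1.sub h3; simpa [Pi.sub_def] using this
    have h6 : Integrable (H y) m' := by
      have := h2.sub h4; simpa [Pi.sub_def] using this
    have e : ∫ w, G y w ∂(m n) - ∫ w, G y w ∂m'
        = (∫ w, (G y w - H y w) ∂(m n) - ∫ w, (G y w - H y w) ∂m')
          + (∫ w, H y w ∂(m n) - ∫ w, H y w ∂m') := by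
      rw [integral_sub h1 h5, integral_sub h2 h6]; ring
    rw [e]
    refine (enorm_add_le _ _).trans (add_le_add ((enorm_sub_le).trans ?_) le_rfl)
    exact add_le_add (enorm_integral_le_lintegral_enorm _) (enorm_integral_le_lintegral_enorm _)
  have hm1 : Measurable fun y => ∫⁻ w, ‖G y w - H y w‖ₑ ∂(m n) := hGH.enorm.lintegral_prod_right
  have hm2 : Measurable fun y => ∫⁻ w, ‖G y w - H y w‖ₑ ∂m' := hGH.enorm.lintegral_prod_right
  refine (lintegral_mono_ae hsplit).trans ?_
  rw [lintegral_add_left (hm1.fun_add hm2), lintegral_add_left hm1]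
  refine (add_le_add (add_le_add (hn n) h') hlimn).trans (le_trans ?_ hδε.le)
  rw [← ENNReal.coe_add, ← ENNReal.coe_add]
  exact_mod_cast (by ring_nf; exact le_rfl : δ / 3 + δ / 3 + δ / 3 ≤ δ)

variable {X : Type*} [MeasurableSpace X] {τ : Measure ℝ}

lemma ae_fst_of_ae {m : Measure (ℝ × X)} (hm : m.fst = τ) {P : ℝ → Prop} (h : ∀ᵐ t ∂τ, P t) :
    ∀ᵐ q ∂m, P q.1 := by
  rw [← hm] at h
  exact ae_of_ae_map measurable_fst.aemeasurable h

lemma lintegral_fst_eq {m : Measure (ℝ × X)} (hm : m.fst = τ) {F : ℝ → ℝ≥0∞} (hF : Measurable F) :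
    ∫⁻ q, F q.1 ∂m = ∫⁻ t, F t ∂τ := by
  rw [← hm, Measure.fst, lintegral_map hF measurable_fst]

lemma measurable_uncurry_swap {G : ℝ × Y → X → ℝ}
    (hG : Measurable fun z : (ℝ × Y) × X => G z.1 z.2) :
    Measurable (Function.uncurry fun (y : Y) (q : ℝ × X) => G (q.1, y) q.2) := by
  have h1 : Measurable fun z : Y × (ℝ × X) => (((z.2.1, z.1), z.2.2) : (ℝ × Y) × X) := by
    fun_prop
  have h2 := hG.comp h1
  exact h2

lemma lintegral_lintegral_enorm_ne_top [SFinite V] {m : Measure (ℝ × X)} [IsFiniteMeasure τ] (hm : m.fst = τ)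
    {S : Set X} (hS : ∀ᵐ q ∂m, q.2 ∈ S) {G : ℝ × Y → X → ℝ}
    (hG : Measurable fun z : (ℝ × Y) × X => G z.1 z.2) {B : ℝ≥0}
    (hB : ∀ᵐ t ∂τ, ∀ u ∈ S, ∫⁻ y, ‖G (t, y) u‖ₑ ∂V ≤ B) :
    ∫⁻ y, ∫⁻ q, ‖G (q.1, y) q.2‖ₑ ∂m ∂V ≠ ∞ := by
  have hfin : IsFiniteMeasure m :=
    ⟨by rw [← Measure.fst_univ, hm]; exact measure_lt_top _ _⟩
  rw [lintegral_lintegral_swap (measurable_uncurry_swap hG).enorm.aemeasurable]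
  refine ((lintegral_mono_ae (g := fun _ => (B : ℝ≥0∞)) ?_).trans_lt ?_).ne
  · filter_upwards [ae_fst_of_ae hm hB, hS] with q h1 h2
    exact h1 _ h2
  · rw [lintegral_const]
    exact ENNReal.mul_lt_top ENNReal.coe_lt_top (measure_lt_top _ _)

variable [PseudoMetricSpace X] [BorelSpace X]

lemma integrable_mul_fst {m : Measure (ℝ × X)} (hm : m.fst = τ) (χ : X →ᵇ ℝ) {β : ℝ → ℝ}
    (hβ : Integrable β τ) : Integrable (fun q : ℝ × X => χ q.2 * β q.1) m := by
  rw [← hm] at hβ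
  have h1 : Integrable (fun q : ℝ × X => β q.1) m := hβ.comp_measurable measurable_fst
  have h2 : Measurable fun q : ℝ × X => χ q.2 := χ.continuous.measurable.comp measurable_snd
  exact h1.bdd_mul (c := ‖χ‖) h2.aestronglyMeasurable
    (Eventually.of_forall fun q => χ.norm_coe_le_norm q.2)

variable [IsFiniteMeasure τ]

/-- Weak convergence of measures with a fixed first marginal allows for test functions that are
merely integrable in the first variable. -/
lemma tendsto_integral_mul_fst {m : ℕ → Measure (ℝ × X)} {m' : Measure (ℝ × X)}
    (hm : ∀ n, (m n).fst = τ) (hm' : m'.fst = τ)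
    (hconv : ∀ F : ℝ × X →ᵇ ℝ, Tendsto (fun n => ∫ q, F q ∂(m n)) atTop (𝓝 (∫ q, F q ∂m')))
    (χ : X →ᵇ ℝ) {β : ℝ → ℝ} (hβ : Integrable β τ) :
    Tendsto (fun n => ∫ q, χ q.2 * β q.1 ∂(m n)) atTop (𝓝 (∫ q, χ q.2 * β q.1 ∂m')) := by
  rw [Metric.tendsto_atTop]
  intro ε hε
  obtain ⟨b, hb, hbi⟩ := hβ.exists_boundedContinuous_integral_sub_le
    (ε := ε / (4 * (‖χ‖ + 1))) (by positivity)
  -- Replacing `β` by a bounded continuous `b` costs an error measured in `L¹(τ)`, hence the same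
  -- for every measure with first marginal `τ`.
  have herr : ∀ {k : Measure (ℝ × X)}, k.fst = τ →
      |∫ q, χ q.2 * β q.1 ∂k - ∫ q, χ q.2 * b q.1 ∂k| ≤ ε / 4 := fun {k} hk => by
    rw [← integral_sub (integrable_mul_fst hk χ hβ) (integrable_mul_fst hk χ hbi)]
    have hd : Integrable (fun t => ‖β t - b t‖) τ := (hβ.sub hbi).norm
    have hd' := hd
    rw [← hk] at hd'
    have hd2 : Integrable (fun q : ℝ × X => ‖χ‖ * ‖β q.1 - b q.1‖) k :=
      (hd'.comp_measurable measurable_fst).const_mul _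
    calc |∫ q, (χ q.2 * β q.1 - χ q.2 * b q.1) ∂k|
        ≤ ∫ q, ‖χ‖ * ‖β q.1 - b q.1‖ ∂k := by
          rw [← Real.norm_eq_abs]
          refine norm_integral_le_of_norm_le hd2 (Eventually.of_forall fun q => ?_)
          rw [← mul_sub, norm_mul]
          exact mul_le_mul_of_nonneg_right (χ.norm_coe_le_norm _) (norm_nonneg _)
      _ = ‖χ‖ * ∫ t, ‖β t - b t‖ ∂τ := by
          rw [integral_const_mul]
          congr 1
          rw [← hk, Measure.fst]
          rw [← hk, Measure.fst] at hd
          exact (integral_map measurable_fst.aemeasurable hd.aestronglyMeasurable).symm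
      _ ≤ ‖χ‖ * (ε / (4 * (‖χ‖ + 1))) := by gcongr
      _ ≤ ε / 4 := by
          rw [mul_div_assoc', div_le_div_iff₀ (by positivity) (by positivity)]
          nlinarith [norm_nonneg χ]
  let F : ℝ × X →ᵇ ℝ :=
    (χ.compContinuous ⟨Prod.snd, continuous_snd⟩) * (b.compContinuous ⟨Prod.fst, continuous_fst⟩)
  obtain ⟨n₀, hn₀⟩ := Metric.tendsto_atTop.1 (hconv F) (ε / 4) (by positivity)
  refine ⟨n₀, fun n hn => ?_⟩
  have h1 := hn₀ n hn
  have hF : ∀ k : Measure (ℝ × X), ∫ q, F q ∂k = ∫ q, χ q.2 * b q.1 ∂k := fun k => rfl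
  rw [hF, hF, Real.dist_eq] at h1
  rw [Real.dist_eq]
  have h2 := abs_le.1 (herr (hm n))
  have h3 := abs_le.1 (herr hm')
  have h4 := abs_lt.1 h1
  rw [abs_lt]
  constructor <;> linarith

variable [SecondCountableTopology X]

/-- For almost every `y` the differences tend to zero. Since the first marginal is fixed, they are
dominated by twice `‖χ‖` times the time integral of `|b|`, independently of `n`. -/
lemma tendsto_lintegral_enorm_integral_mul_sub [SFinite V] {m : ℕ → Measure (ℝ × X)}
    {m' : Measure (ℝ × X)} (hm : ∀ n, (m n).fst = τ) (hm' : m'.fst = τ)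
    (hconv : ∀ F : ℝ × X →ᵇ ℝ, Tendsto (fun n => ∫ q, F q ∂(m n)) atTop (𝓝 (∫ q, F q ∂m')))
    (χ : X →ᵇ ℝ) {b : ℝ × Y → ℝ} (hb : Measurable b)
    (hbi : ∫⁻ y, ∫⁻ t, ‖b (t, y)‖ₑ ∂τ ∂V ≠ ∞) :
    Tendsto (fun n => ∫⁻ y, ‖∫ q, χ q.2 * b (q.1, y) ∂(m n) - ∫ q, χ q.2 * b (q.1, y) ∂m'‖ₑ ∂V)
      atTop (𝓝 0) := by
  have hfin : ∀ n, IsFiniteMeasure (m n) := fun n =>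
    ⟨by rw [← Measure.fst_univ, hm]; exact measure_lt_top _ _⟩
  have hfin' : IsFiniteMeasure m' := ⟨by rw [← Measure.fst_univ, hm']; exact measure_lt_top _ _⟩
  have hbs : Measurable (Function.uncurry fun y t => b (t, y)) := hb.comp measurable_swap
  have hmeas : ∀ k : Measure (ℝ × X), IsFiniteMeasure k →
      Measurable fun y => ∫ q, χ q.2 * b (q.1, y) ∂k := fun k _ => by
    have h1 : Measurable fun z : Y × (ℝ × X) => χ z.2.2 * b (z.2.1, z.1) :=
      (χ.continuous.measurable.comp (by fun_prop)).mul (hb.comp (by fun_prop))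
    exact h1.stronglyMeasurable.integral_prod_right'.measurable
  have hbound : ∀ k : Measure (ℝ × X), k.fst = τ → ∀ y,
      ‖∫ q, χ q.2 * b (q.1, y) ∂k‖ₑ ≤ ‖χ‖ₑ * ∫⁻ t, ‖b (t, y)‖ₑ ∂τ := fun k hk y => by
    have hby : Measurable fun t => ‖b (t, y)‖ₑ := (hb.comp (by fun_prop)).enorm
    refine (enorm_integral_le_lintegral_enorm _).trans ?_
    calc ∫⁻ q, ‖χ q.2 * b (q.1, y)‖ₑ ∂k ≤ ∫⁻ q, ‖χ‖ₑ * ‖b (q.1, y)‖ₑ ∂k := by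
          refine lintegral_mono fun q => ?_
          rw [enorm_mul]
          refine mul_le_mul' ?_ le_rfl
          rw [← ofReal_norm, ← ofReal_norm]
          exact ENNReal.ofReal_le_ofReal (χ.norm_coe_le_norm _)
      _ = _ := by
          rw [lintegral_const_mul' _ _ enorm_ne_top, lintegral_fst_eq hk hby]
  have h := tendsto_lintegral_of_dominated_convergence (μ := V)
    (F := fun n y => ‖∫ q, χ q.2 * b (q.1, y) ∂(m n) - ∫ q, χ q.2 * b (q.1, y) ∂m'‖ₑ)
    (f := fun _ => 0) (fun y => 2 * (‖χ‖ₑ * ∫⁻ t, ‖b (t, y)‖ₑ ∂τ))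
    (fun n => ((hmeas _ (hfin n)).sub (hmeas _ hfin')).enorm)
    (fun n => Eventually.of_forall fun y => by
      refine enorm_sub_le.trans ?_
      simp only
      rw [two_mul]
      exact add_le_add (hbound _ (hm n) y) (hbound _ hm' y))
    (by
      rw [lintegral_const_mul' _ _ (by simp), lintegral_const_mul' _ _ enorm_ne_top]
      exact ENNReal.mul_ne_top (by simp) (ENNReal.mul_ne_top enorm_ne_top hbi)) ?_
  · simpa using h
  · filter_upwards [ae_lintegral_enorm_lt_top hbs hbi] with y hy
    have h1 := tendsto_integral_mul_fst hm hm' hconv χ hy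
    have h2 := (h1.sub_const (∫ q, χ q.2 * b (q.1, y) ∂m')).enorm
    simpa using h2

/-- Weak convergence of measures with a fixed first marginal and tight second marginals improves
to strong convergence of the pairings with maps that are Lipschitz with values in `L¹`. -/
lemma tendsto_lintegral_enorm_integral_sub [SFinite V] {m : ℕ → Measure (ℝ × X)}
    {m' : Measure (ℝ × X)} (hm : ∀ n, (m n).fst = τ) (hm' : m'.fst = τ)
    (hconv : ∀ F : ℝ × X →ᵇ ℝ, Tendsto (fun n => ∫ q, F q ∂(m n)) atTop (𝓝 (∫ q, F q ∂m')))
    (ht : IsTightMeasureSet (range fun n => (m n).snd)) (ht' : IsTightMeasureSet {m'.snd})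
    {S : Set X} (hSc : IsClosed S) (hS : ∀ n, ∀ᵐ q ∂(m n), q.2 ∈ S) (hS' : ∀ᵐ q ∂m', q.2 ∈ S)
    {G : ℝ × Y → X → ℝ} (hG : Measurable fun z : (ℝ × Y) × X => G z.1 z.2) {B L : ℝ≥0}
    (hB : ∀ᵐ t ∂τ, ∀ u ∈ S, ∫⁻ y, ‖G (t, y) u‖ₑ ∂V ≤ B)
    (hL : ∀ᵐ t ∂τ, ∀ u ∈ S, ∀ v ∈ S, ∫⁻ y, ‖G (t, y) u - G (t, y) v‖ₑ ∂V ≤ L * edist u v) :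
    Tendsto (fun n => ∫⁻ y, ‖∫ q, G (q.1, y) q.2 ∂(m n) - ∫ q, G (q.1, y) q.2 ∂m'‖ₑ ∂V)
      atTop (𝓝 0) := by
  have hfin : ∀ n, IsFiniteMeasure (m n) := fun n =>
    ⟨by rw [← Measure.fst_univ, hm]; exact measure_lt_top _ _⟩
  have hfin' : IsFiniteMeasure m' := ⟨by rw [← Measure.fst_univ, hm']; exact measure_lt_top _ _⟩
  have hGy := measurable_uncurry_swap hG
  have hswap : ∀ (k : Measure (ℝ × X)), IsFiniteMeasure k → ∀ F : Y → ℝ × X → ℝ,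
      Measurable (Function.uncurry F) → ∫⁻ y, ∫⁻ q, ‖F y q‖ₑ ∂k ∂V = ∫⁻ q, ∫⁻ y, ‖F y q‖ₑ ∂V ∂k :=
    fun k _ F hF => lintegral_lintegral_swap hF.enorm.aemeasurable
  refine tendsto_lintegral_enorm_integral_sub_of_approx hGy
    (fun n => lintegral_lintegral_enorm_ne_top (hm n) (hS n) hG hB)
    (lintegral_lintegral_enorm_ne_top hm' hS' hG hB) fun ε hε => ?_
  set A : ℝ≥0 := (τ univ).toNNReal with hA
  have hAτ : (A : ℝ≥0∞) = τ univ := ENNReal.coe_toNNReal (measure_ne_top _ _)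
  -- Total error of the approximation: Lipschitz constant times distance `2δ` over the whole mass
  -- `A`, plus the crude bound `2B` on the remaining mass `δ` outside the compact set.
  obtain ⟨δ, hδ, hδε⟩ : ∃ δ : ℝ≥0, 0 < δ ∧ L * (2 * δ) * A + 2 * B * δ ≤ ε := by
    refine ⟨ε / (2 * L * A + 2 * B + 1), by positivity, ?_⟩
    have h1 : L * (2 * (ε / (2 * L * A + 2 * B + 1))) * A + 2 * B * (ε / (2 * L * A + 2 * B + 1))
        = ε * ((2 * L * A + 2 * B) / (2 * L * A + 2 * B + 1)) := by ring
    rw [h1]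
    refine mul_le_of_le_one_right zero_le ?_
    rw [div_le_one (by positivity)]
    exact le_self_add
  obtain ⟨K, hK, hKm⟩ := isTightMeasureSet_iff_exists_isCompact_measure_compl_le.1 (ht.union ht')
    δ (by exact_mod_cast hδ)
  have hδ' : (0 : ℝ) < δ := by exact_mod_cast hδ
  -- The centres are taken in `K ∩ S`, as the bounds on `G` are available only on `S`.
  obtain ⟨C, hCsub, hCfin, hcover⟩ := (hK.inter_right hSc).finite_cover_balls hδ'
  lift C to Finset X using hCfin
  obtain ⟨χ, hχ0, hχ1, hχeq, hχd⟩ := exists_subordinate_functions hδ' C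
  have hCS : ∀ c ∈ C, c ∈ S := fun c hc => (hCsub hc).2
  have hχm : ∀ c, Measurable (χ c) := fun c => (χ c).continuous.measurable
  have hGc : ∀ c, Measurable fun z : ℝ × Y => G z c := fun c =>
    hG.comp (measurable_prodMk_right (y := c))
  -- Interpolation in `u` between the centres: a finite sum of products of a function of `u` and a
  -- function of `(t, y)`.
  let H : Y → ℝ × X → ℝ := fun y q => ∑ c ∈ C, χ c q.2 * G (q.1, y) c
  have hH : Measurable (Function.uncurry H) := by
    refine Finset.measurable_sum _ fun c _ => ?_
    have h1 : Measurable fun z : Y × (ℝ × X) => (z.2.1, z.1) := by fun_prop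
    have h2 := (hGc c).comp h1
    have h3 : Measurable fun z : Y × (ℝ × X) => χ c z.2.2 :=
      (hχm c).comp (measurable_snd.comp measurable_snd)
    exact h3.mul h2
  have hcsum : ∀ u, ∑ c ∈ C, ‖χ c u‖ₑ ≤ 1 := fun u => by
    simp_rw [Real.enorm_of_nonneg (hχ0 _ u)]
    rw [← ENNReal.ofReal_sum_of_nonneg fun c _ => hχ0 c u]
    exact ENNReal.ofReal_le_one.2 (hχ1 u)
  have hmulm : ∀ (t : ℝ) (a : ℝ) (c : X), Measurable fun y => ‖a‖ₑ * ‖G (t, y) c‖ₑ := fun t a c =>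
    ((hGc c).comp measurable_prodMk_left).enorm.const_mul _
  have hgood : ∀ᵐ t ∂τ, ∀ u ∈ S, ∫⁻ y, ‖G (t, y) u - H y (t, u)‖ₑ ∂V ≤ 2 * B := by
    filter_upwards [hB] with t htB u hu
    calc ∫⁻ y, ‖G (t, y) u - H y (t, u)‖ₑ ∂V
        ≤ ∫⁻ y, (‖G (t, y) u‖ₑ + ∑ c ∈ C, ‖χ c u‖ₑ * ‖G (t, y) c‖ₑ) ∂V := by
          refine lintegral_mono fun y => enorm_sub_le.trans (add_le_add le_rfl ?_)
          refine (enorm_sum_le _ _).trans (le_of_eq ?_)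
          simp_rw [enorm_mul]
      _ = ∫⁻ y, ‖G (t, y) u‖ₑ ∂V + ∑ c ∈ C, ‖χ c u‖ₑ * ∫⁻ y, ‖G (t, y) c‖ₑ ∂V := by
          have hGu : Measurable fun y => ‖G (t, y) u‖ₑ :=
            ((hGc u).comp measurable_prodMk_left).enorm
          rw [lintegral_add_left hGu,
            lintegral_finsetSum _ fun c _ => hmulm t _ c]
          congr 1
          refine Finset.sum_congr rfl fun c _ => ?_
          exact lintegral_const_mul' _ _ enorm_ne_top
      _ ≤ B + ∑ c ∈ C, ‖χ c u‖ₑ * B := by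
          refine add_le_add (htB u hu) (Finset.sum_le_sum fun c hc => ?_)
          exact mul_le_mul' le_rfl (htB c (hCS c hc))
      _ ≤ 2 * B := by
          rw [← Finset.sum_mul, two_mul]
          exact add_le_add le_rfl (mul_le_of_le_one_left zero_le (hcsum u))
  have hbest : ∀ᵐ t ∂τ, ∀ u ∈ S, u ∈ K → ∫⁻ y, ‖G (t, y) u - H y (t, u)‖ₑ ∂V ≤ L * (2 * δ) := by
    filter_upwards [hL] with t htL u hu huK
    obtain ⟨c₀, hc₀, hc₀d⟩ := mem_iUnion₂.1 (hcover ⟨huK, hu⟩)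
    have hone := hχeq u ⟨c₀, hc₀, hc₀d⟩
    have hGd : ∀ c, Measurable fun y => ‖χ c u‖ₑ * ‖G (t, y) u - G (t, y) c‖ₑ := fun c =>
      (((hGc u).comp measurable_prodMk_left).sub
        ((hGc c).comp measurable_prodMk_left)).enorm.const_mul _
    calc ∫⁻ y, ‖G (t, y) u - H y (t, u)‖ₑ ∂V
        ≤ ∫⁻ y, ∑ c ∈ C, ‖χ c u‖ₑ * ‖G (t, y) u - G (t, y) c‖ₑ ∂V := by
          refine lintegral_mono fun y => ?_
          have h1 : G (t, y) u - H y (t, u) = ∑ c ∈ C, χ c u * (G (t, y) u - G (t, y) c) := by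
            simp_rw [mul_sub, Finset.sum_sub_distrib, ← Finset.sum_mul, hone, one_mul, H]
          rw [h1]
          refine (enorm_sum_le _ _).trans (le_of_eq ?_)
          simp_rw [enorm_mul]
      _ = ∑ c ∈ C, ‖χ c u‖ₑ * ∫⁻ y, ‖G (t, y) u - G (t, y) c‖ₑ ∂V := by
          rw [lintegral_finsetSum _ fun c _ => hGd c]
          refine Finset.sum_congr rfl fun c _ => ?_
          exact lintegral_const_mul' _ _ enorm_ne_top
      _ ≤ ∑ c ∈ C, ‖χ c u‖ₑ * (L * (2 * δ)) := by
          refine Finset.sum_le_sum fun c hc => ?_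
          by_cases hz : χ c u = 0
          · simp [hz]
          · refine mul_le_mul' le_rfl ((htL u hu c (hCS c hc)).trans (mul_le_mul' le_rfl ?_))
            rw [edist_dist]
            refine (ENNReal.ofReal_le_ofReal (hχd c u hz)).trans (le_of_eq ?_)
            rw [ENNReal.ofReal_mul zero_le_two, ENNReal.ofReal_coe_nnreal]
            simp
      _ ≤ L * (2 * δ) := by
          rw [← Finset.sum_mul]
          exact mul_le_of_le_one_left zero_le (hcsum u)
  have herr : ∀ k : Measure (ℝ × X), k.fst = τ → IsFiniteMeasure k → (∀ᵐ q ∂k, q.2 ∈ S) →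
      k.snd Kᶜ ≤ δ → ∫⁻ y, ∫⁻ q, ‖G (q.1, y) q.2 - H y q‖ₑ ∂k ∂V ≤ ε := fun k hk hkf hkS hkK => by
    rw [hswap k hkf (fun y q => G (q.1, y) q.2 - H y q) (hGy.sub hH)]
    -- In a pseudometric space a compact set need not be closed, so a measurable hull of the
    -- complement is used.
    have hKc : MeasurableSet (toMeasurable k (Prod.snd ⁻¹' Kᶜ)) := measurableSet_toMeasurable _ _
    calc ∫⁻ q, ∫⁻ y, ‖G (q.1, y) q.2 - H y q‖ₑ ∂V ∂k
        ≤ ∫⁻ q, (L * (2 * δ) + (toMeasurable k (Prod.snd ⁻¹' Kᶜ)).indicator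
            (fun _ => 2 * (B : ℝ≥0∞)) q) ∂k := by
          refine lintegral_mono_ae ?_
          filter_upwards [ae_fst_of_ae hk hgood, ae_fst_of_ae hk hbest, hkS] with q h1 h2 h3
          by_cases hq : q.2 ∈ K
          · exact (h2 _ h3 hq).trans le_self_add
          · rw [indicator_of_mem (subset_toMeasurable _ _ hq)]
            exact (h1 _ h3).trans le_add_self
      _ = L * (2 * δ) * τ univ + 2 * B * k (Prod.snd ⁻¹' Kᶜ) := by
          rw [lintegral_add_left measurable_const, lintegral_indicator hKc, lintegral_const,
            setLIntegral_const, measure_toMeasurable, ← hk, Measure.fst_univ]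
      _ ≤ L * (2 * δ) * A + 2 * B * δ := by
          rw [hAτ]
          gcongr
          refine (Measure.le_map_apply measurable_snd.aemeasurable _).trans hkK
      _ ≤ ε := by exact_mod_cast hδε
  refine ⟨H, hH, fun n => herr _ (hm n) (hfin n) (hS n) (hKm _ (Or.inl ⟨n, rfl⟩)),
    herr _ hm' hfin' hS' (hKm _ (Or.inr rfl)), ?_⟩
  have hbi : ∀ c ∈ C, ∫⁻ y, ∫⁻ t, ‖G (t, y) c‖ₑ ∂τ ∂V ≠ ∞ := fun c hc => by
    have h1 : Measurable (Function.uncurry fun (y : Y) (t : ℝ) => ‖G (t, y) c‖ₑ) :=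
      ((hGc c).comp measurable_swap).enorm
    rw [lintegral_lintegral_swap h1.aemeasurable]
    refine ((lintegral_mono_ae (g := fun _ => (B : ℝ≥0∞)) ?_).trans_lt ?_).ne
    · filter_upwards [hB] with t ht using ht c (hCS c hc)
    · rw [lintegral_const]
      exact ENNReal.mul_lt_top ENNReal.coe_lt_top (measure_lt_top _ _)
  have hlim : Tendsto (fun n => ∑ c ∈ C, ∫⁻ y, ‖∫ q, χ c q.2 * G (q.1, y) c ∂(m n)
      - ∫ q, χ c q.2 * G (q.1, y) c ∂m'‖ₑ ∂V) atTop (𝓝 0) := by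
    have := tendsto_finsetSum C fun c hc => tendsto_lintegral_enorm_integral_mul_sub hm hm' hconv
      (χ c) (hGc c) (hbi c hc)
    simpa using this
  have hmeas : ∀ k : Measure (ℝ × X), IsFiniteMeasure k → ∀ c,
      Measurable fun y => ∫ q, χ c q.2 * G (q.1, y) c ∂k := fun k _ c => by
    have h1 : Measurable fun z : Y × (ℝ × X) => (z.2.1, z.1) := by fun_prop
    have h2 := (hGc c).comp h1
    have h3 : Measurable fun z : Y × (ℝ × X) => χ c z.2.2 :=
      (hχm c).comp (measurable_snd.comp measurable_snd)
    exact (h3.mul h2).stronglyMeasurable.integral_prod_right'.measurable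
  refine tendsto_of_tendsto_of_tendsto_of_le_of_le tendsto_const_nhds hlim (fun _ => zero_le)
    fun n => ?_
  have hinty : ∀ c ∈ C, ∀ᵐ y ∂V, Integrable (fun t => G (t, y) c) τ := fun c hc =>
    ae_lintegral_enorm_lt_top (G := fun (y : Y) t => G (t, y) c) ((hGc c).comp measurable_swap)
      (hbi c hc)
  have hme : ∀ c, Measurable fun y => ‖∫ q, χ c q.2 * G (q.1, y) c ∂(m n)
      - ∫ q, χ c q.2 * G (q.1, y) c ∂m'‖ₑ := fun c =>
    ((hmeas _ (hfin n) c).sub (hmeas _ hfin' c)).enorm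
  simp only
  rw [← lintegral_finsetSum _ fun c _ => hme c]
  refine lintegral_mono_ae ?_
  filter_upwards [(Finset.eventually_all C).2 hinty] with y hy
  simp only [H]
  rw [integral_finsetSum _ fun c hc => integrable_mul_fst (hm n) (χ c) (hy c hc),
    integral_finsetSum _ fun c hc => integrable_mul_fst hm' (χ c) (hy c hc),
    ← Finset.sum_sub_distrib]
  exact enorm_sum_le _ _

end WeakToStrong

lemma integrable_integral_of_compProd {α β : Type*} [MeasurableSpace α] [MeasurableSpace β]
    {μ : Measure α} [SFinite μ] {κ : Kernel α β} [IsSFiniteKernel κ] {f : α × β → ℝ}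
    (hf : Integrable f (μ ⊗ₘ κ)) : Integrable (fun a => ∫ b, f (a, b) ∂(κ a)) μ :=
  Integrable.integral_compProd (κ := Kernel.const Unit μ) (η := Kernel.prodMkLeft Unit κ)
    (a := ()) hf

/-! ### Strong convergence of correlation measures -/

section StrongConvergence

variable {d N : ℕ} {p : ℝ≥0∞} {D : Set (Space d)} {T : ℝ} [Fact (1 ≤ p)] [Fact (p ≠ ∞)]

variable [IsFiniteMeasure ((volume : Measure (Space d)).restrict D)]

instance (k : ℕ) : SFinite (volPow D k) :=
  have : SigmaFinite (volPow D k) := IsFiniteMeasure.toSigmaFinite _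
  inferInstance

lemma lintegral_rep_rpow (hD : MeasurableSet D) (u : LpState N p D) :
    ∫⁻ x in D, ‖rep u x‖ₑ ^ p.toReal = ‖u‖ₑ ^ p.toReal := by
  rw [enorm_lpState_rpow]
  refine lintegral_congr_ae ?_
  filter_upwards [rep_ae_eq hD u] with x hx
  rw [hx]

lemma lintegral_rep_sub_rpow (hD : MeasurableSet D) (u v : LpState N p D) :
    (∫⁻ x in D, ‖rep u x - rep v x‖ₑ ^ p.toReal) ^ (1 / p.toReal) = edist u v := by
  have hp := one_le_toReal p
  have h : ∫⁻ x in D, ‖rep u x - rep v x‖ₑ ^ p.toReal = ‖u - v‖ₑ ^ p.toReal := by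
    rw [enorm_lpState_rpow]
    refine lintegral_congr_ae ?_
    filter_upwards [rep_ae_eq hD u, rep_ae_eq hD v, Lp.coeFn_sub u v] with x hu hv hx
    rw [hu, hv, hx, Pi.sub_apply]
  rw [h, ← ENNReal.rpow_mul, mul_one_div_cancel (by linarith), ENNReal.rpow_one,
    edist_eq_enorm_sub]

lemma measurable_apply_repTuple {k : ℕ} {g' : ℝ × (Fin k → Space d) → (Fin k → State N) → ℝ}
    (hg' : Measurable fun q : (ℝ × (Fin k → Space d)) × (Fin k → State N) => g' q.1 q.2) :
    Measurable fun z : (ℝ × (Fin k → Space d)) × LpState N p D =>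
      g' z.1 (repTuple z.2 z.1.2) := by
  have h1 : Measurable fun z : (ℝ × (Fin k → Space d)) × LpState N p D => (z.2, z.1.2) := by
    fun_prop
  have h2 := (measurable_repTuple (N := N) (p := p) (D := D) k).comp h1
  have h3 := hg'.comp (measurable_fst.prodMk h2)
  exact h3

lemma IsObservable.exists_lintegral_repTuple_le (hD : MeasurableSet D) {k : ℕ}
    {g : ℝ → (Fin k → Space d) → (Fin k → State N) → ℝ} (hg : IsObservable p D T k g) (R : ℝ) :
    ∃ B : ℝ≥0, ∀ᵐ t ∂(timeVol T), ∀ u : LpState N p D, ‖u‖ ≤ R →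
      ∫⁻ x, ‖g t x (repTuple u x)‖ₑ ∂(volPow D k) ≤ B := by
  obtain ⟨B, hB⟩ := hg.exists_lintegral_le (R.toNNReal ^ p.toReal)
  refine ⟨B, ?_⟩
  filter_upwards [hB] with t ht u hu
  refine ht (rep u) (measurable_rep_comp measurable_const measurable_id) ?_
  rw [lintegral_rep_rpow hD, ENNReal.coe_rpow_of_nonneg _ ENNReal.toReal_nonneg, ← ofReal_norm]
  exact ENNReal.rpow_le_rpow (ENNReal.ofReal_le_ofReal hu) ENNReal.toReal_nonneg

lemma IsLipObservable.exists_lintegral_repTuple_sub_le (hD : MeasurableSet D) {k : ℕ}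
    {g : ℝ → (Fin (k + 1) → Space d) → (Fin (k + 1) → State N) → ℝ}
    (hg : IsLipObservable p D T k g) (R : ℝ) :
    ∃ L : ℝ≥0, ∀ᵐ t ∂(timeVol T), ∀ u v : LpState N p D, ‖u‖ ≤ R → ‖v‖ ≤ R →
      ∫⁻ x, ‖g t x (repTuple u x) - g t x (repTuple v x)‖ₑ ∂(volPow D (k + 1))
        ≤ L * edist u v := by
  obtain ⟨L, hL⟩ := hg.exists_lintegral_sub_le (R.toNNReal ^ p.toReal)
  have hb : ∀ u : LpState N p D, ‖u‖ ≤ R →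
      ∫⁻ x in D, ‖rep u x‖ₑ ^ p.toReal ≤ (R.toNNReal ^ p.toReal : ℝ≥0) := fun u hu => by
    rw [lintegral_rep_rpow hD, ENNReal.coe_rpow_of_nonneg _ ENNReal.toReal_nonneg, ← ofReal_norm]
    exact ENNReal.rpow_le_rpow (ENNReal.ofReal_le_ofReal hu) ENNReal.toReal_nonneg
  refine ⟨L, ?_⟩
  filter_upwards [hL] with t ht u v hu hv
  rw [← lintegral_rep_sub_rpow hD]
  exact ht (rep u) (rep v) (measurable_rep_comp measurable_const measurable_id)
    (measurable_rep_comp measurable_const measurable_id) (hb u hu) (hb v hv)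

/-- After Tonelli the pairing is an expectation of integrals of `g` along `u`, and these are bounded
on the ball that carries the kernel. -/
lemma IsObservable.obsIntegrable (hD : MeasurableSet D) {k : ℕ}
    {g : ℝ → (Fin k → Space d) → (Fin k → State N) → ℝ} (hg : IsObservable p D T k g)
    (κ : Kernel ℝ (LpState N p D)) [IsMarkovKernel κ] {R : ℝ}
    (hκ : ∀ᵐ t ∂(timeVol T), ∀ᵐ u ∂(κ t), ‖u‖ ≤ R) :
    ObsIntegrable D T k g fun k t => pointLaw (κ t) k := by
  obtain ⟨B, hB⟩ := hg.exists_lintegral_repTuple_le (N := N) hD R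
  obtain ⟨g', hg'm, hg'⟩ := hg.exists_measurable
  have hGm := measurable_apply_repTuple (p := p) (D := D) hg'm
  refine (lintegral_mono_ae (g := fun _ => (B : ℝ≥0∞)) ?_).trans_lt ?_
  · filter_upwards [hκ, hB, Measure.ae_ae_of_ae_prod hg'] with t ht htB htg
    have hGt : Measurable (Function.uncurry fun (x : Fin k → Space d) (u : LpState N p D) =>
        ‖g' (t, x) (repTuple u x)‖ₑ) := by
      have h1 : Measurable fun z : (Fin k → Space d) × LpState N p D => ((t, z.1), z.2) := by
        fun_prop
      exact (hGm.comp h1).enorm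
    calc ∫⁻ x, ∫⁻ ξ, ‖g t x ξ‖ₑ ∂(pointLaw (κ t) k x) ∂(volPow D k)
        = ∫⁻ x, ∫⁻ u, ‖g' (t, x) (repTuple u x)‖ₑ ∂(κ t) ∂(volPow D k) := by
          refine lintegral_congr_ae ?_
          filter_upwards [htg] with x hx
          have h2 : Measurable fun ξ => ‖g' (t, x) ξ‖ₑ :=
            (hg'm.comp (measurable_prodMk_left (x := (t, x)))).enorm
          simp only [hx]
          exact lintegral_pointLaw (κ t) x h2
      _ = ∫⁻ u, ∫⁻ x, ‖g' (t, x) (repTuple u x)‖ₑ ∂(volPow D k) ∂(κ t) :=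
          lintegral_lintegral_swap hGt.aemeasurable
      _ ≤ ∫⁻ _, B ∂(κ t) := by
          refine lintegral_mono_ae ?_
          filter_upwards [ht] with u hu
          refine le_trans (le_of_eq (lintegral_congr_ae ?_)) (htB u hu)
          filter_upwards [htg] with x hx
          rw [hx]
      _ = B := by simp
  · rw [lintegral_const]
    exact ENNReal.mul_lt_top ENNReal.coe_lt_top (measure_lt_top _ _)

/-- Weak convergence of the space-time measures with tight time averages implies the convergence
of the correlation measures in the strong sense. -/
lemma IsLipObservable.tendsto_of_weak (hD : MeasurableSet D) {k : ℕ}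
    {g : ℝ → (Fin (k + 1) → Space d) → (Fin (k + 1) → State N) → ℝ}
    (hg : IsLipObservable p D T k g) {κ : ℕ → Kernel ℝ (LpState N p D)}
    [∀ n, IsMarkovKernel (κ n)] {κ' : Kernel ℝ (LpState N p D)} [IsMarkovKernel κ'] {R : ℝ}
    (hκ : ∀ n, ∀ᵐ t ∂(timeVol T), ∀ᵐ u ∂(κ n t), ‖u‖ ≤ R)
    (hκ' : ∀ᵐ t ∂(timeVol T), ∀ᵐ u ∂(κ' t), ‖u‖ ≤ R)
    (ht : IsTightMeasureSet (range fun n => (timeVol T ⊗ₘ κ n).snd))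
    (hconv : ∀ F : ℝ × LpState N p D →ᵇ ℝ, Tendsto (fun n => ∫ q, F q ∂(timeVol T ⊗ₘ κ n)) atTop
      (𝓝 (∫ q, F q ∂(timeVol T ⊗ₘ κ')))) :
    Tendsto (fun n => ∫⁻ x, ‖∫ t, ((∫ ξ, g t x ξ ∂(pointLaw (κ n t) (k + 1) x))
      - ∫ ξ, g t x ξ ∂(pointLaw (κ' t) (k + 1) x)) ∂(timeVol T)‖ₑ ∂(volPow D (k + 1)))
      atTop (𝓝 0) := by
  obtain ⟨B, hB⟩ := hg.1.exists_lintegral_repTuple_le (N := N) hD R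
  obtain ⟨L, hL⟩ := hg.exists_lintegral_repTuple_sub_le hD R
  obtain ⟨g', hg'm, hg'⟩ := hg.1.exists_measurable
  have hGm := measurable_apply_repTuple (p := p) (D := D) hg'm
  set S : Set (LpState N p D) := Metric.closedBall 0 R
  have hmem : ∀ {η : Kernel ℝ (LpState N p D)} [IsMarkovKernel η],
      (∀ᵐ t ∂(timeVol T), ∀ᵐ u ∂(η t), ‖u‖ ≤ R) → ∀ᵐ q ∂(timeVol T ⊗ₘ η), q.2 ∈ S := by
    intro η _ h
    refine Measure.ae_compProd_of_ae_ae (measurable_snd Metric.isClosed_closedBall.measurableSet) ?_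
    simpa [S] using h
  have hfst : ∀ (η : Kernel ℝ (LpState N p D)) [IsMarkovKernel η],
      (timeVol T ⊗ₘ η).fst = timeVol T := fun η _ => Measure.fst_compProd _ _
  have hg'ae := Measure.ae_ae_of_ae_prod hg'
  have hB' : ∀ᵐ t ∂(timeVol T), ∀ u ∈ S,
      ∫⁻ x, ‖g' (t, x) (repTuple u x)‖ₑ ∂(volPow D (k + 1)) ≤ B := by
    filter_upwards [hB, hg'ae] with t htB htg u hu
    refine le_trans (le_of_eq (lintegral_congr_ae ?_)) (htB u (by simpa [S] using hu))
    filter_upwards [htg] with x hx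
    rw [hx]
  have hL' : ∀ᵐ t ∂(timeVol T), ∀ u ∈ S, ∀ v ∈ S,
      ∫⁻ x, ‖g' (t, x) (repTuple u x) - g' (t, x) (repTuple v x)‖ₑ ∂(volPow D (k + 1))
        ≤ L * edist u v := by
    filter_upwards [hL, hg'ae] with t htL htg u hu v hv
    refine le_trans (le_of_eq (lintegral_congr_ae ?_))
      (htL u v (by simpa [S] using hu) (by simpa [S] using hv))
    filter_upwards [htg] with x hx
    rw [hx]
  -- The abstract result with `X = L^p`, `S` the closed ball of radius `R`, and `G` the measurable
  -- version of `g` evaluated along `u`. The remaining steps translate joint integrals into iterated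
  -- ones and undo the change of version.
  have hmain := tendsto_lintegral_enorm_integral_sub (V := volPow D (k + 1))
    (G := fun z u => g' z (repTuple u z.2)) (fun n => hfst (κ n)) (hfst κ') hconv ht
    isTightMeasureSet_singleton Metric.isClosed_closedBall (fun n => hmem (hκ n)) (hmem hκ')
    hGm hB' hL'
  have hint : ∀ (η : Kernel ℝ (LpState N p D)) [IsMarkovKernel η],
      (∀ᵐ t ∂(timeVol T), ∀ᵐ u ∂(η t), ‖u‖ ≤ R) → ∀ᵐ x ∂(volPow D (k + 1)),
        Integrable (fun q : ℝ × LpState N p D => g' (q.1, x) (repTuple q.2 x))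
          (timeVol T ⊗ₘ η) := fun η _ h =>
    ae_lintegral_enorm_lt_top (G := fun x (q : ℝ × LpState N p D) => g' (q.1, x) (repTuple q.2 x))
      (measurable_uncurry_swap (G := fun z (u : LpState N p D) => g' z (repTuple u z.2)) hGm)
      (lintegral_lintegral_enorm_ne_top (G := fun z (u : LpState N p D) => g' z (repTuple u z.2))
        (hfst η) (hmem h) hGm hB')
  have hswap : ∀ᵐ x ∂(volPow D (k + 1)), ∀ᵐ t ∂(timeVol T), g t x = g' (t, x) := by
    have h1 : ∀ᵐ z ∂((volPow D (k + 1)).prod (timeVol T)), g z.2 z.1 = g' (z.2, z.1) :=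
      (Measure.measurePreserving_swap (μ := volPow D (k + 1))
        (ν := timeVol T)).quasiMeasurePreserving.ae hg'
    exact Measure.ae_ae_of_ae_prod h1
  refine hmain.congr fun n => lintegral_congr_ae ?_
  filter_upwards [hint (κ n) (hκ n), hint κ' hκ', hswap] with x h1 h2 h3
  congr 1
  rw [Measure.integral_compProd h1, Measure.integral_compProd h2,
    ← integral_sub (integrable_integral_of_compProd h1) (integrable_integral_of_compProd h2)]
  refine integral_congr_ae ?_
  filter_upwards [h3] with t ht
  have h4 : Measurable (g' (t, x)) := hg'm.comp (measurable_prodMk_left (x := (t, x)))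
  simp only [ht]
  rw [integral_pointLaw _ x h4, integral_pointLaw _ x h4]

end StrongConvergence

/-- Bound every term by the largest one. -/
lemma rpow_finset_sum_le {ι : Type*} (E : Finset ι) (a : ι → ℝ≥0∞) {s : ℝ} (hs : 1 ≤ s) :
    (∑ e ∈ E, a e) ^ s ≤ (E.card : ℝ≥0∞) ^ s * ∑ e ∈ E, a e ^ s := by
  have hs0 : 0 < s := by linarith
  rcases E.eq_empty_or_nonempty with rfl | hne
  · simp [hs0]
  · obtain ⟨e₀, he₀, hmax⟩ := E.exists_max_image a hne
    calc (∑ e ∈ E, a e) ^ s ≤ (E.card * a e₀) ^ s := by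
          gcongr
          simpa using Finset.sum_le_card_nsmul E a _ hmax
      _ = (E.card : ℝ≥0∞) ^ s * a e₀ ^ s := ENNReal.mul_rpow_of_nonneg _ _ hs0.le
      _ ≤ _ := by
          gcongr
          exact Finset.single_le_sum (f := fun e => a e ^ s) (fun _ _ => zero_le) he₀

/-! ### Differences on the lattice -/

section LatticeDifferences

variable {d : ℕ} {E : Type*} [NormedAddCommGroup E]

/-- The `s`-th power of the `ℓ^s` norm of the differences of `v` in the direction `e`. -/
def latticeDiff (s : ℝ) (v : (Fin d → ℤ) → E) (e : Fin d → ℤ) : ℝ≥0∞ :=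
  ∑' i, ‖v (i + e) - v i‖ₑ ^ s

lemma latticeDiff_zero {s : ℝ} (hs : 1 ≤ s) (v : (Fin d → ℤ) → E) : latticeDiff s v 0 = 0 := by
  simp [latticeDiff, show 0 < s by linarith]

lemma latticeDiff_neg (s : ℝ) (v : (Fin d → ℤ) → E) (e : Fin d → ℤ) :
    latticeDiff s v (-e) = latticeDiff s v e := by
  unfold latticeDiff
  rw [← (Equiv.addRight e).tsum_eq]
  refine tsum_congr fun i => ?_
  rw [Equiv.coe_addRight, add_neg_cancel_right, ← enorm_neg, neg_sub]

lemma latticeDiff_add_le {s : ℝ} (hs : 1 ≤ s) (v : (Fin d → ℤ) → E) (e e' : Fin d → ℤ) :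
    latticeDiff s v (e + e') ≤ 2 ^ (s - 1) * (latticeDiff s v e + latticeDiff s v e') := by
  have h : latticeDiff s v e' = ∑' i, ‖v (i + e + e') - v (i + e)‖ₑ ^ s := by
    rw [latticeDiff, ← (Equiv.addRight e).tsum_eq]
    rfl
  rw [h, latticeDiff, latticeDiff, ← ENNReal.tsum_add, ← ENNReal.tsum_mul_left]
  refine ENNReal.tsum_le_tsum fun i => ?_
  calc ‖v (i + (e + e')) - v i‖ₑ ^ s
      ≤ (‖v (i + e) - v i‖ₑ + ‖v (i + e + e') - v (i + e)‖ₑ) ^ s := by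
        gcongr
        rw [show v (i + (e + e')) - v i = (v (i + e) - v i) + (v (i + e + e') - v (i + e)) by
          rw [add_assoc]; abel]
        exact enorm_add_le _ _
    _ ≤ _ := ENNReal.rpow_add_le_mul_rpow_add_rpow _ _ hs

/-- A diagonal neighbour is reached by at most one unit step in each coordinate direction. By shift
invariance of the sum, backward and forward steps cost the same, and each added step costs a factor
`2^(s-1)`. -/
lemma latticeDiff_le_sum {s : ℝ} (hs : 1 ≤ s) (v : (Fin d → ℤ) → E) {e : Fin d → ℤ}
    (he : ∀ m, e m = 0 ∨ e m = 1 ∨ e m = -1) :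
    latticeDiff s v e ≤ ((2 : ℝ≥0∞) ^ (s - 1)) ^ d * ∑ m, latticeDiff s v (Pi.single m 1) := by
  have hc : (1 : ℝ≥0∞) ≤ 2 ^ (s - 1) := by
    simpa using ENNReal.rpow_le_rpow (one_le_two : (1 : ℝ≥0∞) ≤ 2) (by linarith : 0 ≤ s - 1)
  have hsingle : ∀ m, latticeDiff s v (Pi.single m (e m)) ≤ latticeDiff s v (Pi.single m 1) :=
    fun m => by
      rcases he m with h | h | h
      · rw [h, Pi.single_zero, latticeDiff_zero hs]; exact zero_le
      · rw [h]
      · rw [h, Pi.single_neg, latticeDiff_neg]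
  have key : ∀ F : Finset (Fin d), latticeDiff s v (∑ m ∈ F, Pi.single m (e m))
      ≤ ((2 : ℝ≥0∞) ^ (s - 1)) ^ F.card * ∑ m ∈ F, latticeDiff s v (Pi.single m 1) := fun F => by
    induction F using Finset.induction_on with
    | empty => simp [latticeDiff_zero hs]
    | insert a F ha ih =>
      rw [Finset.sum_insert ha, Finset.sum_insert ha, Finset.card_insert_of_notMem ha]
      refine (latticeDiff_add_le hs v _ _).trans ?_
      rw [pow_succ', mul_assoc]
      refine mul_le_mul' le_rfl ?_
      rw [mul_add]
      refine add_le_add ((hsingle a).trans ?_) ih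
      exact le_mul_of_one_le_left zero_le (one_le_pow₀ hc)
  have := key Finset.univ
  rwa [Finset.univ_sum_single, Finset.card_univ, Fintype.card_fin] at this

end LatticeDifferences

/-! ### The modulus at the mesh size -/

namespace Mesh

variable {d : ℕ}

lemma volume_index_preimage_le (M : Mesh d) (i : Fin d → ℤ) :
    volume (M.index ⁻¹' {i}) ≤ ENNReal.ofReal (M.size ^ d) := by
  have h : M.index ⁻¹' {i} ⊆ (WithLp.ofLp : Space d → Fin d → ℝ) ⁻¹'
      (univ.pi fun m => Ico (M.origin m + M.size * i m) (M.origin m + M.size * (i m + 1))) := by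
    rintro x rfl m -
    exact M.index_bounds x m
  refine (measure_mono h).trans (le_of_eq ?_)
  rw [(PiLp.volume_preserving_ofLp (Fin d)).measure_preimage
    (MeasurableSet.univ_pi fun _ => measurableSet_Ico).nullMeasurableSet, Real.volume_pi_Ico]
  have : ∀ m : Fin d, M.origin m + M.size * (i m + 1) - (M.origin m + M.size * i m) = M.size :=
    fun m => by ring
  simp [this, ENNReal.ofReal_pow M.size_pos.le]

lemma lintegral_comp_index_le (M : Mesh d) (D : Set (Space d)) (W : (Fin d → ℤ) → ℝ≥0∞) :
    ∫⁻ x in D, W (M.index x) ≤ ENNReal.ofReal (M.size ^ d) * ∑' i, W i := by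
  refine (setLIntegral_le_lintegral _ _).trans ?_
  have hm : ∀ i, MeasurableSet (M.index ⁻¹' {i}) := fun i =>
    M.measurable_index (measurableSet_singleton i)
  have hu : (⋃ i, M.index ⁻¹' {i}) = univ := by
    ext x; simp
  rw [← setLIntegral_univ, ← hu, lintegral_iUnion hm, ← ENNReal.tsum_mul_left]
  · refine ENNReal.tsum_le_tsum fun i => ?_
    rw [setLIntegral_congr_fun (hm i) (g := fun _ => W i) fun x hx => by rw [show M.index x = i from hx],
      setLIntegral_const, mul_comm]
    exact mul_le_mul' (M.volume_index_preimage_le i) le_rfl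
  · intro i j hij
    refine Set.disjoint_left.2 fun x hi hj => hij ?_
    rw [← show M.index x = i from hi, ← show M.index x = j from hj]

/-- At distance strictly below the mesh size, each coordinate can cross at most one cell face. -/
lemma index_sub_of_dist_lt (M : Mesh d) {x y : Space d} (h : dist y x < M.size) (m : Fin d) :
    -1 ≤ (M.index y - M.index x) m ∧ (M.index y - M.index x) m ≤ 1 := by
  have hs := M.size_pos
  have h1 := M.index_bounds x m
  have h2 := M.index_bounds y m
  have h3 : |(y - x) m| < M.size :=
    (abs_apply_le_norm _ m).trans_lt (by rwa [← dist_eq_norm])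
  rw [PiLp.sub_apply, abs_lt] at h3
  have h4 : M.size * (M.index x m : ℝ) < M.size * (M.index y m + 2) := by linarith
  have h5 : M.size * (M.index y m : ℝ) < M.size * (M.index x m + 2) := by linarith
  have h6 := lt_of_mul_lt_mul_left h4 hs.le
  have h7 := lt_of_mul_lt_mul_left h5 hs.le
  have h8 : M.index x m < M.index y m + 2 := by exact_mod_cast h6
  have h9 : M.index y m < M.index x m + 2 := by exact_mod_cast h7
  rw [Pi.sub_apply]
  constructor <;> linarith

variable {N : ℕ} {p : ℝ≥0∞} {D : Set (Space d)} [Fact (1 ≤ p)] [Fact (p ≠ ∞)]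

lemma enorm_toLpState_rpow_le (M : Mesh d) (hD : Bornology.IsBounded D)
    (v : (Fin d → ℤ) → State N) :
    ‖M.toLpState p hD v‖ₑ ^ p.toReal
      ≤ ENNReal.ofReal (M.size ^ d) * ∑' i, ‖v i‖ₑ ^ p.toReal := by
  rw [enorm_lpState_rpow]
  refine le_trans (le_of_eq (lintegral_congr_ae ?_))
    (M.lintegral_comp_index_le D fun i => ‖v i‖ₑ ^ p.toReal)
  filter_upwards [M.coeFn_toLpState (p := p) hD v] with x hx
  rw [hx]
  rfl

/-- The modulus of continuity at the mesh size is controlled by the differences between neighbours. -/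
lemma exists_modulus_toLpState_le (N : ℕ) (p : ℝ≥0∞) [Fact (1 ≤ p)] [Fact (p ≠ ∞)]
    (hD : MeasurableSet D) (hb : Bornology.IsBounded D) {s : ℝ} (hs : p.toReal ≤ s) :
    ∃ K : ℝ≥0, ∀ (M : Mesh d) (v : (Fin d → ℤ) → State N),
      modulus M.size (M.toLpState p hb v) ^ (s / p.toReal)
        ≤ K * (ENNReal.ofReal (M.size ^ d) * ∑ m, latticeDiff s v (Pi.single m 1)) := by
  have := isFiniteMeasure_restrict_of_isBounded hb
  have hp := one_le_toReal p
  have hs1 : 1 ≤ s := hp.trans hs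
  have hsp : 1 ≤ s / p.toReal := by rwa [le_div_iff₀ (by linarith), one_mul]
  -- Offsets of the neighbours that a ball of radius equal to the mesh size can reach, diagonal ones
  -- included.
  set E : Finset (Fin d → ℤ) := Finset.Icc (-1) 1 with hE
  set K : ℝ≥0∞ := volume D ^ (s / p.toReal - 1) *
    ((E.card : ℝ≥0∞) ^ s * (E.card * ((2 : ℝ≥0∞) ^ (s - 1)) ^ d)) with hK
  have hKt : K ≠ ∞ := by
    refine ENNReal.mul_ne_top (ENNReal.rpow_ne_top_of_nonneg (by linarith) ?_)
      (ENNReal.mul_ne_top (ENNReal.rpow_ne_top_of_nonneg (by linarith) (by simp))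
        (ENNReal.mul_ne_top (by simp) (ENNReal.pow_ne_top (by simp))))
    exact hb.measure_lt_top.ne
  refine ⟨K.toNNReal, fun M v => ?_⟩
  rw [ENNReal.coe_toNNReal hKt]
  set W : (Fin d → ℤ) → ℝ≥0∞ := fun i => ∑ e ∈ E, ‖v (i + e) - v i‖ₑ with hW
  have hWm : Measurable fun x => W (M.index x) :=
    (measurable_of_countable W).comp M.measurable_index
  have h1 : modulus M.size (M.toLpState p hb v) ≤ ∫⁻ x in D, W (M.index x) ^ p.toReal := by
    rw [modulus_eq_fnModulus, fnModulus_congr (M.coeFn_toLpState (p := p) hb v)]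
    refine lintegral_mono fun x => ?_
    have hk : Measurable fun y => ballKernel D M.size (x, y) :=
      (measurable_ballKernel hD M.size).comp (measurable_const.prodMk measurable_id)
    calc ∫⁻ y in D, ballKernel D M.size (x, y)
          * ‖M.piecewiseConst v x - M.piecewiseConst v y‖ₑ ^ p.toReal
        ≤ ∫⁻ y in D, ballKernel D M.size (x, y) * W (M.index x) ^ p.toReal := by
          refine lintegral_mono fun y => ?_
          by_cases hxy : y ∈ Metric.ball x M.size
          · simp only
            gcongr
            have hmem : M.index y - M.index x ∈ E := by
              rw [hE, Finset.mem_Icc]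
              have := M.index_sub_of_dist_lt (Metric.mem_ball.1 hxy)
              exact ⟨fun m => (this m).1, fun m => (this m).2⟩
            have hle := Finset.single_le_sum
              (f := fun e => ‖v (M.index x + e) - v (M.index x)‖ₑ) (fun _ _ => zero_le) hmem
            simp only [add_sub_cancel] at hle
            rw [← enorm_neg, neg_sub]
            exact hle
          · simp only
            rw [ballKernel, indicator_of_notMem (by exact hxy)]; simp
      _ = (∫⁻ y in D, ballKernel D M.size (x, y)) * W (M.index x) ^ p.toReal :=
          lintegral_mul_const _ hk
      _ ≤ W (M.index x) ^ p.toReal := mul_le_of_le_one_left zero_le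
          (lintegral_ballKernel_snd_le D M.size x)
  have h2 : ∑' i, W i ^ s ≤ (E.card : ℝ≥0∞) ^ s * (E.card * ((2 : ℝ≥0∞) ^ (s - 1)) ^ d)
      * ∑ m, latticeDiff s v (Pi.single m 1) := by
    calc ∑' i, W i ^ s ≤ ∑' i, (E.card : ℝ≥0∞) ^ s * ∑ e ∈ E, ‖v (i + e) - v i‖ₑ ^ s :=
          ENNReal.tsum_le_tsum fun i => rpow_finset_sum_le E _ hs1
      _ = (E.card : ℝ≥0∞) ^ s * ∑ e ∈ E, latticeDiff s v e := by
          rw [ENNReal.tsum_mul_left, Summable.tsum_finsetSum fun _ _ => ENNReal.summable]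
          rfl
      _ ≤ (E.card : ℝ≥0∞) ^ s * ∑ e ∈ E, (((2 : ℝ≥0∞) ^ (s - 1)) ^ d
            * ∑ m, latticeDiff s v (Pi.single m 1)) := by
          gcongr with e he
          refine latticeDiff_le_sum hs1 v fun m => ?_
          rw [hE, Finset.mem_Icc] at he
          have ha := he.1 m
          have hb' := he.2 m
          simp only [Pi.neg_apply, Pi.one_apply] at ha hb'
          omega
      _ = _ := by
          rw [Finset.sum_const, nsmul_eq_mul]
          ring
  calc modulus M.size (M.toLpState p hb v) ^ (s / p.toReal)
      ≤ (∫⁻ x in D, W (M.index x) ^ p.toReal) ^ (s / p.toReal) :=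
        ENNReal.rpow_le_rpow h1 (by linarith)
    -- Jensen with exponent `s/p ≥ 1` passes from `p`-th powers to the `s`-th powers controlled by
    -- the weak BV bound.
    _ ≤ volume D ^ (s / p.toReal - 1) * ∫⁻ x in D, (W (M.index x) ^ p.toReal) ^ (s / p.toReal) := by
        have := rpow_lintegral_le hsp (hWm.pow_const p.toReal).aemeasurable
          (μ := volume.restrict D)
        rwa [Measure.restrict_apply_univ] at this
    _ = volume D ^ (s / p.toReal - 1) * ∫⁻ x in D, W (M.index x) ^ s := by
        simp_rw [← ENNReal.rpow_mul, mul_div_cancel₀ s (by linarith : p.toReal ≠ 0)]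
    _ ≤ volume D ^ (s / p.toReal - 1) * (ENNReal.ofReal (M.size ^ d) *
          ((E.card : ℝ≥0∞) ^ s * (E.card * ((2 : ℝ≥0∞) ^ (s - 1)) ^ d)
            * ∑ m, latticeDiff s v (Pi.single m 1))) := by
        gcongr
        exact (M.lintegral_comp_index_le D fun i => W i ^ s).trans (mul_le_mul' le_rfl h2)
    _ = _ := by
        rw [hK]
        ring

end Mesh

/-- Only finitely many cells meet the bounded set `D`, so convergence of each cell value is uniform
there. -/
lemma Mesh.tendsto_toLpState {d N : ℕ} {p : ℝ≥0∞} [Fact (1 ≤ p)] {D : Set (Space d)}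
    (hDm : MeasurableSet D) (hb : Bornology.IsBounded D) (M : Mesh d) {α : Type*} {l : Filter α}
    {v : α → (Fin d → ℤ) → State N} {w : (Fin d → ℤ) → State N}
    (h : ∀ i, Tendsto (fun a => v a i) l (𝓝 (w i))) :
    Tendsto (fun a => M.toLpState p hb (v a)) l (𝓝 (M.toLpState p hb w)) := by
  have := isFiniteMeasure_restrict_of_isBounded hb
  set c : ℝ := measureUnivNNReal ((volume : Measure (Space d)).restrict D) ^ p.toReal⁻¹
  have hc : 0 ≤ c := by positivity
  rw [Metric.tendsto_nhds]
  intro ε hε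
  have hδ : 0 < ε / (c + 1) := by positivity
  have hev : ∀ᶠ a in l, ∀ i ∈ M.index '' D, dist (v a i) (w i) < ε / (c + 1) :=
    (eventually_all_finite (M.finite_index_image hb)).2 fun i _ =>
      Metric.tendsto_nhds.1 (h i) _ hδ
  filter_upwards [hev] with a ha
  rw [dist_eq_norm]
  refine (M.norm_toLpState_sub_le hb hDm hδ.le fun i hi => ?_).trans_lt ?_
  · rw [← dist_eq_norm]; exact (ha i hi).le
  · change c * (ε / (c + 1)) < ε
    rw [mul_div_assoc', div_lt_iff₀ (by positivity)]
    nlinarith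

lemma Mesh.continuous_cellAverage {d N : ℕ} {p : ℝ≥0∞} [Fact (1 ≤ p)] {D : Set (Space d)}
    [IsFiniteMeasure ((volume : Measure (Space d)).restrict D)] (M : Mesh d) (i : Fin d → ℤ) :
    Continuous fun u : LpState N p D => M.cellAverage u i := by
  by_cases hi : i ∈ M.interior D
  · have h : ∀ u : LpState N p D, M.cellAverage u i = (volume.real (M.cell i))⁻¹ •
        ∫ x in M.cell i, u x ∂((volume : Measure (Space d)).restrict D) := fun u => by
      rw [M.cellAverage_of_mem u hi, setAverage_eq,
        Measure.restrict_restrict (M.isOpen_cell i).measurableSet, inter_eq_left.2 hi]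
    simp_rw [h]
    have hc := continuous_setIntegral_lpState (N := N) (p := p) (D := D) (M.cell i)
    exact hc.const_smul (volume.real (M.cell i))⁻¹
  · simp_rw [fun u : LpState N p D => M.cellAverage_of_notMem u hi]
    exact continuous_const

/-! ### Stability of the scheme and measurability of the solution operator -/

namespace FVScheme

variable {d N q : ℕ} {D : Set (Space d)} {f : Fin d → State N → State N}

/-- The time derivative of the cell values prescribed by the scheme. -/
def rate (S : FVScheme D f q) (v : (Fin d → ℤ) → State N) (i : Fin d → ℤ) : State N :=
  -∑ m, (1 / S.mesh.size) • (S.faceFlux v m i - S.faceFlux v m (i - Pi.single m 1))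

/-- Two sets of cell values that are compatible with the boundary treatment, bounded by `K`, and
`δ`-close in the interior cells. -/
structure IsClose (S : FVScheme D f q) (K δ : ℝ) (v w : (Fin d → ℤ) → State N) : Prop where
  norm_left : ∀ j, ‖v j‖ ≤ K
  norm_right : ∀ j, ‖w j‖ ≤ K
  ghost_left : S.ghost v = v
  ghost_right : S.ghost w = w
  nonneg : 0 ≤ δ
  close : ∀ j ∈ S.mesh.interior D, ‖v j - w j‖ ≤ δ

/-- Compatible values are fixed by the boundary treatment, so closeness in the interior cells
propagates to any given cell, with a constant depending on the cell. -/
lemma exists_sub_le (S : FVScheme D f q) (K : ℝ) (j : Fin d → ℤ) :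
    ∃ L : ℝ≥0, ∀ v w δ, S.IsClose K δ v w → ‖v j - w j‖ ≤ L * δ := by
  obtain ⟨L, hL⟩ := S.ghost_lipschitz K j
  refine ⟨L, fun v w δ h => ?_⟩
  have := hL v w (fun j _ => h.norm_left j) (fun j _ => h.norm_right j) δ h.nonneg h.close
  rwa [h.ghost_left, h.ghost_right] at this

lemma exists_faceFlux_sub_le (S : FVScheme D f q) (K : ℝ) (m : Fin d) (i : Fin d → ℤ) :
    ∃ L : ℝ≥0, ∀ v w δ, S.IsClose K δ v w →
      ‖S.faceFlux v m i - S.faceFlux w m i‖ ≤ L * δ := by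
  obtain ⟨L₁, hL₁⟩ := S.flux_lipschitz m {ξ | ∀ j, ‖ξ j‖ ≤ K} (by
    refine isBounded_iff_forall_norm_le.2 ⟨max K 0, fun ξ hξ => ?_⟩
    exact (pi_norm_le_iff_of_nonneg (le_max_right _ _)).2 fun j => (hξ j).trans (le_max_left _ _))
  choose L hL using S.exists_sub_le K
  set stencil : Fin (2 * q) → Fin d → ℤ := fun j => i + Pi.single m ((j : ℤ) - ((q : ℤ) - 1))
  refine ⟨L₁ * ∑ j, L (stencil j), fun v w δ h => ?_⟩
  have h1 := hL₁.dist_le_mul (fun j => v (stencil j)) (fun j => h.norm_left _)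
    (fun j => w (stencil j)) (fun j => h.norm_right _)
  rw [dist_eq_norm, dist_eq_norm] at h1
  refine h1.trans ?_
  push_cast
  rw [mul_assoc]
  refine mul_le_mul_of_nonneg_left ?_ L₁.coe_nonneg
  have hδ := h.nonneg
  refine (pi_norm_le_iff_of_nonneg (by positivity)).2 fun j => ?_
  refine (hL (stencil j) v w δ h).trans ?_
  refine mul_le_mul_of_nonneg_right ?_ hδ
  exact Finset.single_le_sum (f := fun j => (L (stencil j) : ℝ)) (fun _ _ => NNReal.coe_nonneg _)
    (Finset.mem_univ j)

/-- The constants of the stencil cells are made uniform by the finiteness of the set of interior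
cells. -/
lemma exists_rate_sub_le (S : FVScheme D f q) (hb : Bornology.IsBounded D) (K : ℝ) :
    ∃ L : ℝ≥0, ∀ v w δ, S.IsClose K δ v w → ∀ i ∈ S.mesh.interior D,
      ‖S.rate v i - S.rate w i‖ ≤ L * δ := by
  have hs := S.mesh.size_pos
  choose L hL using fun m i => S.exists_faceFlux_sub_le K m i
  set B : (Fin d → ℤ) → ℝ≥0 := fun i =>
    ∑ m, (1 / S.mesh.size).toNNReal * (L m i + L m (i - Pi.single m 1)) with hB
  obtain ⟨C, hC⟩ := ((S.mesh.finite_interior hb).image B).bddAbove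
  refine ⟨C, fun v w δ h i hi => ?_⟩
  have hδ := h.nonneg
  refine le_trans ?_ (mul_le_mul_of_nonneg_right (NNReal.coe_le_coe.2 (hC ⟨i, hi, rfl⟩)) hδ)
  have e : S.rate v i - S.rate w i = -∑ m, (1 / S.mesh.size) •
      ((S.faceFlux v m i - S.faceFlux w m i)
        - (S.faceFlux v m (i - Pi.single m 1) - S.faceFlux w m (i - Pi.single m 1))) := by
    unfold rate
    rw [← neg_sub', ← Finset.sum_sub_distrib]
    congr 1
    refine Finset.sum_congr rfl fun m _ => ?_
    rw [← smul_sub]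
    congr 1
    abel
  rw [e, norm_neg, hB]
  push_cast
  rw [Finset.sum_mul]
  refine (norm_sum_le _ _).trans (Finset.sum_le_sum fun m _ => ?_)
  rw [norm_smul, Real.norm_of_nonneg (by positivity), Real.coe_toNNReal _ (by positivity), mul_assoc]
  refine mul_le_mul_of_nonneg_left ?_ (by positivity)
  rw [add_mul]
  exact (norm_sub_le _ _).trans (add_le_add (hL m _ v w δ h) (hL m _ v w δ h))

variable {p : ℝ≥0∞} {S : FVScheme D f q} {T : ℝ}

/-- Stability of the scheme with respect to the initial data. -/
lemma IsSolution.norm_sub_le {ubar vbar : LpState N p D} {u v : ℝ → (Fin d → ℤ) → State N}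
    (hu : S.IsSolution T ubar u) (hv : S.IsSolution T vbar v) (hb : Bornology.IsBounded D)
    {K : ℝ} (hKu : ∀ t ∈ Ico 0 T, ∀ i, ‖u t i‖ ≤ K) (hKv : ∀ t ∈ Ico 0 T, ∀ i, ‖v t i‖ ≤ K)
    {L : ℝ≥0} (hL : ∀ v w δ, S.IsClose K δ v w → ∀ i ∈ S.mesh.interior D,
      ‖S.rate v i - S.rate w i‖ ≤ L * δ) {δ : ℝ} (hδ : 0 ≤ δ)
    (hinit : ∀ i ∈ S.mesh.interior D,
      ‖S.mesh.cellAverage ubar i - S.mesh.cellAverage vbar i‖ ≤ δ) {t : ℝ} (ht : t ∈ Ico 0 T)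
    {i : Fin d → ℤ} (hi : i ∈ S.mesh.interior D) :
    ‖u t i - v t i‖ ≤ δ * Real.exp (L * t) := by
  have : Fintype (S.mesh.interior D) := (S.mesh.finite_interior hb).fintype
  let w : ℝ → S.mesh.interior D → State N := fun τ j => u τ j - v τ j
  let w' : ℝ → S.mesh.interior D → State N := fun τ j => S.rate (u τ) j - S.rate (v τ) j
  have hder : ∀ τ ∈ Ico 0 T, HasDerivWithinAt w (w' τ) (Ico 0 T) τ := fun τ hτ =>
    hasDerivWithinAt_pi.2 fun j => (hu.ode τ hτ j j.2).sub (hv.ode τ hτ j j.2)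
  -- Gronwall for the finite vector of interior differences in the sup norm; the exterior values
  -- enter only through the Lipschitz bound on the rate, applied with `δ = ‖w τ‖`.
  have h := norm_le_gronwallBound_of_norm_deriv_right_le (f := w) (f' := w') (δ := δ) (K := L)
    (ε := 0) (a := 0) (b := t) (fun τ hτ => ?_) (fun τ hτ => ?_) ?_ (fun τ hτ => ?_) t
    (right_mem_Icc.2 ht.1)
  · rw [gronwallBound_ε0, sub_zero] at h
    exact (norm_le_pi_norm (w t) ⟨i, hi⟩).trans h
  · have hτ' : τ ∈ Ico 0 T := ⟨hτ.1, hτ.2.trans_lt ht.2⟩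
    exact (hder τ hτ').continuousWithinAt.mono fun x hx => ⟨hx.1, hx.2.trans_lt ht.2⟩
  · have hτ' : τ ∈ Ico 0 T := ⟨hτ.1, hτ.2.trans ht.2⟩
    refine (hder τ hτ').mono_of_mem_nhdsWithin ?_
    exact mem_of_superset (Ico_mem_nhdsGE hτ'.2) fun x hx => ⟨hτ.1.trans hx.1, hx.2⟩
  · refine (pi_norm_le_iff_of_nonneg hδ).2 fun j => ?_
    simp only [w]
    rw [hu.init j j.2, hv.init j j.2]
    exact hinit j j.2
  · have hτ' : τ ∈ Ico 0 T := ⟨hτ.1, hτ.2.trans ht.2⟩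
    rw [add_zero]
    refine (pi_norm_le_iff_of_nonneg (by positivity)).2 fun j => ?_
    exact hL (u τ) (v τ) ‖w τ‖ ⟨hKu τ hτ', hKv τ hτ', hu.boundary τ hτ', hv.boundary τ hτ',
      norm_nonneg _, fun k hk => norm_le_pi_norm (w τ) ⟨k, hk⟩⟩ j j.2

variable [Fact (1 ≤ p)] [Fact (p ≠ ∞)] {sol : LpState N p D → ℝ → (Fin d → ℤ) → State N}

/-- On a fixed mesh an `ℓ^p` bound controls every single value. The constant degenerates as the mesh
is refined; it only places solutions in a bounded set where the fluxes are Lipschitz. -/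
lemma exists_norm_le_of_lpBound {M : Mesh d} {C : ℝ≥0}
    (hLp : ∀ t ∈ Ico 0 T, ∀ ubar : LpState N p D,
      ENNReal.ofReal (M.size ^ d) * ∑' i, ‖sol ubar t i‖ₑ ^ p.toReal
        ≤ C * (ENNReal.ofReal (M.size ^ d) * ∑' i, ‖M.cellAverage ubar i‖ₑ ^ p.toReal))
    (hb : Bornology.IsBounded D) (ρ : ℝ) :
    ∃ K : ℝ, ∀ ubar, ‖ubar‖ ≤ ρ → ∀ t ∈ Ico 0 T, ∀ i, ‖sol ubar t i‖ ≤ K := by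
  have := isFiniteMeasure_restrict_of_isBounded hb
  have hp := one_le_toReal p
  have hpos : 0 < M.size ^ d := pow_pos M.size_pos d
  set A : ℝ≥0∞ := (C * ENNReal.ofReal ρ ^ p.toReal) / ENNReal.ofReal (M.size ^ d) with hA
  have hAt : A ^ (1 / p.toReal) ≠ ∞ := by
    refine ENNReal.rpow_ne_top_of_nonneg (by positivity) (ENNReal.div_ne_top ?_ (by simpa using hpos))
    exact ENNReal.mul_ne_top ENNReal.coe_ne_top
      (ENNReal.rpow_ne_top_of_nonneg (by linarith) ENNReal.ofReal_ne_top)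
  refine ⟨(A ^ (1 / p.toReal)).toReal, fun ubar hubar t ht i => ?_⟩
  have h1 : ‖sol ubar t i‖ₑ ^ p.toReal ≤ A := by
    rw [hA, ENNReal.le_div_iff_mul_le (Or.inl (by simpa using hpos)) (Or.inl ENNReal.ofReal_ne_top),
      mul_comm]
    calc ENNReal.ofReal (M.size ^ d) * ‖sol ubar t i‖ₑ ^ p.toReal
        ≤ ENNReal.ofReal (M.size ^ d) * ∑' i, ‖sol ubar t i‖ₑ ^ p.toReal := by
          gcongr
          exact ENNReal.le_tsum (f := fun i => ‖sol ubar t i‖ₑ ^ p.toReal) i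
      _ ≤ C * ‖ubar‖ₑ ^ p.toReal := (hLp t ht ubar).trans
          (mul_le_mul' le_rfl (M.tsum_cellAverage_rpow_le ubar))
      _ ≤ _ := by
          gcongr
          rw [← ofReal_norm]
          exact ENNReal.ofReal_le_ofReal hubar
  have h2 : ‖sol ubar t i‖ₑ ≤ A ^ (1 / p.toReal) := by
    have := ENNReal.rpow_le_rpow h1 (by positivity : 0 ≤ 1 / p.toReal)
    rwa [← ENNReal.rpow_mul, mul_one_div_cancel (by linarith), ENNReal.rpow_one] at this
  have h3 := ENNReal.toReal_mono hAt h2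
  rwa [toReal_enorm] at h3

lemma norm_toLpState_le_of_lpBound {M : Mesh d} {C : ℝ≥0}
    (hLp : ∀ t ∈ Ico 0 T, ∀ ubar : LpState N p D,
      ENNReal.ofReal (M.size ^ d) * ∑' i, ‖sol ubar t i‖ₑ ^ p.toReal
        ≤ C * (ENNReal.ofReal (M.size ^ d) * ∑' i, ‖M.cellAverage ubar i‖ₑ ^ p.toReal))
    (hb : Bornology.IsBounded D) {t : ℝ} (ht : t ∈ Ico 0 T) (ubar : LpState N p D) :
    ‖M.toLpState p hb (sol ubar t)‖ ≤ C ^ (1 / p.toReal) * ‖ubar‖ := by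
  have := isFiniteMeasure_restrict_of_isBounded hb
  have hp := one_le_toReal p
  have h1 : ‖M.toLpState p hb (sol ubar t)‖ₑ ^ p.toReal ≤ C * ‖ubar‖ₑ ^ p.toReal :=
    (M.enorm_toLpState_rpow_le hb _).trans ((hLp t ht ubar).trans
      (mul_le_mul' le_rfl (M.tsum_cellAverage_rpow_le ubar)))
  have h2 := ENNReal.rpow_le_rpow h1 (by positivity : 0 ≤ 1 / p.toReal)
  rw [ENNReal.mul_rpow_of_nonneg _ _ (by positivity), ← ENNReal.rpow_mul, ← ENNReal.rpow_mul,
    mul_one_div_cancel (by linarith), ENNReal.rpow_one, ENNReal.rpow_one] at h2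
  have ht : (C : ℝ≥0∞) ^ (1 / p.toReal) ≠ ∞ :=
    ENNReal.rpow_ne_top_of_nonneg (by positivity) ENNReal.coe_ne_top
  have h3 := ENNReal.toReal_mono (ENNReal.mul_ne_top ht enorm_ne_top) h2
  rw [ENNReal.toReal_mul, toReal_enorm, toReal_enorm, ← ENNReal.toReal_rpow] at h3
  exact h3

section Measurability

variable {C : ℝ≥0}

/-- Near `u₀` all solutions share one bound, hence one Lipschitz constant. The initial data enter
only through finitely many cell averages, which are continuous on `L^p`, and Gronwall's inequality
concludes. -/
lemma continuous_sol (hsol : ∀ ubar, S.IsSolution T ubar (sol ubar))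
    (hLp : ∀ t ∈ Ico 0 T, ∀ ubar : LpState N p D,
      ENNReal.ofReal (S.mesh.size ^ d) * ∑' i, ‖sol ubar t i‖ₑ ^ p.toReal
        ≤ C * (ENNReal.ofReal (S.mesh.size ^ d)
          * ∑' i, ‖S.mesh.cellAverage ubar i‖ₑ ^ p.toReal))
    (hb : Bornology.IsBounded D) {t : ℝ} (ht : t ∈ Ico 0 T) (j : Fin d → ℤ) :
    Continuous fun ubar => sol ubar t j := by
  have := isFiniteMeasure_restrict_of_isBounded hb
  refine continuous_iff_continuousAt.2 fun u₀ => ?_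
  obtain ⟨K, hK⟩ := exists_norm_le_of_lpBound hLp hb (‖u₀‖ + 1)
  obtain ⟨L, hL⟩ := S.exists_rate_sub_le hb K
  obtain ⟨L', hL'⟩ := S.exists_sub_le K j
  have hfin := S.mesh.finite_interior hb
  let δ : LpState N p D → ℝ := fun u =>
    ∑ i ∈ hfin.toFinset, ‖S.mesh.cellAverage u i - S.mesh.cellAverage u₀ i‖
  have hδ0 : ∀ u, 0 ≤ δ u := fun u => Finset.sum_nonneg fun _ _ => norm_nonneg _
  have hδ : Continuous δ := continuous_finsetSum _ fun i _ =>
    ((S.mesh.continuous_cellAverage i).sub continuous_const).norm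
  have hlim : Tendsto (fun u => L' * (δ u * Real.exp (L * t))) (𝓝 u₀) (𝓝 0) := by
    have h1 : Continuous fun u => L' * (δ u * Real.exp (L * t)) :=
      continuous_const.mul (hδ.mul continuous_const)
    have h2 := h1.tendsto u₀
    simpa [δ] using h2
  refine tendsto_iff_norm_sub_tendsto_zero.2 (squeeze_zero' (Eventually.of_forall fun _ =>
    norm_nonneg _) ?_ hlim)
  have hev : ∀ᶠ u in 𝓝 u₀, ‖u‖ ≤ ‖u₀‖ + 1 := by
    filter_upwards [continuous_norm.continuousAt.eventually (gt_mem_nhds (lt_add_one ‖u₀‖))]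
      with u hu using hu.le
  filter_upwards [hev] with u hu
  have hu₀ : ‖u₀‖ ≤ ‖u₀‖ + 1 := by linarith
  refine hL' _ _ _ ⟨hK u hu t ht, hK u₀ hu₀ t ht, (hsol u).boundary t ht, (hsol u₀).boundary t ht,
    mul_nonneg (hδ0 u) (Real.exp_pos _).le, fun i hi => ?_⟩
  refine (hsol u).norm_sub_le (hsol u₀) hb (hK u hu) (hK u₀ hu₀) hL (hδ0 u) (fun i hi => ?_) ht hi
  exact Finset.single_le_sum
    (f := fun i => ‖S.mesh.cellAverage u i - S.mesh.cellAverage u₀ i‖) (fun _ _ => norm_nonneg _)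
    (hfin.mem_toFinset.2 hi)

/-- Interior values are continuous by the differential equation; exterior ones inherit this from the
boundary treatment. -/
lemma continuousOn_sol (hsol : ∀ ubar, S.IsSolution T ubar (sol ubar))
    (hLp : ∀ t ∈ Ico 0 T, ∀ ubar : LpState N p D,
      ENNReal.ofReal (S.mesh.size ^ d) * ∑' i, ‖sol ubar t i‖ₑ ^ p.toReal
        ≤ C * (ENNReal.ofReal (S.mesh.size ^ d)
          * ∑' i, ‖S.mesh.cellAverage ubar i‖ₑ ^ p.toReal))
    (hb : Bornology.IsBounded D) (ubar : LpState N p D) (j : Fin d → ℤ) :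
    ContinuousOn (fun t => sol ubar t j) (Ico 0 T) := by
  intro t ht
  obtain ⟨K, hK⟩ := exists_norm_le_of_lpBound hLp hb ‖ubar‖
  obtain ⟨L', hL'⟩ := S.exists_sub_le K j
  have hfin := S.mesh.finite_interior hb
  let δ : ℝ → ℝ := fun τ => ∑ i ∈ hfin.toFinset, ‖sol ubar τ i - sol ubar t i‖
  have hδ : Tendsto δ (𝓝[Ico 0 T] t) (𝓝 0) := by
    have h1 : Tendsto δ (𝓝[Ico 0 T] t) (𝓝 (∑ i ∈ hfin.toFinset, (0 : ℝ))) :=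
      tendsto_finsetSum _ fun i hi => by
        have h2 := ((hsol ubar).ode t ht i (hfin.mem_toFinset.1 hi)).continuousWithinAt
        exact tendsto_iff_norm_sub_tendsto_zero.1 h2
    simpa using h1
  have hlim : Tendsto (fun τ => L' * δ τ) (𝓝[Ico 0 T] t) (𝓝 0) := by
    simpa using hδ.const_mul (L' : ℝ)
  refine tendsto_iff_norm_sub_tendsto_zero.2 (squeeze_zero' (Eventually.of_forall fun _ =>
    norm_nonneg _) ?_ hlim)
  filter_upwards [self_mem_nhdsWithin] with τ hτ
  refine hL' _ _ _ ⟨hK ubar le_rfl τ hτ, hK ubar le_rfl t ht, (hsol ubar).boundary τ hτ,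
    (hsol ubar).boundary t ht, Finset.sum_nonneg fun _ _ => norm_nonneg _, fun i hi => ?_⟩
  exact Finset.single_le_sum (f := fun i => ‖sol ubar τ i - sol ubar t i‖)
    (fun _ _ => norm_nonneg _) (hfin.mem_toFinset.2 hi)

open Classical in
/-- The solution operator of the scheme, extended by zero to all times. -/
def solOp (M : Mesh d) (hb : Bornology.IsBounded D) (T : ℝ)
    (sol : LpState N p D → ℝ → (Fin d → ℤ) → State N) (z : ℝ × LpState N p D) : LpState N p D :=
  if z.1 ∈ Ico 0 T then M.toLpState p hb (sol z.2 z.1) else 0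

/-- A Carathéodory argument: continuous in the data for each time, measurable in time for each
datum, with second countable `L^p`. -/
lemma measurable_solOp (hsol : ∀ ubar, S.IsSolution T ubar (sol ubar))
    (hLp : ∀ t ∈ Ico 0 T, ∀ ubar : LpState N p D,
      ENNReal.ofReal (S.mesh.size ^ d) * ∑' i, ‖sol ubar t i‖ₑ ^ p.toReal
        ≤ C * (ENNReal.ofReal (S.mesh.size ^ d)
          * ∑' i, ‖S.mesh.cellAverage ubar i‖ₑ ^ p.toReal))
    (hDm : MeasurableSet D) (hb : Bornology.IsBounded D) :
    Measurable (solOp S.mesh hb T sol) := by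
  have := isFiniteMeasure_restrict_of_isBounded hb
  have hc : ∀ t, Continuous fun u => solOp S.mesh hb T sol (t, u) := fun t => by
    by_cases ht : t ∈ Ico 0 T
    · simp only [solOp, if_pos ht]
      exact continuous_iff_continuousAt.2 fun u₀ => S.mesh.tendsto_toLpState hDm hb fun i =>
        (continuous_sol hsol hLp hb ht i).tendsto u₀
    · simp only [solOp, if_neg ht]
      exact continuous_const
  have hm : ∀ u, Measurable fun t => solOp S.mesh hb T sol (t, u) := fun u => by
    refine measurable_of_restrict_of_restrict_compl (measurableSet_Ico (a := 0) (b := T)) ?_ ?_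
    · have h1 : ContinuousOn (fun t => S.mesh.toLpState p hb (sol u t)) (Ico 0 T) := fun t ht =>
        S.mesh.tendsto_toLpState hDm hb fun i => continuousOn_sol hsol hLp hb u i t ht
      have h2 := (continuousOn_iff_continuous_domRestrict.1 h1).measurable
      convert h2 using 1
      funext t
      simp only [domRestrict_apply, solOp, if_pos t.2]
    · have h2 : Measurable fun _ : ((Ico 0 T)ᶜ : Set ℝ) => (0 : LpState N p D) := measurable_const
      convert h2 using 1
      funext t
      simp only [domRestrict_apply, solOp, if_neg t.2]
  have h := measurable_uncurry_of_continuous_of_measurable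
    (u := fun (u : LpState N p D) (t : ℝ) => solOp S.mesh hb T sol (t, u)) hc hm
  have h2 := h.comp (measurable_swap (α := ℝ) (β := LpState N p D))
  exact h2

end Measurability

end FVScheme

/-! ### Kernels of random maps -/

section RandomKernel

variable {α β γ : Type*} [MeasurableSpace α] [MeasurableSpace β] [MeasurableSpace γ]

/-- The kernel of the laws of `X (a, ·)` under `μ`. -/
def pushKernel (μ : Measure β) (X : α × β → γ) : Kernel α γ := (Kernel.id ×ₖ Kernel.const α μ).map X

lemma pushKernel_apply (μ : Measure β) [SFinite μ] {X : α × β → γ} (hX : Measurable X) (a : α) :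
    pushKernel μ X a = μ.map fun b => X (a, b) := by
  rw [pushKernel, Kernel.map_apply _ hX, Kernel.prod_apply, Kernel.id_apply, Kernel.const_apply,
    Measure.dirac_prod, Measure.map_map hX measurable_prodMk_left]
  rfl

lemma isMarkovKernel_pushKernel (μ : Measure β) [IsProbabilityMeasure μ] {X : α × β → γ}
    (hX : Measurable X) : IsMarkovKernel (pushKernel μ X) :=
  Kernel.IsMarkovKernel.map _ hX

/-- Exchanging time and initial data turns estimates valid for each datum into estimates for the
kernel. -/
lemma lintegral_pushKernel (μ : Measure β) [SFinite μ] (τ : Measure α) [SFinite τ]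
    {X : α × β → γ} (hX : Measurable X) {F : γ → ℝ≥0∞} (hF : Measurable F) :
    ∫⁻ a, ∫⁻ c, F c ∂(pushKernel μ X a) ∂τ = ∫⁻ b, ∫⁻ a, F (X (a, b)) ∂τ ∂μ := by
  have h : ∀ a, ∫⁻ c, F c ∂(pushKernel μ X a) = ∫⁻ b, F (X (a, b)) ∂μ := fun a => by
    have hXa : Measurable fun b => X (a, b) := hX.comp measurable_prodMk_left
    rw [pushKernel_apply μ hX, lintegral_map hF hXa]
  simp_rw [h]
  exact lintegral_lintegral_swap (hF.comp hX).aemeasurable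

end RandomKernel

/-! ### Normalisation of finite measures -/

section Normalization

lemma isTightMeasureSet_range_smul {X : Type*} [TopologicalSpace X] [MeasurableSpace X] {ι : Type*} {m : ι → Measure X}
    (h : IsTightMeasureSet (range m)) {c : ℝ≥0∞} (hc : c ≠ ∞) :
    IsTightMeasureSet (range fun i => c • m i) := by
  rw [isTightMeasureSet_iff_exists_isCompact_measure_compl_le] at h ⊢
  intro ε hε
  -- Dividing by `c + 1` covers `c = 0`.
  obtain ⟨K, hK, hm⟩ := h (ε / (c + 1)) (ENNReal.div_pos hε.ne' (by simpa using hc))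
  refine ⟨K, hK, ?_⟩
  rintro _ ⟨i, rfl⟩
  rw [Measure.smul_apply, smul_eq_mul]
  calc c * m i Kᶜ ≤ (c + 1) * (ε / (c + 1)) := by
        gcongr
        · exact le_self_add
        · exact hm _ ⟨i, rfl⟩
    _ ≤ ε := ENNReal.mul_div_le

variable {X : Type*} [NormedAddCommGroup X] [CompleteSpace X] [SecondCountableTopology X]
  [MeasurableSpace X] [BorelSpace X]

/-- A version of `exists_subseq_tendsto_integral_compProd` for finite measures in time. -/
lemma exists_subseq_tendsto_integral_compProd_of_finite {τ : Measure ℝ} [IsFiniteMeasure τ]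
    (hτ : τ ≠ 0) (κ : ℕ → Kernel ℝ X) [∀ n, IsMarkovKernel (κ n)]
    (ht : IsTightMeasureSet (range fun n => (τ ⊗ₘ κ n).snd)) {R : ℝ}
    (hR : ∀ n, ∀ᵐ t ∂τ, ∀ᵐ u ∂(κ n t), ‖u‖ ≤ R) :
    ∃ φ : ℕ → ℕ, StrictMono φ ∧ ∃ κ' : Kernel ℝ X, IsMarkovKernel κ' ∧
      (∀ᵐ t ∂τ, ∀ᵐ u ∂(κ' t), ‖u‖ ≤ R) ∧
      ∀ F : ℝ × X →ᵇ ℝ, Tendsto (fun n => ∫ q, F q ∂(τ ⊗ₘ κ (φ n))) atTop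
        (𝓝 (∫ q, F q ∂(τ ⊗ₘ κ'))) := by
  have : NeZero τ := ⟨hτ⟩
  set c : ℝ≥0∞ := (τ univ)⁻¹ with hc
  have h0 : τ univ ≠ 0 := NeZero.ne _
  have hct : c ≠ ∞ := by simpa [hc] using hτ
  have hc0 : c ≠ 0 := by simp [hc]
  have hprob : IsProbabilityMeasure (c • τ) := isProbabilityMeasureSMul
  have hac : ∀ {P : ℝ → Prop}, (∀ᵐ t ∂(c • τ), P t) ↔ ∀ᵐ t ∂τ, P t := fun {P} => by
    rw [Measure.ae_ennreal_smul_measure_iff hc0]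
  have hint : ∀ (η : Kernel ℝ X) [IsMarkovKernel η] (F : ℝ × X →ᵇ ℝ),
      ∫ q, F q ∂(τ ⊗ₘ η) = (c.toReal)⁻¹ * ∫ q, F q ∂((c • τ) ⊗ₘ η) := fun η _ F => by
    rw [Measure.compProd_smul_left, integral_smul_measure, smul_eq_mul, ← mul_assoc,
      inv_mul_cancel₀ (ENNReal.toReal_ne_zero.2 ⟨hc0, hct⟩), one_mul]
  have htight : IsTightMeasureSet (range fun n => ((c • τ) ⊗ₘ κ n).snd) := by
    have h := isTightMeasureSet_range_smul ht hct
    have e : ∀ n, ((c • τ) ⊗ₘ κ n).snd = c • (τ ⊗ₘ κ n).snd := fun n => by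
      rw [Measure.compProd_smul_left, Measure.snd, Measure.map_smul, Measure.snd]
    simp_rw [e]
    exact h
  obtain ⟨φ, hφ, κ', hκ', hb, hlim⟩ := exists_subseq_tendsto_integral_compProd (π := c • τ) κ
    htight (fun n => hac.2 (hR n))
  refine ⟨φ, hφ, κ', hκ', hac.1 hb, fun F => ?_⟩
  simp_rw [hint]
  exact (hlim F).const_mul _

end Normalization

/-! ### Estimates uniform in the mesh and conclusion -/

section Convergence

variable {d N : ℕ} {p : ℝ≥0∞} [Fact (1 ≤ p)] {D : Set (Space d)}

/-- Needed because the kernels, built from the solution operator extended by zero, agree with the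
approximate solutions only on `[0,T)`. -/
lemma HasCorrelationMeasure.congr {T : ℝ} {μ μ' : ℝ → Measure (LpState N p D)}
    {ν : TimeCorrFamily d N} (h : HasCorrelationMeasure T μ ν) (he : ∀ t ∈ Ico 0 T, μ t = μ' t) :
    HasCorrelationMeasure T μ' ν where
  prob t ht := he t ht ▸ h.prob t ht
  corr := h.corr
  dual := by
    filter_upwards [h.dual, ae_restrict_mem measurableSet_Ico] with t ht htI
    rw [← he t htI]
    exact ht

/-- Bound for the time-averaged modulus of continuity at the mesh size. -/
lemma exists_lintegral_modulus_solOp_le (N : ℕ) (p : ℝ≥0∞) [Fact (1 ≤ p)] [Fact (p ≠ ∞)]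
    (hD : MeasurableSet D) (hb : Bornology.IsBounded D) (T : ℝ) {s : ℝ} (hs : p.toReal ≤ s)
    (C : ℝ≥0) :
    ∃ K : ℝ≥0, ∀ (M : Mesh d) (sol : LpState N p D → ℝ → (Fin d → ℤ) → State N)
      (ubar : LpState N p D), Measurable (fun t => FVScheme.solOp M hb T sol (t, ubar)) →
      ENNReal.ofReal (M.size ^ d)
          * ∫⁻ t, ∑ m, ∑' i, ‖sol ubar t (i + Pi.single m 1) - sol ubar t i‖ₑ ^ s ∂(timeVol T)
        ≤ C * ENNReal.ofReal M.size →
      ∫⁻ t, modulus M.size (FVScheme.solOp M hb T sol (t, ubar)) ∂(timeVol T)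
        ≤ (K * ENNReal.ofReal M.size) ^ (p.toReal / s) := by
  have := isFiniteMeasure_restrict_of_isBounded hb
  have hp := one_le_toReal p
  have hs0 : 0 < s := by linarith
  have hsp : 1 ≤ s / p.toReal := by rwa [le_div_iff₀ (by linarith), one_mul]
  obtain ⟨K, hK⟩ := Mesh.exists_modulus_toLpState_le N p hD hb hs
  set A : ℝ≥0∞ := timeVol T univ ^ (s / p.toReal - 1)
  have hA : A ≠ ∞ := ENNReal.rpow_ne_top_of_nonneg (by linarith) (measure_ne_top _ _)
  refine ⟨A.toNNReal * K * C, fun M sol ubar hm hBV => ?_⟩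
  have hm' : Measurable fun t => modulus M.size (FVScheme.solOp M hb T sol (t, ubar)) :=
    (measurable_modulus hD M.size).comp hm
  have h1 : (∫⁻ t, modulus M.size (FVScheme.solOp M hb T sol (t, ubar)) ∂(timeVol T))
      ^ (s / p.toReal) ≤ (A.toNNReal * K * C : ℝ≥0) * ENNReal.ofReal M.size := by
    -- Jensen in time, again with exponent `s/p`; the space estimate then applies at each time in
    -- `[0,T)`.
    calc _ ≤ A * ∫⁻ t, modulus M.size (FVScheme.solOp M hb T sol (t, ubar)) ^ (s / p.toReal)
            ∂(timeVol T) := rpow_lintegral_le hsp hm'.aemeasurable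
      _ ≤ A * ∫⁻ t, K * (ENNReal.ofReal (M.size ^ d) *
            ∑ m, ∑' i, ‖sol ubar t (i + Pi.single m 1) - sol ubar t i‖ₑ ^ s) ∂(timeVol T) := by
          refine mul_le_mul' le_rfl (setLIntegral_mono' measurableSet_Ico fun t ht => ?_)
          rw [FVScheme.solOp, if_pos ht]
          exact hK M (sol ubar t)
      _ ≤ A * (K * (C * ENNReal.ofReal M.size)) := by
          rw [lintegral_const_mul' _ _ ENNReal.coe_ne_top,
            lintegral_const_mul' _ _ ENNReal.ofReal_ne_top]
          gcongr
      _ = _ := by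
          push_cast
          rw [ENNReal.coe_toNNReal hA]
          ring
  have h2 := ENNReal.rpow_le_rpow h1 (by positivity : 0 ≤ p.toReal / s)
  rw [← ENNReal.rpow_mul, div_mul_div_cancel₀ (by linarith : p.toReal ≠ 0), div_self hs0.ne',
    ENNReal.rpow_one] at h2
  exact h2

lemma lintegral_snd_compProd {X : Type*} [MeasurableSpace X] {τ : Measure ℝ} [SFinite τ]
    (κ : Kernel ℝ X) [IsSFiniteKernel κ] {F : X → ℝ≥0∞} (hF : Measurable F) :
    ∫⁻ u, F u ∂(τ ⊗ₘ κ).snd = ∫⁻ t, ∫⁻ u, F u ∂(κ t) ∂τ := by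
  rw [Measure.snd, lintegral_map hF measurable_snd,
    Measure.lintegral_compProd (f := fun q : ℝ × X => F q.2) (hF.comp measurable_snd)]

lemma tendsto_scaled_bound (C K : ℝ≥0) (c : ℝ≥0∞) (hc : c ≠ ∞) {p s : ℝ} (hp : 0 < p) (hs : 0 < s) :
    Tendsto (fun r : ℝ => c * (C * (K * ENNReal.ofReal r) ^ (1 / s)) ^ p) (𝓝[>] 0) (𝓝 0) := by
  have h1 : Tendsto (fun r : ℝ => K * ENNReal.ofReal r) (𝓝[>] 0) (𝓝 0) := by
    have h := ENNReal.Tendsto.const_mul (a := (K : ℝ≥0∞))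
      (ENNReal.continuous_ofReal.tendsto (0 : ℝ)) (Or.inr ENNReal.coe_ne_top)
    simpa using h.mono_left nhdsWithin_le_nhds
  have h2 := h1.ennrpow_const (1 / s)
  rw [ENNReal.zero_rpow_of_pos (by positivity)] at h2
  have h3 := ENNReal.Tendsto.const_mul (a := (C : ℝ≥0∞)) h2 (Or.inr ENNReal.coe_ne_top)
  rw [mul_zero] at h3
  have h4 := h3.ennrpow_const p
  rw [ENNReal.zero_rpow_of_pos hp] at h4
  have h5 := ENNReal.Tendsto.const_mul (a := c) h4 (Or.inr hc)
  rwa [mul_zero] at h5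

end Convergence

/-- Compactness of the approximate statistical solutions. -/
theorem exists_subseq_convergesStrongly {d N q : ℕ} {p : ℝ≥0∞} [Fact (1 ≤ p)] [Fact (p ≠ ∞)]
    {D : Set (Space d)} (hD : IsOpen D) (hb : Bornology.IsBounded D) {T : ℝ} (hT : 0 < T)
    {f : Fin d → State N → State N} {μbar : Measure (LpState N p D)} [IsProbabilityMeasure μbar]
    {R : ℝ} (hR : ∀ᵐ u ∂μbar, ‖u‖ ≤ R) {scheme : ℕ → FVScheme D f q}
    (hmesh : Tendsto (fun n => (scheme n).mesh.size) atTop (𝓝 0))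
    {sol : ℕ → LpState N p D → ℝ → (Fin d → ℤ) → State N}
    (hsol : ∀ n ubar, (scheme n).IsSolution T ubar (sol n ubar))
    (hLp : UniformLpBound T (fun n => (scheme n).mesh) sol) {s : ℝ} (hs : p.toReal ≤ s)
    (hBV : WeakBVBound T s (fun n => (scheme n).mesh) sol)
    (hscal : ApproximateScaling T s (fun n => (scheme n).mesh)
      (fun n => approxStatSol (scheme n).mesh hb (sol n) μbar)) :
    ∃ φ : ℕ → ℕ, StrictMono φ ∧ ∃ μ : ℝ → Measure (LpState N p D), MemPT T μ ∧
      ConvergesStrongly T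
        (fun j => approxStatSol (scheme (φ j)).mesh hb (sol (φ j)) μbar) μ := by
  have := isFiniteMeasure_restrict_of_isBounded hb
  have hDm := hD.measurableSet
  have hp := one_le_toReal p
  have hs0 : 0 < s := by linarith
  obtain ⟨C₁, hC₁⟩ := hLp
  obtain ⟨C₂, hC₂⟩ := hBV R
  obtain ⟨C₃, hC₃⟩ := hscal
  obtain ⟨K, hK⟩ := exists_lintegral_modulus_solOp_le N p hDm hb T hs C₂
  have hXm : ∀ n, Measurable (FVScheme.solOp (scheme n).mesh hb T (sol n)) := fun n =>
    FVScheme.measurable_solOp (hsol n) (hC₁ n) hDm hb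
  set κ : ℕ → Kernel ℝ (LpState N p D) := fun n =>
    pushKernel μbar (FVScheme.solOp (scheme n).mesh hb T (sol n)) with hκdef
  have hκapp : ∀ n t, κ n t = μbar.map fun u =>
      FVScheme.solOp (scheme n).mesh hb T (sol n) (t, u) := fun n t =>
    pushKernel_apply μbar (hXm n) t
  have hκM : ∀ n, IsMarkovKernel (κ n) := fun n => isMarkovKernel_pushKernel μbar (hXm n)
  have hκeq : ∀ n, ∀ t ∈ Ico 0 T, κ n t = approxStatSol (scheme n).mesh hb (sol n) μbar t :=
    fun n t ht => by
      rw [hκapp, approxStatSol]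
      simp only [FVScheme.solOp, if_pos ht]
  set R' : ℝ := C₁ ^ (1 / p.toReal) * R with hR'
  have hκb : ∀ n, ∀ᵐ t ∂(timeVol T), ∀ᵐ u ∂(κ n t), ‖u‖ ≤ R' := fun n => by
    filter_upwards [ae_restrict_mem measurableSet_Ico] with t ht
    rw [hκapp]
    refine (ae_map_iff ((hXm n).comp measurable_prodMk_left).aemeasurable
      (measurableSet_le measurable_norm measurable_const)).2 ?_
    filter_upwards [hR] with u hu
    have he : FVScheme.solOp (scheme n).mesh hb T (sol n) (t, u)
        = (scheme n).mesh.toLpState p hb (sol n u t) := if_pos ht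
    rw [Function.comp_apply, he]
    refine (FVScheme.norm_toLpState_le_of_lpBound (hC₁ n) hb ht u).trans ?_
    exact mul_le_mul_of_nonneg_left hu (by positivity)
  set I : ℕ → ℝ → ℝ≥0∞ := fun n r => ∫⁻ t, ∫⁻ u, modulus r u ∂(κ n t) ∂(timeVol T) with hI
  have hstruct : ∀ n r, structureFunction T (approxStatSol (scheme n).mesh hb (sol n) μbar) r
      = I n r ^ (1 / p.toReal) := fun n r => by
    rw [structureFunction, hI]
    congr 1
    refine setLIntegral_congr_fun measurableSet_Ico fun t ht => ?_
    simp only [hκeq n t ht]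
  have hImesh : ∀ n, I n (scheme n).mesh.size
      ≤ (K * ENNReal.ofReal (scheme n).mesh.size) ^ (p.toReal / s) := fun n => by
    rw [hI]
    simp only [hκdef]
    rw [lintegral_pushKernel μbar (timeVol T) (hXm n) (measurable_modulus hDm _)]
    refine (lintegral_mono_ae (g := fun _ =>
      (K * ENNReal.ofReal (scheme n).mesh.size) ^ (p.toReal / s)) ?_).trans (by simp)
    filter_upwards [hR] with u hu
    exact hK (scheme n).mesh (sol n) u ((hXm n).comp measurable_prodMk_right) (hC₂ n u hu)
  -- Scaling with `ℓ = r/Δ`: the factor `(r/Δ)^(1/s)` meets `(K Δ)^(1/s)` and the mesh size cancels.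
  -- This is the uniform modulus behind the compactness.
  have hIr : ∀ n r, (scheme n).mesh.size < r →
      I n r ≤ (C₃ * (K * ENNReal.ofReal r) ^ (1 / s)) ^ p.toReal := fun n r hr => by
    have hΔ := (scheme n).mesh.size_pos
    set Δ := (scheme n).mesh.size
    have h1 := hC₃ n (r / Δ) ((one_lt_div hΔ).2 hr)
    rw [hstruct, hstruct, div_mul_cancel₀ r hΔ.ne'] at h1
    have h2 : I n Δ ^ (1 / p.toReal) ≤ (K * ENNReal.ofReal Δ) ^ (1 / s) := by
      refine (ENNReal.rpow_le_rpow (hImesh n) (by positivity)).trans (le_of_eq ?_)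
      rw [← ENNReal.rpow_mul]
      congr 1
      field_simp
    have h3 : I n r ^ (1 / p.toReal) ≤ C₃ * (K * ENNReal.ofReal r) ^ (1 / s) := by
      refine (h1.trans (mul_le_mul' le_rfl h2)).trans (le_of_eq ?_)
      rw [mul_assoc, ← ENNReal.ofReal_rpow_of_nonneg (div_nonneg (hΔ.le.trans hr.le) hΔ.le)
        (by positivity), ← ENNReal.mul_rpow_of_nonneg _ _ (by positivity)]
      congr 2
      rw [mul_left_comm, ← ENNReal.ofReal_mul (div_nonneg (hΔ.le.trans hr.le) hΔ.le),
        div_mul_cancel₀ r hΔ.ne']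
    have h4 := ENNReal.rpow_le_rpow h3 (by linarith : 0 ≤ p.toReal)
    rwa [← ENNReal.rpow_mul, one_div_mul_cancel (by linarith), ENNReal.rpow_one] at h4
  have hτ : timeVol T univ = ENNReal.ofReal T := by simp [timeVol]
  have hτ0 : timeVol T univ ≠ 0 := by rw [hτ]; simpa using hT
  set c : ℝ≥0∞ := (timeVol T univ)⁻¹ with hc
  have hct : c ≠ ∞ := ENNReal.inv_ne_top.2 hτ0
  have hprob : ∀ n, IsProbabilityMeasure (c • (timeVol T ⊗ₘ κ n).snd) := fun n => by
    refine ⟨?_⟩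
    rw [Measure.smul_apply, Measure.snd_univ, ← Measure.fst_univ, Measure.fst_compProd, hc,
      smul_eq_mul, ENNReal.inv_mul_cancel hτ0 (measure_ne_top _ _)]
  have hsndb : ∀ n, ∀ᵐ u ∂(timeVol T ⊗ₘ κ n).snd, ‖u‖ ≤ R' := fun n => by
    have hset : MeasurableSet {u : LpState N p D | ‖u‖ ≤ R'} :=
      measurableSet_le measurable_norm measurable_const
    refine (ae_map_iff measurable_snd.aemeasurable hset).2 ?_
    exact Measure.ae_compProd_of_ae_ae (measurable_snd hset) (hκb n)
  have htight' : IsTightMeasureSet (range fun n => c • (timeVol T ⊗ₘ κ n).snd) := by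
    refine isTightMeasureSet_range_of_modulus hD hb _
      (fun n => Measure.ae_smul_measure (hsndb n) c) fun ε hε => ?_
    filter_upwards [ENNReal.tendsto_nhds_zero.1 (tendsto_scaled_bound C₃ K c hct
      (by linarith : 0 < p.toReal) hs0) ε hε, self_mem_nhdsWithin] with r hr hr0
    -- The bound at radius `r` needs the mesh size below `r`, which holds for all large `n`; the
    -- tightness criterion asks for no more.
    filter_upwards [hmesh.eventually (gt_mem_nhds hr0)] with n hn
    rw [lintegral_smul_measure, smul_eq_mul, lintegral_snd_compProd (κ n) (measurable_modulus hDm r)]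
    exact (mul_le_mul' le_rfl (hIr n r hn)).trans hr
  have htight : IsTightMeasureSet (range fun n => (timeVol T ⊗ₘ κ n).snd) := by
    have h := isTightMeasureSet_range_smul htight' (measure_ne_top (timeVol T) univ)
    simpa only [smul_smul, hc, ENNReal.mul_inv_cancel hτ0 (measure_ne_top (timeVol T) univ),
      one_smul] using h
  obtain ⟨φ, hφ, κ', hκ', hκ'b, hlim⟩ := exists_subseq_tendsto_integral_compProd_of_finite
    (fun h => hτ0 (by rw [h]; simp)) κ htight hκb
  have hcorr := hasCorrelationMeasure_pointLaw hDm hb κ' hκ'b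
  refine ⟨φ, hφ, fun t => κ' t, ⟨_, hcorr⟩, fun j k t => pointLaw (κ (φ j) t) k,
    fun k t => pointLaw (κ' t) k, fun j => ?_, hcorr, fun k g hg => ⟨fun j => ?_, ?_, ?_⟩⟩
  · exact (hasCorrelationMeasure_pointLaw hDm hb (κ (φ j)) (hκb _)).congr (hκeq (φ j))
  · exact hg.1.obsIntegrable hDm (κ (φ j)) (hκb _)
  · exact hg.1.obsIntegrable hDm κ' hκ'b
  · exact hg.tendsto_of_weak hDm (fun n => hκb (φ n)) hκ'b
      (htight.subset (by rintro _ ⟨n, rfl⟩; exact ⟨φ n, rfl⟩)) hlim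

end StatSol

end

theorem theorem4p1 {d N q : ℕ} (p : ℝ≥0∞) [Fact (1 ≤ p)] (hp : p ≠ ∞)
    (D : Set (StatSol.Space d)) (hD_open : IsOpen D) (hD_conn : IsConnected D)
    (hD_bdd : Bornology.IsBounded D) (T : ℝ) (hT : 0 < T)
    (f : Fin d → StatSol.State N → StatSol.State N)
    (μbar : Measure (StatSol.LpState N p D)) [IsProbabilityMeasure μbar]
    (R : ℝ) (hR : 0 < R) (hsupp : μbar.support ⊆ Metric.closedBall 0 R)
    (scheme : ℕ → StatSol.FVScheme D f q)
    (hmesh : Tendsto (fun n => (scheme n).mesh.size) atTop (𝓝 0))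
    (sol : ℕ → StatSol.LpState N p D → ℝ → (Fin d → ℤ) → StatSol.State N)
    (hsol : ∀ n ubar, (scheme n).IsSolution T ubar (sol n ubar))
    (hLp : StatSol.UniformLpBound T (fun n => (scheme n).mesh) sol)
    (s : ℝ) (hs : p.toReal ≤ s)
    (hBV : StatSol.WeakBVBound T s (fun n => (scheme n).mesh) sol)
    (hscal : StatSol.ApproximateScaling T s (fun n => (scheme n).mesh)
      (fun n => StatSol.approxStatSol (scheme n).mesh hD_bdd (sol n) μbar)) :
    ∃ φ : ℕ → ℕ, StrictMono φ ∧
      ∃ μ : ℝ → Measure (StatSol.LpState N p D), StatSol.MemPT T μ ∧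
        StatSol.ConvergesStrongly T
          (fun j => StatSol.approxStatSol (scheme (φ j)).mesh hD_bdd (sol (φ j)) μbar) μ := by
  have : Fact (p ≠ ∞) := ⟨hp⟩
  exact StatSol.exists_subseq_convergesStrongly hD_open hD_bdd hT
    -- In the second countable space `L^p` the support carries full measure, so the norm bound holds
    -- almost surely.
    (Filter.mem_of_superset Measure.support_mem_ae fun u hu => by simpa using hsupp hu)
    hmesh hsol hLp hs hBV hscal
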